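/- Let $(G_k)_{k\ge 0}$ be finite groups of order at least $2$, let $G=\prod_{k\ge0}G_k$ be their compact product and $\mu$ its normalized Haar measure (the product of the uniform measures). Let $p_k$ be the number of conjugacy classes of $G_k$, and put $P_0=1$, $P_{k+1}=p_kP_k$. Every $n\in\mathbb N$ has a unique expansion $n=\sum_{k\ge0}n_kP_k$ with $0\le n_k\le p_k-1$; for $n\geq 1$ put $|n|=\max\{k:n_k\ne0\}$, and put $n^{(s)}=\sum_{k\ge s}n_kP_k$. For each $k$ let $r_k^0=1,r_k^1,\dots,r_k^{p_k-1}$ be an enumeration of the irreducible complex characters of $G_k$, and let $\chi_n(x)=\prod_{k\ge0}r_k^{n_k}(x_k)$ for $x=(x_k)_k\in G$. For $y\in G$ let $$J_s(y)=\{x\in G:\ x_i \text{ is conjugate to } y_i \text{ in } G_i \text{ for all } 0\le i\le s-1\}.$$ Let $\mathcal M$ be a von Neumann algebra with a normal semifinite faithful trace $\tau$, let $\mathcal N=L_\infty(G,\mu)\,\bar\otimes\,\mathcal M$ with the tensor trace, and identify $L_p(\mathcal N)=L_p(G;L_p(\mathcal M))$ for $p=2,4$. For a family $(x_i)_{i\in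 I}$ in $L_2(\mathcal N)$ let $$\Big\|{\sup_{i\in I}}^{+}x_i\Big\|_2=\|(x_i)_i\|_{L_2(\mathcal N;\ell_\infty(I))}=\inf\Big\{\sup_i\|y_i\|_\infty\,\|a\|_4\|b\|_4:\ x_i=ay_ib\ \ (i\in I),\ a,b\in L_4(\mathcal N),\ (y_i)_i\subset\mathcal N\text{ bounded}\Big\},$$ with $\inf\emptyset=\infty$. Let $A,s\in\mathbb N$ with $A\ge s$, and let $f\in L_2(\mathcal N)$ (in particular, $f$ may be any element of $L_2(\mathcal N)$ that is constant on conjugacy classes). Then, for every $n$ with $|n|=A$, the function $$T_nf(y)=\frac1{\mu(J_s(y))}\int_{J_s(y)}f(x)\,\chi_{n^{(s)}}(y)\,\overline{\chi_{n^{(s)}}(x)}\,d\mu(x)\qquad(y\in G)$$ belongs to $L_2(\mathcal N)$, and $$\Big\|{\sup_{|n|=A}}^{+}T_nf\Big\|_2\le\|f\|_2 .$$ -/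

import Mathlib

open MeasureTheory Filter Topology
open scoped ENNReal NNReal ComplexConjugate

/-! ### Semifinite von Neumann algebras and their noncommutative `L_2`, `L_4` spaces -/

section Trace

variable {H : Type*} [NormedAddCommGroup H] [InnerProductSpace ℂ H] [CompleteSpace H]

/-- A normal semifinite faithful trace on the von Neumann algebra `M`.  It is a function
`M₊ → [0, ∞]`; the values of `toFun` outside the positive cone of `M` are junk and never used. -/
structure NSFTrace (M : VonNeumannAlgebra H) where
  toFun : (H →L[ℂ] H) → ℝ≥0∞
  map_add : ∀ x ∈ M, ∀ y ∈ M, 0 ≤ x → 0 ≤ y → toFun (x + y) = toFun x + toFun y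
  map_smul : ∀ (c : ℝ≥0), ∀ x ∈ M, 0 ≤ x → toFun (((c : ℝ) : ℂ) • x) = c * toFun x
  tracial : ∀ x ∈ M, toFun (star x * x) = toFun (x * star x)
  faithful : ∀ x ∈ M, 0 ≤ x → toFun x = 0 → x = 0
  normal : ∀ D : Set (H →L[ℂ] H), D.Nonempty → DirectedOn (· ≤ ·) D →
    (∀ d ∈ D, d ∈ M ∧ 0 ≤ d) → ∀ x ∈ M, IsLUB D x → toFun x = ⨆ d ∈ D, toFun d
  semifinite : ∀ x ∈ M, 0 ≤ x → x ≠ 0 →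
    ∃ y ∈ M, 0 ≤ y ∧ y ≤ x ∧ y ≠ 0 ∧ toFun y < ∞

namespace NSFTrace

variable {M : VonNeumannAlgebra H} (τ : NSFTrace M)

theorem smul_mem' {x : H →L[ℂ] H} (hx : x ∈ M) (c : ℂ) : c • x ∈ M :=
  M.toStarSubalgebra.smul_mem hx c

theorem star_mul_mem {x : H →L[ℂ] H} (hx : x ∈ M) : star x * x ∈ M :=
  mul_mem (star_mem hx) hx

theorem ofReal_smul_nonneg {x : H →L[ℂ] H} (hx : 0 ≤ x) (c : ℝ≥0) : 0 ≤ ((c : ℝ) : ℂ) • x := by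
  have h := star_left_conjugate_nonneg hx (((Real.sqrt c : ℝ) : ℂ) • (1 : H →L[ℂ] H))
  have e : star (((Real.sqrt c : ℝ) : ℂ) • (1 : H →L[ℂ] H)) * x *
      (((Real.sqrt c : ℝ) : ℂ) • (1 : H →L[ℂ] H)) = ((c : ℝ) : ℂ) • x := by
    rw [star_smul, star_one, smul_mul_assoc, smul_mul_assoc, mul_smul_comm, smul_smul, one_mul,
      mul_one]
    congr 1
    simp only [RCLike.star_def, Complex.conj_ofReal]
    rw [← Complex.ofReal_mul]
    exact congrArg _ (Real.mul_self_sqrt c.2)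
  rwa [e] at h

theorem mono {x y : H →L[ℂ] H} (hx : x ∈ M) (hy : y ∈ M) (h0 : 0 ≤ x) (h : x ≤ y) :
    τ.toFun x ≤ τ.toFun y := by
  have e := τ.map_add x hx (y - x) (sub_mem hy hx) h0 (sub_nonneg.2 h)
  rw [add_sub_cancel] at e
  rw [e]
  exact le_self_add

theorem sqrt_mem {b : H →L[ℂ] H} (hb : b ∈ M) : CFC.sqrt b ∈ M := by
  have h : CFC.sqrt b ∈ Set.centralizer (Set.centralizer (M : Set (H →L[ℂ] H))) := by
    intro z hz
    have hc : Commute b z := hz b hb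
    have := hc.cfc_nnreal NNReal.sqrt
    rw [CFC.sqrt_eq_cfc]
    exact this.symm
  rw [VonNeumannAlgebra.centralizer_centralizer] at h
  exact h

/-- `τ(A²) ≤ τ(B²)` for `0 ≤ A ≤ B` in `M`. -/
theorem sq_mono {A B : H →L[ℂ] H} (hA : A ∈ M) (hB : B ∈ M) (h0 : 0 ≤ A) (h : A ≤ B) :
    τ.toFun (A * A) ≤ τ.toFun (B * B) := by
  have hB0 : 0 ≤ B := h0.trans h
  set a := CFC.sqrt A with ha
  set b := CFC.sqrt B with hb
  have ham : a ∈ M := sqrt_mem hA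
  have hbm : b ∈ M := sqrt_mem hB
  have haa : a * a = A := CFC.sqrt_mul_sqrt_self A h0
  have hbb : b * b = B := CFC.sqrt_mul_sqrt_self B hB0
  have hsa : star a = a := (CFC.sqrt_nonneg A).isSelfAdjoint.star_eq
  have hsb : star b = b := (CFC.sqrt_nonneg B).isSelfAdjoint.star_eq
  have h1 : A * A = star a * A * a := by rw [hsa, ← haa]; simp only [mul_assoc]
  have h2 : star a * B * a = star (b * a) * (b * a) := by
    rw [star_mul, hsb, ← hbb]; simp only [mul_assoc]
  have h3 : (b * a) * star (b * a) = star b * A * b := by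
    rw [star_mul, hsa, hsb, ← haa]; simp only [mul_assoc]
  have h4 : star b * B * b = B * B := by rw [hsb, ← hbb]; simp only [mul_assoc]
  have sm : star a ∈ M := star_mem ham
  have sm' : star b ∈ M := star_mem hbm
  calc τ.toFun (A * A) = τ.toFun (star a * A * a) := by rw [h1]
    _ ≤ τ.toFun (star a * B * a) :=
        τ.mono (mul_mem (mul_mem sm hA) ham) (mul_mem (mul_mem sm hB) ham)
          (star_left_conjugate_nonneg h0 a) (star_left_conjugate_le_conjugate h a)
    _ = τ.toFun (star b * A * b) := by rw [h2, τ.tracial _ (mul_mem hbm ham), h3]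
    _ ≤ τ.toFun (star b * B * b) :=
        τ.mono (mul_mem (mul_mem sm' hA) hbm) (mul_mem (mul_mem sm' hB) hbm)
          (star_left_conjugate_nonneg h0 b) (star_left_conjugate_le_conjugate h b)
    _ = τ.toFun (B * B) := by rw [h4]

/-- `(x+y)*(x+y) ≤ (1+t) x*x + (1+1/t) y*y`. -/
theorem add_sq_le (x y : H →L[ℂ] H) {t : ℝ≥0} (ht : 0 < t) :
    star (x + y) * (x + y) ≤ (((1 + t : ℝ≥0) : ℝ) : ℂ) • (star x * x)
      + (((1 + t⁻¹ : ℝ≥0) : ℝ) : ℂ) • (star y * y) := by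
  rw [← sub_nonneg]
  set s : ℝ := Real.sqrt t with hs
  have hs0 : s ≠ 0 := (Real.sqrt_pos.2 ht).ne'
  have hss : s * s = t := Real.mul_self_sqrt t.2
  have h := star_mul_self_nonneg ((s : ℂ) • x - ((s⁻¹ : ℝ) : ℂ) • y)
  convert h using 1
  have e1 : ((t : ℝ) : ℂ) = (s : ℂ) * s := by rw [← Complex.ofReal_mul, hss]
  have hsC : (s : ℂ) ≠ 0 := by exact_mod_cast hs0
  simp only [star_add, star_sub, star_smul, RCLike.star_def, Complex.conj_ofReal, NNReal.coe_add,
    NNReal.coe_one, NNReal.coe_inv, Complex.ofReal_add, Complex.ofReal_one, e1,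
    Complex.ofReal_inv, map_inv₀, mul_inv]
  simp only [add_mul, mul_add, sub_mul, mul_sub, smul_mul_assoc, mul_smul_comm, add_smul,
    one_smul, smul_smul, smul_sub, inv_mul_cancel₀ hsC, mul_inv_cancel₀ hsC]
  abel

theorem map_comb {A B : H →L[ℂ] H} (hA : A ∈ M) (hB : B ∈ M) (hA0 : 0 ≤ A) (hB0 : 0 ≤ B)
    (c d : ℝ≥0) : τ.toFun (((c : ℝ) : ℂ) • A + ((d : ℝ) : ℂ) • B)
      = c * τ.toFun A + d * τ.toFun B := by
  rw [τ.map_add _ (smul_mem' hA _) _ (smul_mem' hB _) (ofReal_smul_nonneg hA0 c)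
    (ofReal_smul_nonneg hB0 d), τ.map_smul c A hA hA0, τ.map_smul d B hB hB0]

theorem sq_add_le {x y : H →L[ℂ] H} (hx : x ∈ M) (hy : y ∈ M) {t : ℝ≥0} (ht : 0 < t) :
    τ.toFun (star (x + y) * (x + y)) ≤
      (1 + t : ℝ≥0) * τ.toFun (star x * x) + (1 + t⁻¹ : ℝ≥0) * τ.toFun (star y * y) := by
  rw [← τ.map_comb (star_mul_mem hx) (star_mul_mem hy) (star_mul_self_nonneg x)
    (star_mul_self_nonneg y)]
  exact τ.mono (star_mul_mem (add_mem hx hy))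
    (add_mem (smul_mem' (star_mul_mem hx) _) (smul_mem' (star_mul_mem hy) _))
    (star_mul_self_nonneg _) (add_sq_le x y ht)

theorem le_add_of_forall {z a b : ℝ} (ha : 0 ≤ a) (hb : 0 ≤ b)
    (h : ∀ t : ℝ≥0, 0 < t → z ^ 2 ≤ (1 + t) * a ^ 2 + (1 + (t : ℝ)⁻¹) * b ^ 2) : z ≤ a + b := by
  refine le_of_forall_pos_le_add fun ε hε => ?_
  have hε2 : 0 < ε / 2 := half_pos hε
  set p := a + ε / 2 with hp
  set q := b + ε / 2 with hq
  have hp0 : 0 < p := by positivity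
  have hq0 : 0 < q := by positivity
  have h1 := h ⟨q / p, by positivity⟩ (by
    have : 0 < q / p := by positivity
    exact_mod_cast this)
  change z ^ 2 ≤ (1 + q / p) * a ^ 2 + (1 + (q / p)⁻¹) * b ^ 2 at h1
  have h2 : a ^ 2 ≤ p ^ 2 := by gcongr; linarith
  have h3 : b ^ 2 ≤ q ^ 2 := by gcongr; linarith
  have h4 : z ^ 2 ≤ (p + q) ^ 2 := by
    calc z ^ 2 ≤ (1 + q / p) * a ^ 2 + (1 + (q / p)⁻¹) * b ^ 2 := h1
      _ ≤ (1 + q / p) * p ^ 2 + (1 + (q / p)⁻¹) * q ^ 2 := by gcongr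
      _ = (p + q) ^ 2 := by field_simp; ring
  have := (abs_le.1 (abs_le_of_sq_le_sq h4 (by positivity))).2
  linarith

theorem star_smul_mul (c : ℂ) (x : H →L[ℂ] H) :
    star (c • x) * (c • x) = (((‖c‖₊ ^ 2 : ℝ≥0) : ℝ) : ℂ) • (star x * x) := by
  rw [star_smul, smul_mul_assoc, mul_smul_comm, smul_smul]
  congr 1
  rw [RCLike.star_def, Complex.conj_mul']
  push_cast
  rfl

/-- `M ∩ L_2(M) = {x ∈ M : τ(|x|²) < ∞}`, where `|x|² = x*x`. -/
def sub2 : Submodule ℂ (H →L[ℂ] H) where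
  carrier := {x | x ∈ M ∧ τ.toFun (star x * x) < ∞}
  zero_mem' := by
    refine ⟨zero_mem M, ?_⟩
    have := τ.map_smul 0 0 (zero_mem M) le_rfl
    simp only [NNReal.coe_zero, Complex.ofReal_zero, smul_zero, ENNReal.coe_zero, zero_mul] at this
    rw [mul_zero, this]
    exact ENNReal.zero_lt_top
  add_mem' := by
    rintro x y ⟨hx, hx'⟩ ⟨hy, hy'⟩
    refine ⟨add_mem hx hy, (τ.sq_add_le hx hy one_pos).trans_lt ?_⟩
    exact ENNReal.add_lt_top.2 ⟨ENNReal.mul_lt_top ENNReal.coe_lt_top hx',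
      ENNReal.mul_lt_top ENNReal.coe_lt_top hy'⟩
  smul_mem' := by
    rintro c x ⟨hx, hx'⟩
    refine ⟨smul_mem' hx c, ?_⟩
    rw [star_smul_mul, τ.map_smul _ _ (star_mul_mem hx) (star_mul_self_nonneg x)]
    exact ENNReal.mul_lt_top ENNReal.coe_lt_top hx'

/-- `‖x‖_2 = τ(|x|²)^{1/2}`. -/
noncomputable def nrm2 (x : H →L[ℂ] H) : ℝ := (τ.toFun (star x * x)).toReal ^ (1 / 2 : ℝ)

/-- `‖x‖_4 = τ(|x|⁴)^{1/4}`, where `|x|⁴ = (x*x)²`. -/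
noncomputable def nrm4 (x : H →L[ℂ] H) : ℝ := (τ.toFun ((star x * x) ^ 2)).toReal ^ (1 / 4 : ℝ)

theorem nrm2_nonneg (x : H →L[ℂ] H) : 0 ≤ τ.nrm2 x := Real.rpow_nonneg ENNReal.toReal_nonneg _

theorem nrm4_nonneg (x : H →L[ℂ] H) : 0 ≤ τ.nrm4 x := Real.rpow_nonneg ENNReal.toReal_nonneg _

theorem nrm2_sq (x : H →L[ℂ] H) : τ.nrm2 x ^ 2 = (τ.toFun (star x * x)).toReal := by
  rw [nrm2, ← Real.rpow_natCast, ← Real.rpow_mul ENNReal.toReal_nonneg]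
  norm_num

theorem star_sq (x : H →L[ℂ] H) : star (star x * x) * (star x * x) = (star x * x) ^ 2 := by
  rw [(IsSelfAdjoint.star_mul_self x).star_eq, sq]

theorem nrm4_sq (x : H →L[ℂ] H) : τ.nrm4 x ^ 2 = τ.nrm2 (star x * x) := by
  rw [nrm4, nrm2, star_sq, ← Real.rpow_natCast, ← Real.rpow_mul ENNReal.toReal_nonneg]
  norm_num

theorem nrm2_smul (c : ℂ) {x : H →L[ℂ] H} (hx : x ∈ M) : τ.nrm2 (c • x) = ‖c‖ * τ.nrm2 x := by
  rw [nrm2, nrm2, star_smul_mul, τ.map_smul _ _ (star_mul_mem hx) (star_mul_self_nonneg x),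
    ENNReal.toReal_mul, Real.mul_rpow ENNReal.toReal_nonneg ENNReal.toReal_nonneg]
  congr 1
  rw [ENNReal.coe_toReal, NNReal.coe_pow, coe_nnnorm, ← Real.rpow_natCast,
    ← Real.rpow_mul (norm_nonneg c)]
  norm_num

theorem nrm4_smul (c : ℂ) {x : H →L[ℂ] H} (hx : x ∈ M) : τ.nrm4 (c • x) = ‖c‖ * τ.nrm4 x := by
  rw [← pow_left_inj₀ (τ.nrm4_nonneg _) (mul_nonneg (norm_nonneg c) (τ.nrm4_nonneg _))
    two_ne_zero, mul_pow, nrm4_sq, nrm4_sq, star_smul_mul, τ.nrm2_smul _ (star_mul_mem hx)]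
  simp

theorem nrm2_add_le {x y : H →L[ℂ] H} (hx : x ∈ τ.sub2) (hy : y ∈ τ.sub2) :
    τ.nrm2 (x + y) ≤ τ.nrm2 x + τ.nrm2 y := by
  refine le_add_of_forall (τ.nrm2_nonneg x) (τ.nrm2_nonneg y) fun t ht => ?_
  have h := τ.sq_add_le hx.1 hy.1 ht
  have hxf : ((1 + t : ℝ≥0) : ℝ≥0∞) * τ.toFun (star x * x) ≠ ∞ :=
    (ENNReal.mul_lt_top ENNReal.coe_lt_top hx.2).ne
  have hyf : ((1 + t⁻¹ : ℝ≥0) : ℝ≥0∞) * τ.toFun (star y * y) ≠ ∞ :=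
    (ENNReal.mul_lt_top ENNReal.coe_lt_top hy.2).ne
  have h' := ENNReal.toReal_mono (ENNReal.add_ne_top.2 ⟨hxf, hyf⟩) h
  rw [ENNReal.toReal_add hxf hyf, ENNReal.toReal_mul, ENNReal.toReal_mul] at h'
  rw [nrm2_sq, nrm2_sq, nrm2_sq]
  simpa only [ENNReal.coe_toReal, NNReal.coe_add, NNReal.coe_one, NNReal.coe_inv] using h'

theorem sq_mem_sub2 {x : H →L[ℂ] H} :
    x ∈ M → τ.toFun ((star x * x) ^ 2) < ∞ → star x * x ∈ τ.sub2 := fun hx h =>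
  ⟨star_mul_mem hx, by rwa [star_sq]⟩

/-- The analogue for `4` of `sq_add_le`. -/
theorem four_add_le {x y : H →L[ℂ] H} (hx : x ∈ M) (hy : y ∈ M) {t : ℝ≥0} (ht : 0 < t) :
    τ.toFun ((star (x + y) * (x + y)) ^ 2) ≤
      τ.toFun (star ((((1 + t : ℝ≥0) : ℝ) : ℂ) • (star x * x)
        + (((1 + t⁻¹ : ℝ≥0) : ℝ) : ℂ) • (star y * y)) * ((((1 + t : ℝ≥0) : ℝ) : ℂ) • (star x * x)
        + (((1 + t⁻¹ : ℝ≥0) : ℝ) : ℂ) • (star y * y))) := by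
  have hB := add_mem (smul_mem' (star_mul_mem hx) (((1 + t : ℝ≥0) : ℝ) : ℂ))
    (smul_mem' (star_mul_mem hy) (((1 + t⁻¹ : ℝ≥0) : ℝ) : ℂ))
  have hB0 : 0 ≤ (((1 + t : ℝ≥0) : ℝ) : ℂ) • (star x * x)
      + (((1 + t⁻¹ : ℝ≥0) : ℝ) : ℂ) • (star y * y) :=
    add_nonneg (ofReal_smul_nonneg (star_mul_self_nonneg x) _)
      (ofReal_smul_nonneg (star_mul_self_nonneg y) _)
  rw [hB0.isSelfAdjoint.star_eq, sq]
  exact τ.sq_mono (star_mul_mem (add_mem hx hy)) hB (star_mul_self_nonneg _) (add_sq_le x y ht)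

/-- `M ∩ L_4(M) = {x ∈ M : τ(|x|⁴) < ∞}`, where `|x|⁴ = (x*x)²`. -/
def sub4 : Submodule ℂ (H →L[ℂ] H) where
  carrier := {x | x ∈ M ∧ τ.toFun ((star x * x) ^ 2) < ∞}
  zero_mem' := by
    refine ⟨zero_mem M, ?_⟩
    have := (τ.sub2.zero_mem).2
    simpa using this
  add_mem' := by
    rintro x y ⟨hx, hx'⟩ ⟨hy, hy'⟩
    refine ⟨add_mem hx hy, (τ.four_add_le hx hy one_pos).trans_lt ?_⟩
    exact (τ.sub2.add_mem (τ.sub2.smul_mem _ (τ.sq_mem_sub2 hx hx'))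
      (τ.sub2.smul_mem _ (τ.sq_mem_sub2 hy hy'))).2
  smul_mem' := by
    rintro c x ⟨hx, hx'⟩
    refine ⟨smul_mem' hx c, ?_⟩
    rw [← star_sq, star_smul_mul]
    exact (τ.sub2.smul_mem _ (τ.sq_mem_sub2 hx hx')).2

theorem nrm4_add_le {x y : H →L[ℂ] H} (hx : x ∈ τ.sub4) (hy : y ∈ τ.sub4) :
    τ.nrm4 (x + y) ≤ τ.nrm4 x + τ.nrm4 y := by
  refine le_add_of_forall (τ.nrm4_nonneg x) (τ.nrm4_nonneg y) fun t ht => ?_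
  have h := τ.four_add_le hx.1 hy.1 ht
  have hX := τ.sub2.smul_mem (((1 + t : ℝ≥0) : ℝ) : ℂ) (τ.sq_mem_sub2 hx.1 hx.2)
  have hY := τ.sub2.smul_mem (((1 + t⁻¹ : ℝ≥0) : ℝ) : ℂ) (τ.sq_mem_sub2 hy.1 hy.2)
  have h1 : τ.nrm2 (star (x + y) * (x + y)) ≤ _ :=
    (Real.rpow_le_rpow ENNReal.toReal_nonneg
      (by rw [star_sq]; exact ENNReal.toReal_mono (τ.sub2.add_mem hX hY).2.ne h)
      (by norm_num)).trans (τ.nrm2_add_le hX hY)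
  rw [τ.nrm2_smul _ (star_mul_mem hx.1), τ.nrm2_smul _ (star_mul_mem hy.1)] at h1
  rw [nrm4_sq, nrm4_sq, nrm4_sq]
  refine h1.trans_eq ?_
  congr 2
  · rw [Complex.norm_real, Real.norm_of_nonneg (NNReal.coe_nonneg _)]; simp
  · rw [Complex.norm_real, Real.norm_of_nonneg (NNReal.coe_nonneg _)]; simp

/-- The vector space `M ∩ L_2(M)`, to be normed by `‖·‖_2`. -/
def PreL2 : Type _ := τ.sub2

/-- The vector space `M ∩ L_4(M)`, to be normed by `‖·‖_4`. -/
def PreL4 : Type _ := τ.sub4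

instance : AddCommGroup τ.PreL2 := inferInstanceAs (AddCommGroup τ.sub2)

instance : Module ℂ τ.PreL2 := inferInstanceAs (Module ℂ τ.sub2)

instance : AddCommGroup τ.PreL4 := inferInstanceAs (AddCommGroup τ.sub4)

instance : Module ℂ τ.PreL4 := inferInstanceAs (Module ℂ τ.sub4)

/-- The underlying operator. -/
def PreL2.op {τ : NSFTrace M} (x : τ.PreL2) : H →L[ℂ] H := Subtype.val x

/-- The underlying operator. -/
def PreL4.op {τ : NSFTrace M} (x : τ.PreL4) : H →L[ℂ] H := Subtype.val x

noncomputable instance : Norm τ.PreL2 := ⟨fun x => τ.nrm2 x.op⟩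

noncomputable instance : Norm τ.PreL4 := ⟨fun x => τ.nrm4 x.op⟩

theorem core2 : SeminormedSpace.Core ℂ τ.PreL2 where
  norm_nonneg _ := τ.nrm2_nonneg _
  norm_smul c x := τ.nrm2_smul c (Subtype.prop x).1
  norm_triangle x y := τ.nrm2_add_le (Subtype.prop x) (Subtype.prop y)

theorem core4 : SeminormedSpace.Core ℂ τ.PreL4 where
  norm_nonneg _ := τ.nrm4_nonneg _
  norm_smul c x := τ.nrm4_smul c (Subtype.prop x).1
  norm_triangle x y := τ.nrm4_add_le (Subtype.prop x) (Subtype.prop y)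

noncomputable instance : SeminormedAddCommGroup τ.PreL2 := .ofCore τ.core2

noncomputable instance : NormedSpace ℂ τ.PreL2 :=
  ⟨fun c x => (τ.core2.norm_smul c x).le⟩

noncomputable instance : SeminormedAddCommGroup τ.PreL4 := .ofCore τ.core4

noncomputable instance : NormedSpace ℂ τ.PreL4 :=
  ⟨fun c x => (τ.core4.norm_smul c x).le⟩

/-- The noncommutative space `L_2(M)`: the completion of `M ∩ L_2(M)` for `‖·‖_2`. -/
abbrev L2 : Type _ := UniformSpace.Completion τ.PreL2

/-- The noncommutative space `L_4(M)`: the completion of `M ∩ L_4(M)` for `‖·‖_4`. -/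
abbrev L4 : Type _ := UniformSpace.Completion τ.PreL4

/-- `x = a y b` for `a, b ∈ L_4(M)`, `y ∈ M`, `x ∈ L_2(M)`: the product of operators of `M`,
extended by continuity to `L_4(M) × L_4(M) → L_2(M)` (Hölder), i.e. `x = lim uᵢ y vᵢ` in `L_2(M)`
where `uᵢ, vᵢ ∈ M ∩ L_4(M)` tend to `a` and `b` in `L_4(M)`. -/
def IsProd (a : τ.L4) (y : H →L[ℂ] H) (b : τ.L4) (x : τ.L2) : Prop :=
  ∃ (u v : ℕ → τ.PreL4) (w : ℕ → τ.PreL2),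
    (∀ i, (w i).op = (u i).op * y * (v i).op) ∧
    Tendsto (fun i => (u i : τ.L4)) atTop (𝓝 a) ∧
    Tendsto (fun i => (v i : τ.L4)) atTop (𝓝 b) ∧
    Tendsto (fun i => (w i : τ.L2)) atTop (𝓝 x)

end NSFTrace

end Trace

/-! ### The tensor product `N = L_∞(Ω, μ) ⊗̄ M` and the space `L_2(N; ℓ_∞)` -/

section Tensor

variable {H : Type*} [NormedAddCommGroup H] [InnerProductSpace ℂ H] [CompleteSpace H]
variable {Ω : Type*} [MeasurableSpace Ω]

/-- The operators `g ⊗ 1` (`g ∈ L_∞(Ω, μ)`) and `1 ⊗ m` (`m ∈ M`) on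
`L_2(Ω; H) = L_2(Ω) ⊗ H`. -/
def tensorGenerators (M : VonNeumannAlgebra H) (μ : Measure Ω) :
    Set (Lp H 2 μ →L[ℂ] Lp H 2 μ) :=
  {T | ∃ g : Ω → ℂ, MemLp g ∞ μ ∧ ∀ ξ : Lp H 2 μ, T ξ =ᵐ[μ] fun t => g t • ξ t} ∪
  {T | ∃ m ∈ M, ∀ ξ : Lp H 2 μ, T ξ =ᵐ[μ] fun t => m (ξ t)}

/-- The von Neumann algebra `L_∞(Ω, μ) ⊗̄ M` acting on `L_2(Ω; H)`: the double commutant of the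
elementary tensors (`StarSubalgebra.centralizer` is the commutant of a set and its adjoints). -/
noncomputable def tensorVN (M : VonNeumannAlgebra H) (μ : Measure Ω) :
    VonNeumannAlgebra (Lp H 2 μ) where
  toStarSubalgebra := StarSubalgebra.centralizer ℂ
    (StarSubalgebra.centralizer ℂ (tensorGenerators M μ) : Set (Lp H 2 μ →L[ℂ] Lp H 2 μ))
  centralizer_centralizer' := by
    change Set.centralizer (Set.centralizer
      ((StarSubalgebra.centralizer ℂ (StarSubalgebra.centralizer ℂ (tensorGenerators M μ) :
        Set (Lp H 2 μ →L[ℂ] Lp H 2 μ)) : StarSubalgebra ℂ (Lp H 2 μ →L[ℂ] Lp H 2 μ)) :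
        Set (Lp H 2 μ →L[ℂ] Lp H 2 μ))) = _
    rw [StarSubalgebra.coe_centralizer_centralizer, Set.centralizer_centralizer_centralizer]
    exact (StarSubalgebra.coe_centralizer_centralizer ℂ _).symm

/-- `y : Ω → M` is a decomposition of the operator `Y` on `L_2(Ω; H)` into fibres:
`(Yξ)(t) = y(t) ξ(t)` for almost every `t`, for every `ξ`. This is how elements of
`L_∞(Ω, μ) ⊗̄ M` are viewed as `M`-valued functions. -/
def IsFibre (M : VonNeumannAlgebra H) (μ : Measure Ω) (Y : Lp H 2 μ →L[ℂ] Lp H 2 μ)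
    (y : Ω → H →L[ℂ] H) : Prop :=
  (∀ t, y t ∈ M) ∧ ∀ ξ : Lp H 2 μ, Y ξ =ᵐ[μ] fun t => y t (ξ t)

variable {M : VonNeumannAlgebra H} (τ : NSFTrace M) (μ : Measure Ω)

/-- `L_2(N)` for `N = L_∞(Ω, μ) ⊗̄ M` with the tensor trace, as the space `L_2(Ω; L_2(M))`. -/
abbrev L2N : Type _ := Lp τ.L2 2 μ

/-- `L_4(N)` for `N = L_∞(Ω, μ) ⊗̄ M` with the tensor trace, as the space `L_4(Ω; L_4(M))`. -/
abbrev L4N : Type _ := Lp τ.L4 4 μ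

/-- `x = a Y b` for `a, b ∈ L_4(N)`, `Y ∈ N`, `x ∈ L_2(N)`: fibrewise product. -/
def IsProdN (a : L4N τ μ) (Y : tensorVN M μ) (b : L4N τ μ) (x : L2N τ μ) : Prop :=
  ∃ y : Ω → H →L[ℂ] H, IsFibre M μ Y y ∧ ∀ᵐ t ∂μ, τ.IsProd (a t) (y t) (b t) (x t)

/-- The norm of a family `x = (x_i)` in `L_2(N; ℓ_∞(ι))`: the infimum of
`sup_i ‖Y_i‖_∞ ‖a‖_4 ‖b‖_4` over all factorizations `x_i = a Y_i b` with `a, b ∈ L_4(N)` and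
`(Y_i)` a bounded family in `N`. It is `∞` if there is no factorization, i.e. if `x` is not in
`L_2(N; ℓ_∞(ι))`. -/
noncomputable def maxNorm {ι : Type*} (x : ι → L2N τ μ) : ℝ≥0∞ :=
  ⨅ (a : L4N τ μ) (b : L4N τ μ) (Y : ι → tensorVN M μ)
    (_ : ∃ C : ℝ, ∀ i, ‖(Y i : Lp H 2 μ →L[ℂ] Lp H 2 μ)‖ ≤ C)
    (_ : ∀ i, IsProdN τ μ a (Y i) b (x i)),
    (⨆ i, ‖(Y i : Lp H 2 μ →L[ℂ] Lp H 2 μ)‖ₑ) * ‖a‖ₑ * ‖b‖ₑ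

end Tensor

/-! ### The compact group `G = ∏ G_k` and its character system -/

section Group

/-- The irreducible complex characters of a finite group. -/
def irrChars (K : Type*) [Group K] : Set (K → ℂ) :=
  {φ | ∃ (d : ℕ) (ρ : Representation ℂ K (Fin d → ℂ)), ρ.IsIrreducible ∧ φ = ρ.character}

variable (Γ : ℕ → Type*) [∀ k, Group (Γ k)]

/-- `p_k`, the number of conjugacy classes of `G_k`. -/
noncomputable def numClasses (k : ℕ) : ℕ := Nat.card (ConjClasses (Γ k))

/-- `P_0 = 1`, `P_{k+1} = p_k P_k`. -/
noncomputable def bigP (k : ℕ) : ℕ := ∏ i ∈ Finset.range k, numClasses Γ i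

/-- The digits of the expansion `n = ∑ n_k P_k`, `0 ≤ n_k ≤ p_k - 1`. -/
noncomputable def dig (n k : ℕ) : ℕ := n / bigP Γ k % numClasses Γ k

/-- `n^{(s)} = ∑_{k ≥ s} n_k P_k`. -/
noncomputable def tail (s n : ℕ) : ℕ := ∑ᶠ (k : ℕ) (_ : s ≤ k), dig Γ n k * bigP Γ k

/-- The set of `n` with `|n| = A`, where `|n| = max {k : n_k ≠ 0}`. -/
def block (A : ℕ) : Set ℕ := {n | IsGreatest {k | dig Γ n k ≠ 0} A}

/-- `r_k^0, …, r_k^{p_k - 1}` is an enumeration of the irreducible characters of `G_k` with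
`r_k^0 = 1`, for every `k`. -/
def IsCharacterSystem (r : ∀ k, ℕ → Γ k → ℂ) : Prop :=
  ∀ k, Set.BijOn (r k) (Set.Iio (numClasses Γ k)) (irrChars (Γ k)) ∧ r k 0 = fun _ => 1

variable {Γ}

/-- `χ_n(x) = ∏_k r_k^{n_k}(x_k)` (all but finitely many factors are `1`). -/
noncomputable def chi (r : ∀ k, ℕ → Γ k → ℂ) (n : ℕ) (x : ∀ k, Γ k) : ℂ :=
  ∏ᶠ k, r k (dig Γ n k) (x k)

/-- `J_s(y)`: the product of the conjugacy classes of `y_0, …, y_{s-1}` and of the whole groups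
`G_s, G_{s+1}, …`. -/
def J (s : ℕ) (y : ∀ k, Γ k) : Set (∀ k, Γ k) := {x | ∀ i < s, IsConj (y i) (x i)}

variable (Γ)

/-- The normalized Haar measure of `G`: the product of the uniform measures on the `G_k`. -/
noncomputable def haarG [∀ k, MeasurableSpace (Γ k)] : Measure (∀ k, Γ k) :=
  Measure.infinitePi fun k => ProbabilityTheory.uniformOn (Set.univ : Set (Γ k))

variable {Γ}

/-- `y ↦ μ(J_s(y))⁻¹ ∫_{J_s(y)} f(x) χ_{n^{(s)}}(y) conj χ_{n^{(s)}}(x) dμ(x)`. -/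
noncomputable def avg [∀ k, MeasurableSpace (Γ k)] {E : Type*} [NormedAddCommGroup E]
    [NormedSpace ℂ E] (r : ∀ k, ℕ → Γ k → ℂ) (s n : ℕ) (f : (∀ k, Γ k) → E) (y : ∀ k, Γ k) : E :=
  (((haarG Γ).real (J s y) : ℂ))⁻¹ •
    ∫ x in J s y, (chi r (tail Γ s n) y * conj (chi r (tail Γ s n) x)) • f x ∂(haarG Γ)

end Group

/-! Only the coordinates k ≤ A matter. Attach to each k < s the indicators of the conjugacy classes
of G_k, normalized in L_2, and to each s ≤ k ≤ A the irreducible characters of G_k. The products ψ_m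
of one such function per coordinate are orthonormal in L_2(G). The kernel of T_n at (y, x) is ψ_m(y)
conj ψ_m(x), where m = m(n, y) lists the classes of y_0, …, y_{s-1} and the digits n_s, …, n_A
(`mixedProd_mul_conj`). Hence T_n f(y) = ψ_m(y) v_m with the Fourier coefficient v_m = ∫ conj ψ_m f:
whatever n is, T_n f(y) lies in the finite family (ψ_m(y) v_m)_m. The maximal norm is at most the
norm of the square function of this family, and ∫ Σ |ψ_m|² ‖v_m‖² = Σ ‖v_m‖² ≤ ‖f‖² is Bessel's
inequality with values in the Hilbert space L_2(M) (`sum_norm_integral_sq_le`).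

The noncommutative core is the bound by the square function, `exists_common_factorization`. For x_i
in M ∩ L_2(M) put S = (Σ x_i x_i*)^{1/2} and T = (Σ x_i* x_i)^{1/2}. The mixed Schwarz inequality
|⟨η, x_i ξ⟩| ≤ ‖S^{1/2} η‖ ‖T^{1/2} ξ‖ and Douglas factorization give x_i = S^{1/2} y_i T^{1/2} with
contractions y_i in M, and the fourth powers of the L_4 norms of both outer factors equal Σ
‖x_i‖_2².

Vectors of the completion are expanded in series, and the operators S_j, T_j of the terms are added
up. The square roots of the partial sums converge in L_4(M) because A ↦ τ(A⁴) is superadditive on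
the positive cone. The contractions converge weakly along an ultrafilter, and the factorization
survives because ‖·‖_2 is lower semicontinuous under bounded weak operator limits
(`toFun_weakLim_le`, `isProd_of_isWeakLim`). That semicontinuity combines Mazur's convexity argument
with `exists_dominating`, where normality of the trace enters.

Since only finitely many coordinates are involved, the factorizations are chosen pointwise on the
finite group ∏_{k ≤ A} G_k and glued without measurable selection (`maxNorm_le_of_finite`). -/

set_option linter.unusedSectionVars false

/-! ### Weak operator limits along an ultrafilter -/

section WeakLimits

variable {E : Type*} [NormedAddCommGroup E] [InnerProductSpace ℂ E] [CompleteSpace E]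

/-- Banach–Alaoglu, transported through the Riesz isomorphism; an ultrafilter replaces the
extraction of subsequences, so no separability is needed. -/
theorem exists_weak_limit (U : Ultrafilter ℕ) {z : ℕ → E} {C : ℝ} (hz : ∀ k, ‖z k‖ ≤ C) :
    ∃ ζ : E, ‖ζ‖ ≤ C ∧ ∀ f : StrongDual ℂ E, Tendsto (fun k => f (z k)) U (𝓝 (f ζ)) := by
  let w : ℕ → WeakDual ℂ E := fun k =>
    StrongDual.toWeakDual (InnerProductSpace.toDual ℂ E (z k))
  have hc := WeakDual.isCompact_closedBall (𝕜 := ℂ) (E := E) 0 C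
  have hmem : ∀ k, w k ∈ WeakDual.toStrongDual ⁻¹' Metric.closedBall (0 : StrongDual ℂ E) C := by
    intro k
    rw [Set.mem_preimage, mem_closedBall_zero_iff]
    simpa [w] using hz k
  obtain ⟨φ, hφ, hlim⟩ := hc.ultrafilter_le_nhds (U.map w)
    (by
      rw [le_principal_iff]
      exact Filter.mem_map.2 (Filter.univ_mem' hmem))
  refine ⟨(InnerProductSpace.toDual ℂ E).symm (WeakDual.toStrongDual φ), ?_, fun f => ?_⟩
  · simpa using hφ
  · have h1 : Tendsto w U (𝓝 φ) := hlim
    obtain ⟨v, rfl⟩ := (InnerProductSpace.toDual ℂ E).surjective f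
    have h2 : Tendsto (fun k => w k v) U (𝓝 (φ v)) :=
      ((WeakDual.eval_continuous v).tendsto φ).comp h1
    -- The Riesz isomorphism is conjugate linear, so the limits obtained are those of the
    -- conjugates.
    have h3 := (Complex.continuous_conj.tendsto _).comp h2
    refine (h3.congr fun k => ?_).trans_eq ?_
    · simp [w]
    · congr 1
      rw [InnerProductSpace.toDual_apply_apply, ← inner_conj_symm,
        InnerProductSpace.toDual_symm_apply]
      rfl

/-- `Y` is the limit of the sequence `y` in the weak operator topology along `U`. -/
def IsWeakLim (U : Filter ℕ) (y : ℕ → E →L[ℂ] E) (Y : E →L[ℂ] E) : Prop :=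
  ∀ ξ η : E, Tendsto (fun k => inner ℂ η (y k ξ)) U (𝓝 (inner ℂ η (Y ξ)))

/-- Weak limits are taken vector by vector along the same ultrafilter; uniqueness of limits then
makes the limit map linear. -/
theorem exists_isWeakLim (U : Ultrafilter ℕ) {y : ℕ → E →L[ℂ] E} {C : ℝ} (hy : ∀ k, ‖y k‖ ≤ C) :
    ∃ Y : E →L[ℂ] E, ‖Y‖ ≤ C ∧ IsWeakLim U y Y := by
  have hC : 0 ≤ C := (norm_nonneg _).trans (hy 0)
  have h : ∀ ξ : E, ∃ ζ : E, ‖ζ‖ ≤ C * ‖ξ‖ ∧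
      ∀ f : StrongDual ℂ E, Tendsto (fun k => f (y k ξ)) U (𝓝 (f ζ)) := fun ξ =>
    exists_weak_limit U fun k => ((y k).le_opNorm ξ).trans (by gcongr; exact hy k)
  choose Z hZ hZl using h
  have hl : ∀ ξ η : E, Tendsto (fun k => inner ℂ η (y k ξ)) U (𝓝 (inner ℂ η (Z ξ))) :=
    fun ξ η => by simpa using hZl ξ (InnerProductSpace.toDual ℂ E η)
  let L : E →ₗ[ℂ] E :=
    { toFun := Z
      map_add' := fun ξ ξ' => ext_inner_left ℂ fun η => by
        refine tendsto_nhds_unique (hl (ξ + ξ') η) ?_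
        simpa [inner_add_right] using (hl ξ η).add (hl ξ' η)
      map_smul' := fun c ξ => ext_inner_left ℂ fun η => by
        refine tendsto_nhds_unique (hl (c • ξ) η) ?_
        simpa [inner_smul_right] using (hl ξ η).const_mul c }
  exact ⟨L.mkContinuous C hZ, L.mkContinuous_norm_le hC hZ, hl⟩

variable {U : Filter ℕ} {y : ℕ → E →L[ℂ] E} {Y : E →L[ℂ] E}

/-- Commutation with a fixed operator passes to weak limits, so the double commutant theorem
applies. -/
theorem IsWeakLim.mem [U.NeBot] {M : VonNeumannAlgebra E} (h : IsWeakLim U y Y)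
    (hy : ∀ k, y k ∈ M) : Y ∈ M := by
  rw [← M.commutant_commutant, VonNeumannAlgebra.mem_commutant_iff]
  intro g hg
  rw [VonNeumannAlgebra.mem_commutant_iff] at hg
  ext ξ
  refine ext_inner_left ℂ fun η => ?_
  refine tendsto_nhds_unique ?_ (h (g ξ) η)
  have := h ξ (ContinuousLinearMap.adjoint g η)
  simp only [ContinuousLinearMap.adjoint_inner_left] at this
  refine this.congr fun k => ?_
  congr 1
  exact (congrArg (fun T : E →L[ℂ] E => T ξ) (hg _ (hy k))).symm

theorem IsWeakLim.mul_mul (h : IsWeakLim U y Y) (a b : E →L[ℂ] E) :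
    IsWeakLim U (fun k => a * y k * b) (a * Y * b) := by
  intro ξ η
  have := h (b ξ) (ContinuousLinearMap.adjoint a η)
  simp only [ContinuousLinearMap.adjoint_inner_left] at this
  exact this

theorem IsWeakLim.sub_const (h : IsWeakLim U y Y) (a : E →L[ℂ] E) :
    IsWeakLim U (fun k => y k - a) (Y - a) := by
  intro ξ η
  simpa [inner_sub_right] using (h ξ η).sub_const (inner ℂ η (a ξ))

theorem IsWeakLim.unique [U.NeBot] {Z : E →L[ℂ] E} (h : IsWeakLim U y Y) (h' : IsWeakLim U y Z) :
    Y = Z := by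
  ext ξ
  exact ext_inner_left ℂ fun η => tendsto_nhds_unique (h ξ η) (h' ξ η)

theorem IsWeakLim.norm_apply_le [U.NeBot] (h : IsWeakLim U y Y) {ξ : E} {c : ℝ}
    (hc : ∀ᶠ k in U, ‖y k ξ‖ ≤ c) : ‖Y ξ‖ ≤ c := by
  -- Lower semicontinuity of the norm, by testing against η = Y ξ.
  have h1 := (h ξ (Y ξ)).norm
  have h2 : ‖inner ℂ (Y ξ) (Y ξ)‖ ≤ ‖Y ξ‖ * c :=
    le_of_tendsto h1 (hc.mono fun k hk => (norm_inner_le_norm _ _).trans (by gcongr))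
  rw [inner_self_eq_norm_sq_to_K, norm_pow, RCLike.norm_ofReal, abs_norm, sq] at h2
  rcases (norm_nonneg (Y ξ)).eq_or_lt with h0 | h0
  · rw [← h0]
    obtain ⟨k, hk⟩ := hc.exists
    exact (norm_nonneg _).trans hk
  · exact le_of_mul_le_mul_left h2 h0

end WeakLimits

/-! ### Operator inequalities and resolvents -/

section Order

variable {H : Type*} [NormedAddCommGroup H] [InnerProductSpace ℂ H] [CompleteSpace H]

theorem opNonneg_iff {x : H →L[ℂ] H} (hx : IsSelfAdjoint x) :
    0 ≤ x ↔ ∀ ξ, 0 ≤ (inner ℂ (x ξ) ξ).re := by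
  rw [ContinuousLinearMap.nonneg_iff_isPositive]
  exact ⟨fun h ξ => h.re_inner_nonneg_left ξ, fun h =>
    (ContinuousLinearMap.isPositive_def' (T := x)).2 ⟨hx, fun ξ => h ξ⟩⟩

theorem op_le_iff {x y : H →L[ℂ] H} (hx : IsSelfAdjoint x) (hy : IsSelfAdjoint y) :
    x ≤ y ↔ ∀ ξ, (inner ℂ (x ξ) ξ).re ≤ (inner ℂ (y ξ) ξ).re := by
  rw [← sub_nonneg, opNonneg_iff (hy.sub hx)]
  refine forall_congr' fun ξ => ?_
  rw [sub_apply, inner_sub_left, Complex.sub_re, sub_nonneg]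

theorem inner_star_mul_self (x : H →L[ℂ] H) (ξ : H) :
    (inner ℂ ((star x * x) ξ) ξ).re = ‖x ξ‖ ^ 2 := by
  change (inner ℂ (ContinuousLinearMap.adjoint x (x ξ)) ξ).re = _
  rw [ContinuousLinearMap.adjoint_inner_left, inner_self_eq_norm_sq_to_K]
  norm_cast

theorem star_mul_self_le_iff {x y : H →L[ℂ] H} :
    star x * x ≤ star y * y ↔ ∀ ξ, ‖x ξ‖ ≤ ‖y ξ‖ := by
  rw [op_le_iff (IsSelfAdjoint.star_mul_self x) (IsSelfAdjoint.star_mul_self y)]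
  refine forall_congr' fun ξ => ?_
  rw [inner_star_mul_self, inner_star_mul_self,
    pow_le_pow_iff_left₀ (norm_nonneg _) (norm_nonneg _) two_ne_zero]

theorem opNorm_le_one_of_inner {x : H →L[ℂ] H}
    (h : ∀ ξ η, ‖inner ℂ η (x ξ)‖ ≤ ‖η‖ * ‖ξ‖) : ‖x‖ ≤ 1 := by
  refine x.opNorm_le_bound zero_le_one fun ξ => ?_
  rw [one_mul]
  have h1 := h ξ (x ξ)
  rw [inner_self_eq_norm_sq_to_K, norm_pow, RCLike.norm_ofReal, abs_norm, sq] at h1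
  rcases (norm_nonneg (x ξ)).eq_or_lt with h0 | h0
  · rw [← h0]; positivity
  · exact le_of_mul_le_mul_left h1 h0

/-- For `a ≥ 0` and `δ > 0` the operator `a + δ` is invertible, inside any von Neumann algebra
containing `a`. -/
theorem exists_inv_add {a : H →L[ℂ] H} (ha : 0 ≤ a) {δ : ℝ} (hδ : 0 < δ) :
    ∃ ρ : H →L[ℂ] H, ρ * (a + (δ : ℂ) • 1) = 1 ∧ (a + (δ : ℂ) • 1) * ρ = 1 ∧ star ρ = ρ ∧
      ∀ M : VonNeumannAlgebra H, a ∈ M → ρ ∈ M := by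
  have hs : 0 ≤ ((δ : ℂ) • (1 : H →L[ℂ] H)) := NSFTrace.ofReal_smul_nonneg zero_le_one ⟨δ, hδ.le⟩
  have hu1 : IsUnit ((δ : ℂ) • (1 : H →L[ℂ] H)) := by
    have : ((δ : ℂ)) ≠ 0 := by exact_mod_cast hδ.ne'
    exact (isUnit_one).smul (Units.mk0 (δ : ℂ) this)
  have hu : IsUnit (a + (δ : ℂ) • (1 : H →L[ℂ] H)) :=
    CStarAlgebra.isUnit_of_le _ (le_add_of_nonneg_left ha) (hu1.isStrictlyPositive hs)
  obtain ⟨u, hu⟩ := hu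
  have hsa : star (a + (δ : ℂ) • (1 : H →L[ℂ] H)) = a + (δ : ℂ) • (1 : H →L[ℂ] H) :=
    (add_nonneg ha hs).isSelfAdjoint.star_eq
  have h1 : (↑u⁻¹ : H →L[ℂ] H) * (a + (δ : ℂ) • 1) = 1 := by rw [← hu]; simp
  have h2 : (a + (δ : ℂ) • 1) * (↑u⁻¹ : H →L[ℂ] H) = 1 := by rw [← hu]; simp
  refine ⟨↑u⁻¹, h1, h2, ?_, fun M hM => ?_⟩
  · have h3 : star (↑u⁻¹ : H →L[ℂ] H) * (a + (δ : ℂ) • 1) = 1 := by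
      rw [← hsa, ← star_mul, h2, star_one]
    exact left_inv_eq_right_inv h3 h2
  · rw [← M.commutant_commutant, VonNeumannAlgebra.mem_commutant_iff]
    intro g hg
    rw [VonNeumannAlgebra.mem_commutant_iff] at hg
    have hc : Commute g u := by
      rw [hu]
      exact ((show Commute a g from hg a hM).symm).add_right ((Commute.one_right g).smul_right _)
    exact hc.units_inv_right

theorem norm_add_smul_sq (a : H →L[ℂ] H) (δ : ℝ) (ζ : H) :
    ‖(a + (δ : ℂ) • 1) ζ‖ ^ 2 = ‖a ζ‖ ^ 2 + 2 * δ * (inner ℂ (a ζ) ζ).re + δ ^ 2 * ‖ζ‖ ^ 2 := by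
  have e : (a + (δ : ℂ) • 1) ζ = a ζ + (δ : ℂ) • ζ := by simp
  rw [e, @norm_add_sq ℂ, inner_smul_right, norm_smul, mul_pow, Complex.norm_real,
    Real.norm_eq_abs, sq_abs]
  simp
  ring

theorem norm_le_norm_add_smul {a : H →L[ℂ] H} (ha : 0 ≤ a) {δ : ℝ} (hδ : 0 ≤ δ) (ζ : H) :
    ‖a ζ‖ ≤ ‖(a + (δ : ℂ) • 1) ζ‖ ∧ δ * ‖ζ‖ ≤ ‖(a + (δ : ℂ) • 1) ζ‖ := by
  have h := norm_add_smul_sq a δ ζ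
  have h0 := (opNonneg_iff ha.isSelfAdjoint).1 ha ζ
  have h1 : 0 ≤ 2 * δ * (inner ℂ (a ζ) ζ).re := by positivity
  constructor
  · refine le_of_sq_le_sq ?_ (norm_nonneg _)
    rw [h]; nlinarith [sq_nonneg (δ * ‖ζ‖)]
  · refine le_of_sq_le_sq ?_ (norm_nonneg _)
    rw [h, mul_pow]; nlinarith [sq_nonneg ‖a ζ‖]

end Order

/-! ### Douglas factorization and the mixed Schwarz inequality -/

section Factorization

variable {H : Type*} [NormedAddCommGroup H] [InnerProductSpace ℂ H] [CompleteSpace H]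

theorem inner_apply_eq_star (x : H →L[ℂ] H) (ξ η : H) :
    inner ℂ η (x ξ) = inner ℂ (star x η) ξ := by
  rw [ContinuousLinearMap.star_eq_adjoint, ContinuousLinearMap.adjoint_inner_left]

/-- Douglas factorization: `x = a y b` with a contraction `y`. -/
theorem exists_factorization {M : VonNeumannAlgebra H} {a b x : H →L[ℂ] H} (ha : a ∈ M)
    (hb : b ∈ M) (hx : x ∈ M) (ha0 : 0 ≤ a) (hb0 : 0 ≤ b)
    (h : ∀ ξ η, ‖inner ℂ η (x ξ)‖ ≤ ‖a η‖ * ‖b ξ‖) :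
    ∃ y ∈ M, ‖y‖ ≤ 1 ∧ x = a * y * b := by
  let δ : ℕ → ℝ := fun n => 1 / ((n : ℝ) + 1)
  have hδ : ∀ n, 0 < δ n := fun n => Nat.one_div_pos_of_nat
  have hδ0 : Tendsto δ atTop (𝓝 0) := tendsto_one_div_add_atTop_nhds_zero_nat
  choose ρ hρ hρ' hρs hρM using fun n => exists_inv_add ha0 (hδ n)
  choose σ hσ hσ' hσs hσM using fun n => exists_inv_add hb0 (hδ n)
  have key : ∀ {c r : H →L[ℂ] H} {d : ℝ}, 0 < d → 0 ≤ c → (c + (d : ℂ) • 1) * r = 1 → ∀ ξ,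
      ‖c (r ξ)‖ ≤ ‖ξ‖ ∧ d * ‖r ξ‖ ≤ ‖ξ‖ ∧ c (r ξ) = ξ - (d : ℂ) • r ξ := by
    intro c r d hd hc hr ξ
    have e : (c + (d : ℂ) • 1) (r ξ) = ξ := congrArg (fun T : H →L[ℂ] H => T ξ) hr
    have := norm_le_norm_add_smul hc hd.le (r ξ)
    rw [e] at this
    refine ⟨this.1, this.2, ?_⟩
    rw [eq_sub_iff_add_eq]
    simpa using e
  have key2 : ∀ {c r : H →L[ℂ] H} {d : ℝ}, r * (c + (d : ℂ) • 1) = 1 → ∀ ξ,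
      r (c ξ) = ξ - (d : ℂ) • r ξ := by
    intro c r d hr ξ
    have e : r ((c + (d : ℂ) • 1) ξ) = ξ := congrArg (fun T : H →L[ℂ] H => T ξ) hr
    rw [eq_sub_iff_add_eq]
    simpa using e
  -- The regularized quotients (a + δ)⁻¹ x (b + δ)⁻¹ are contractions because ‖a (a + δ)⁻¹‖ ≤ 1 and
  -- likewise for b; y is a weak limit of them.
  have hT : ∀ n, ‖ρ n * x * σ n‖ ≤ 1 := fun n => opNorm_le_one_of_inner fun ξ η => by
    have e : inner ℂ η ((ρ n * x * σ n) ξ) = inner ℂ (ρ n η) (x (σ n ξ)) := by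
      change inner ℂ η (ρ n (x (σ n ξ))) = _
      rw [inner_apply_eq_star, hρs]
    rw [e]
    refine (h _ _).trans ?_
    have h1 := (key (hδ n) ha0 (hρ' n) η).1
    have h2 := (key (hδ n) hb0 (hσ' n) ξ).1
    gcongr
  obtain ⟨y, hy, hlim⟩ := exists_isWeakLim (hyperfilter ℕ) hT
  refine ⟨y, hlim.mem fun n => mul_mem (mul_mem (hρM n M ha) hx) (hσM n M hb), hy, ?_⟩
  refine IsWeakLim.unique (U := (hyperfilter ℕ : Filter ℕ)) (y := fun n => a * (ρ n * x * σ n) * b)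
    ?_ (hlim.mul_mul a b)
  intro ξ η
  have hle : ((hyperfilter ℕ : Ultrafilter ℕ) : Filter ℕ) ≤ atTop := Nat.hyperfilter_le_atTop
  refine Tendsto.mono_left ?_ hle
  rw [tendsto_iff_norm_sub_tendsto_zero]
  refine squeeze_zero (fun _ => norm_nonneg _)
    (g := fun n => δ n * (‖η‖ * (‖b‖ * ‖ξ‖) + ‖a‖ * ‖η‖ * ‖ξ‖)) (fun n => ?_)
    (by simpa using hδ0.mul_const (‖η‖ * (‖b‖ * ‖ξ‖) + ‖a‖ * ‖η‖ * ‖ξ‖))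
  -- With aρ = 1 - δρ and σb = 1 - δσ, the product a ρ x σ b differs from x by terms which the
  -- hypothesis bounds by a multiple of δ.
  have e : inner ℂ η ((a * (ρ n * x * σ n) * b) ξ)
      = inner ℂ (η - (δ n : ℂ) • ρ n η) (x (ξ - (δ n : ℂ) • σ n ξ)) := by
    change inner ℂ η (a (ρ n (x (σ n (b ξ))))) = _
    rw [inner_apply_eq_star a, ha0.isSelfAdjoint.star_eq, inner_apply_eq_star, hρs,
      key2 (hρ n), key2 (hσ n)]
  have e2 : inner ℂ (η - (δ n : ℂ) • ρ n η) (x (ξ - (δ n : ℂ) • σ n ξ)) - inner ℂ η (x ξ)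
      = - inner ℂ ((δ n : ℂ) • ρ n η) (x (ξ - (δ n : ℂ) • σ n ξ))
        - inner ℂ η (x ((δ n : ℂ) • σ n ξ)) := by
    rw [map_sub, inner_sub_left, inner_sub_right, inner_sub_right]
    ring
  rw [e, e2]
  have hk1 := key (hδ n) ha0 (hρ' n) η
  have hk2 := key (hδ n) hb0 (hσ' n) ξ
  refine (norm_sub_le _ _).trans ?_
  rw [norm_neg, mul_add]
  refine add_le_add ((h _ _).trans ?_) ((h _ _).trans ?_)
  · rw [← hk2.2.2, map_smul, norm_smul, Complex.norm_real, Real.norm_of_nonneg (hδ n).le,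
      mul_assoc]
    have := hk1.1
    have h3 : ‖b (b (σ n ξ))‖ ≤ ‖b‖ * ‖ξ‖ := (b.le_opNorm _).trans (by gcongr; exact hk2.1)
    have := (hδ n).le
    gcongr
  · rw [map_smul, norm_smul, Complex.norm_real, Real.norm_of_nonneg (hδ n).le]
    have := hk2.1
    have h3 := a.le_opNorm η
    have h4 := (hδ n).le
    calc ‖a η‖ * (δ n * ‖b (σ n ξ)‖) = δ n * (‖a η‖ * ‖b (σ n ξ)‖) := by ring
      _ ≤ δ n * (‖a‖ * ‖η‖ * ‖ξ‖) := by gcongr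

/-- The norm of a positive product `u * v` is at most the norm of `v * u`. -/
theorem norm_mul_le_norm_mul_comm {u v : H →L[ℂ] H} (h : 0 ≤ u * v) : ‖u * v‖ ≤ ‖v * u‖ := by
  rcases subsingleton_or_nontrivial H with hH | hH
  · have : u * v = v * u := Subsingleton.elim _ _
    rw [this]
  · by_cases h0 : ‖u * v‖ = 0
    · rw [h0]; exact norm_nonneg _
    · have h1 : ‖u * v‖ ∈ spectrum ℝ (u * v) := CStarAlgebra.norm_mem_spectrum_of_nonneg h
      have h2 : ‖u * v‖ ∈ spectrum ℝ (v * u) := by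
        have h3 : ‖u * v‖ ∈ spectrum ℝ (u * v) \ {0} := ⟨h1, h0⟩
        rw [spectrum.nonzero_mul_comm] at h3
        exact h3.1
      simpa using spectrum.norm_le_norm_of_mem h2

theorem inner_sqrt {P : H →L[ℂ] H} (hP : 0 ≤ P) (ξ : H) :
    ‖CFC.sqrt P ξ‖ ^ 2 = (inner ℂ (P ξ) ξ).re := by
  rw [← inner_star_mul_self, (CFC.sqrt_nonneg P).isSelfAdjoint.star_eq,
    CFC.sqrt_mul_sqrt_self P hP]

/-- The operator q is (S + δ)^{-1/2}, built as P^{1/2} P⁻¹ with P = S + δ. -/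
theorem exists_inv_sqrt_add {S : H →L[ℂ] H} (hS : 0 ≤ S) {δ : ℝ} (hδ : 0 < δ) :
    ∃ q : H →L[ℂ] H, CFC.sqrt (S + (δ : ℂ) • 1) * q = 1 ∧ q * CFC.sqrt (S + (δ : ℂ) • 1) = 1 ∧
      star q = q ∧ (S + (δ : ℂ) • 1) * (q * q) = 1 := by
  obtain ⟨R, hR, hR', hRs, -⟩ := exists_inv_add hS hδ
  have hP0 : 0 ≤ S + (δ : ℂ) • (1 : H →L[ℂ] H) :=
    add_nonneg hS (NSFTrace.ofReal_smul_nonneg zero_le_one ⟨δ, hδ.le⟩)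
  set P := S + (δ : ℂ) • (1 : H →L[ℂ] H)
  set p := CFC.sqrt P
  have hpp : p * p = P := CFC.sqrt_mul_sqrt_self P hP0
  have hps : star p = p := (CFC.sqrt_nonneg P).isSelfAdjoint.star_eq
  have h1 : p * (p * R) = 1 := by rw [← mul_assoc, hpp, hR']
  have h2 : (R * p) * p = 1 := by rw [mul_assoc, hpp, hR]
  have h3 : R * p = p * R := left_inv_eq_right_inv h2 h1
  refine ⟨p * R, h1, by rwa [← h3], by rw [star_mul, hRs, hps, h3], ?_⟩
  calc P * (p * R * (p * R)) = p * (p * (p * R)) * (p * R) := by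
        rw [← hpp]; simp only [mul_assoc]
    _ = 1 := by rw [h1, mul_one, h1]

/-- Mixed Schwarz inequality. -/
theorem norm_inner_le_sqrt_mul_sqrt {x S T : H →L[ℂ] H} (hS : 0 ≤ S) (hT : 0 ≤ T)
    (h1 : x * star x ≤ S * S) (h2 : star x * x ≤ T * T) (ξ η : H) :
    ‖inner ℂ η (x ξ)‖ ≤ ‖CFC.sqrt S η‖ * ‖CFC.sqrt T ξ‖ := by
  have hx1 : ∀ ζ, ‖star x ζ‖ ≤ ‖S ζ‖ := by
    refine star_mul_self_le_iff.1 ?_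
    rwa [star_star, hS.isSelfAdjoint.star_eq]
  have hx2 : ∀ ζ, ‖x ζ‖ ≤ ‖T ζ‖ := by
    refine star_mul_self_le_iff.1 ?_
    rwa [hT.isSelfAdjoint.star_eq]
  have main : ∀ δ : ℝ, 0 < δ → ‖inner ℂ η (x ξ)‖ ^ 2 ≤
      (‖CFC.sqrt S η‖ ^ 2 + δ * ‖η‖ ^ 2) * (‖CFC.sqrt T ξ‖ ^ 2 + δ * ‖ξ‖ ^ 2) := by
    intro δ hδ
    have hs : 0 ≤ ((δ : ℂ) • (1 : H →L[ℂ] H)) :=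
      NSFTrace.ofReal_smul_nonneg zero_le_one ⟨δ, hδ.le⟩
    obtain ⟨q, hpq, -, hqs, hqq⟩ := exists_inv_sqrt_add hS hδ
    obtain ⟨v, -, hvw, hvs, hvv⟩ := exists_inv_sqrt_add hT hδ
    have hP0 := add_nonneg hS hs
    have hW0 := add_nonneg hT hs
    set P := S + (δ : ℂ) • (1 : H →L[ℂ] H) with hP
    set W := T + (δ : ℂ) • (1 : H →L[ℂ] H) with hW
    set p := CFC.sqrt P with hp
    set w := CFC.sqrt W with hw
    have hps : star p = p := (CFC.sqrt_nonneg P).isSelfAdjoint.star_eq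
    -- t = (S + δ)^{-1/2} x (T + δ)^{-1/2}. Its contractivity is the whole inequality, up to letting
    -- δ → 0.
    set t := q * x * v with ht
    have htn : ‖t‖ ≤ 1 := by
      have e1 : t * star t = q * (x * (v * v) * star x * q) := by
        rw [ht, star_mul, star_mul, hqs, hvs]; simp only [mul_assoc]
      have e2 : (x * (v * v) * star x * q) * q = (x * (v * v)) * (star x * (q * q)) := by
        simp only [mul_assoc]
      -- Moving the leading factor q to the end does not decrease the norm, and regroups the product
      -- as x (T + δ)⁻¹ times x* (S + δ)⁻¹, two contractions by hypothesis.
      have h3 : ‖t * star t‖ ≤ ‖(x * (v * v)) * (star x * (q * q))‖ := by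
        have := norm_mul_le_norm_mul_comm (u := q) (v := x * (v * v) * star x * q)
          (by rw [← e1]; exact mul_star_self_nonneg t)
        rwa [← e1, e2] at this
      have h4 : ‖x * (v * v)‖ ≤ 1 := by
        refine ContinuousLinearMap.opNorm_le_bound _ zero_le_one fun ζ => ?_
        have e : W ((v * v) ζ) = ζ := congrArg (fun T : H →L[ℂ] H => T ζ) hvv
        have := (hx2 ((v * v) ζ)).trans (norm_le_norm_add_smul hT hδ.le ((v * v) ζ)).1
        rw [← hW, e] at this
        rwa [one_mul]
      have h5 : ‖star x * (q * q)‖ ≤ 1 := by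
        refine ContinuousLinearMap.opNorm_le_bound _ zero_le_one fun ζ => ?_
        have e : P ((q * q) ζ) = ζ := congrArg (fun T : H →L[ℂ] H => T ζ) hqq
        have := (hx1 ((q * q) ζ)).trans (norm_le_norm_add_smul hS hδ.le ((q * q) ζ)).1
        rw [← hP, e] at this
        rwa [one_mul]
      have h6 : ‖t‖ * ‖t‖ ≤ 1 := by
        rw [← CStarRing.norm_self_mul_star]
        exact h3.trans ((norm_mul_le _ _).trans (mul_le_one₀ h4 (norm_nonneg _) h5))
      nlinarith [norm_nonneg t]
    have ex : p * t * w = x := by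
      rw [ht]
      calc p * (q * x * v) * w = (p * q) * x * (v * w) := by simp only [mul_assoc]
        _ = x := by rw [hpq, hvw, one_mul, mul_one]
    have e3 : inner ℂ η (x ξ) = inner ℂ (p η) (t (w ξ)) := by
      rw [← ex]
      change inner ℂ η (p (t (w ξ))) = _
      rw [inner_apply_eq_star, hps]
    have h7 : ‖inner ℂ η (x ξ)‖ ≤ ‖p η‖ * ‖w ξ‖ := by
      rw [e3]
      refine (norm_inner_le_norm _ _).trans ?_
      have := t.le_of_opNorm_le htn (w ξ)
      rw [one_mul] at this
      gcongr
    have h8 : ∀ {Z : H →L[ℂ] H} (ζ : H), 0 ≤ Z → 0 ≤ Z + (δ : ℂ) • (1 : H →L[ℂ] H) →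
        ‖CFC.sqrt (Z + (δ : ℂ) • (1 : H →L[ℂ] H)) ζ‖ ^ 2 = ‖CFC.sqrt Z ζ‖ ^ 2 + δ * ‖ζ‖ ^ 2 := by
      intro Z ζ hZ hZ'
      rw [inner_sqrt hZ', inner_sqrt hZ]
      have : (Z + (δ : ℂ) • (1 : H →L[ℂ] H)) ζ = Z ζ + (δ : ℂ) • ζ := by simp
      rw [this, inner_add_left, inner_smul_left, Complex.conj_ofReal, Complex.add_re,
        Complex.re_ofReal_mul]
      exact congrArg (_ + δ * ·) (inner_self_eq_norm_sq (𝕜 := ℂ) ζ)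
    rw [← h8 η hS hP0, ← h8 ξ hT hW0, ← mul_pow]
    gcongr
  refine le_of_sq_le_sq ?_ (by positivity)
  rw [mul_pow]
  have hc : Tendsto (fun δ : ℝ => (‖CFC.sqrt S η‖ ^ 2 + δ * ‖η‖ ^ 2) *
      (‖CFC.sqrt T ξ‖ ^ 2 + δ * ‖ξ‖ ^ 2)) (𝓝[>] 0) (𝓝 (‖CFC.sqrt S η‖ ^ 2 * ‖CFC.sqrt T ξ‖ ^ 2)) := by
    have : ContinuousAt (fun δ : ℝ => (‖CFC.sqrt S η‖ ^ 2 + δ * ‖η‖ ^ 2) *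
      (‖CFC.sqrt T ξ‖ ^ 2 + δ * ‖ξ‖ ^ 2)) 0 := by fun_prop
    have := this.tendsto
    simp only [zero_mul, add_zero] at this
    exact this.mono_left nhdsWithin_le_nhds
  exact ge_of_tendsto hc (eventually_nhdsWithin_of_forall fun δ hδ => main δ hδ)

end Factorization

/-! ### The transform s/(1 + s) and monotone weak limits -/

section Damp

variable {H : Type*} [NormedAddCommGroup H] [InnerProductSpace ℂ H] [CompleteSpace H]

/-- The bounded operator monotone transform `s ↦ s (1 + s)⁻¹`. -/
noncomputable def damp (s : H →L[ℂ] H) : H →L[ℂ] H := cfc (fun t : ℝ => 1 - (1 + t)⁻¹) s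

theorem continuousOn_damp {s : H →L[ℂ] H} (hs : 0 ≤ s) :
    ContinuousOn (fun t : ℝ => 1 - (1 + t)⁻¹) (spectrum ℝ s) := by
  refine continuousOn_const.sub (ContinuousOn.inv₀ (by fun_prop) fun t ht => ?_)
  have := spectrum_nonneg_of_nonneg hs ht
  positivity

/-- Passage to the non-unital calculus, in which operator monotonicity of 1 - (1 + t)⁻¹ is stated.
-/
theorem damp_eq_cfcₙ {s : H →L[ℂ] H} (hs : 0 ≤ s) :
    damp s = cfcₙ (fun t : ℝ => 1 - (1 + t)⁻¹) s := by
  rw [damp, cfcₙ_eq_cfc (hf := ?_) (hf0 := by simp)]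
  refine continuousOn_const.sub (ContinuousOn.inv₀ (by fun_prop) fun t ht => ?_)
  have := quasispectrum_nonneg_of_nonneg s hs t ht
  positivity

theorem damp_mono {s t : H →L[ℂ] H} (hs : 0 ≤ s) (h : s ≤ t) : damp s ≤ damp t := by
  rw [damp_eq_cfcₙ hs, damp_eq_cfcₙ (hs.trans h)]
  exact CFC.monotoneOn_one_sub_one_add_inv_real hs (hs.trans h) h

theorem damp_nonneg {s : H →L[ℂ] H} (hs : 0 ≤ s) : 0 ≤ damp s := by
  refine cfc_nonneg fun t ht => ?_
  have := spectrum_nonneg_of_nonneg hs ht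
  rw [sub_nonneg]
  exact inv_le_one_of_one_le₀ (by linarith)

theorem damp_le_self {s : H →L[ℂ] H} (hs : 0 ≤ s) : damp s ≤ s := by
  conv_rhs => rw [← cfc_id' ℝ s hs.isSelfAdjoint]
  refine cfc_mono (fun t ht => ?_) (continuousOn_damp hs) (by fun_prop)
  have h0 := spectrum_nonneg_of_nonneg hs ht
  have : 1 - (1 + t)⁻¹ = t / (1 + t) := by field_simp; ring
  rw [this]
  exact div_le_self h0 (by linarith)

theorem norm_damp_le {s : H →L[ℂ] H} (hs : 0 ≤ s) : ‖damp s‖ ≤ 1 := by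
  refine norm_cfc_le zero_le_one fun t ht => ?_
  have h0 := spectrum_nonneg_of_nonneg hs ht
  have h1 : (1 + t)⁻¹ ≤ 1 := inv_le_one_of_one_le₀ (by linarith)
  have h2 : 0 ≤ (1 + t)⁻¹ := by positivity
  rw [Real.norm_eq_abs, abs_le]
  constructor <;> linarith

/-- The scalar inequality t ≤ (1 + c) t/(1 + t) on [0, c]: damping a bounded operator loses only a
constant, so that bounds on damped operators can be converted back. -/
theorem le_smul_damp {s : H →L[ℂ] H} (hs : 0 ≤ s) {c : ℝ≥0} (hc : ‖s‖ ≤ c) :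
    s ≤ (((1 + c : ℝ≥0) : ℝ) : ℂ) • damp s := by
  rw [Complex.coe_smul, damp, ← cfc_smul _ _ _ (continuousOn_damp hs)]
  conv_lhs => rw [← cfc_id' ℝ s hs.isSelfAdjoint]
  refine cfc_mono (fun t ht => ?_) (by fun_prop) ?_
  swap
  · have := continuousOn_damp hs
    exact this.const_smul (((1 + c : ℝ≥0) : ℝ))
  have h0 := spectrum_nonneg_of_nonneg hs ht
  have h2 : t ≤ c := by
    rcases subsingleton_or_nontrivial H with hH | hH
    · simp at ht
    · exact ((le_abs_self t).trans (spectrum.norm_le_norm_of_mem ht)).trans hc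
  have e : 1 - (1 + t)⁻¹ = t / (1 + t) := by field_simp; ring
  simp only [smul_eq_mul, NNReal.coe_add, NNReal.coe_one]
  rw [e, mul_div_assoc', le_div_iff₀ (by positivity), mul_comm]
  gcongr

theorem damp_mem {M : VonNeumannAlgebra H} {s : H →L[ℂ] H} (hs : s ∈ M) :
    damp s ∈ M := by
  rw [← M.commutant_commutant, VonNeumannAlgebra.mem_commutant_iff]
  intro g hg
  rw [VonNeumannAlgebra.mem_commutant_iff] at hg
  have hc : Commute s g := hg s hs
  exact (hc.cfc_real _).symm

/-- The quadratic forms increase to that of the limit, since the hyperfilter refines `atTop`. This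
puts weak limits in the form required by normality of the trace. -/
theorem IsWeakLim.isLUB {y : ℕ → H →L[ℂ] H} {Y : H →L[ℂ] H} (hy : Monotone y)
    (h0 : ∀ k, 0 ≤ y k) (h : IsWeakLim (hyperfilter ℕ : Filter ℕ) y Y) :
    0 ≤ Y ∧ IsLUB (Set.range y) Y := by
  have hle : (hyperfilter ℕ : Filter ℕ) ≤ atTop := Nat.hyperfilter_le_atTop
  have hre : ∀ ξ, Tendsto (fun k => (inner ℂ (y k ξ) ξ).re) (hyperfilter ℕ)
      (𝓝 (inner ℂ (Y ξ) ξ).re) := fun ξ => by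
    have := (Complex.continuous_re.tendsto _).comp (h ξ ξ)
    rw [← inner_conj_symm, Complex.conj_re] at this
    refine this.congr fun k => ?_
    rw [Function.comp_apply, ← inner_conj_symm, Complex.conj_re]
  have hsa : IsSelfAdjoint Y := by
    rw [ContinuousLinearMap.isSelfAdjoint_iff']
    ext ξ
    refine ext_inner_left ℂ fun η => ?_
    rw [ContinuousLinearMap.adjoint_inner_right]
    have h1 := (Complex.continuous_conj.tendsto _).comp (h η ξ)
    rw [inner_conj_symm] at h1
    refine tendsto_nhds_unique h1 ((h ξ η).congr fun k => ?_)
    rw [Function.comp_apply, inner_conj_symm, inner_apply_eq_star,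
      (h0 k).isSelfAdjoint.star_eq]
  refine ⟨(opNonneg_iff hsa).2 fun ξ => ge_of_tendsto (hre ξ) (.of_forall fun k =>
    (opNonneg_iff (h0 k).isSelfAdjoint).1 (h0 k) ξ), ?_, ?_⟩
  · rintro _ ⟨k, rfl⟩
    refine (op_le_iff (h0 k).isSelfAdjoint hsa).2 fun ξ => ge_of_tendsto (hre ξ) (hle ?_)
    filter_upwards [eventually_ge_atTop k] with l hl
    exact (op_le_iff (h0 k).isSelfAdjoint (h0 l).isSelfAdjoint).1 (hy hl) ξ
  · intro Z hZ
    have hZs : IsSelfAdjoint Z := ((h0 0).trans (hZ ⟨0, rfl⟩)).isSelfAdjoint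
    exact (op_le_iff hsa hZs).2 fun ξ => le_of_tendsto (hre ξ) (.of_forall fun k =>
      (op_le_iff (h0 k).isSelfAdjoint hZs).1 (hZ ⟨k, rfl⟩) ξ)

end Damp

/-! ### Domination in trace and convergence of rapidly Cauchy sequences -/

namespace NSFTrace

variable {H : Type*} [NormedAddCommGroup H] [InnerProductSpace ℂ H] [CompleteSpace H]
variable {M : VonNeumannAlgebra H} (τ : NSFTrace M)

theorem map_zero' : τ.toFun 0 = 0 := by
  simpa using τ.map_smul 0 0 (zero_mem M) le_rfl

theorem map_sum' {ι : Type*} (F : Finset ι) {h : ι → H →L[ℂ] H} (hM : ∀ i, h i ∈ M)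
    (h0 : ∀ i, 0 ≤ h i) : τ.toFun (∑ i ∈ F, h i) = ∑ i ∈ F, τ.toFun (h i) := by
  classical
  induction F using Finset.induction_on with
  | empty => simpa using τ.map_zero'
  | insert i F hi ih =>
    rw [Finset.sum_insert hi, Finset.sum_insert hi, τ.map_add _ (hM i) _
      (sum_mem fun j _ => hM j) (h0 i) (Finset.sum_nonneg fun j _ => h0 j), ih]

/-- A series of positive operators with summable traces is, after damping, dominated by an
operator of controlled trace. -/
theorem exists_dominating {h : ℕ → H →L[ℂ] H} (hM : ∀ i, h i ∈ M) (h0 : ∀ i, 0 ≤ h i)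
    {B : ℝ≥0∞} (hB : ∀ K, ∑ i ∈ Finset.range K, τ.toFun (h i) ≤ B) :
    ∃ q ∈ M, 0 ≤ q ∧ τ.toFun q ≤ B ∧ ∀ (K : ℕ) (g : H →L[ℂ] H) (c : ℝ≥0), 0 ≤ g →
      g ≤ ∑ i ∈ Finset.range K, h i → ‖g‖ ≤ c → g ≤ (((1 + c : ℝ≥0) : ℝ) : ℂ) • q := by
  let s : ℕ → H →L[ℂ] H := fun K => ∑ i ∈ Finset.range K, h i
  have hs0 : ∀ K, 0 ≤ s K := fun K => Finset.sum_nonneg fun i _ => h0 i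
  have hsM : ∀ K, s K ∈ M := fun K => sum_mem fun i _ => hM i
  have hsm : Monotone s := fun K L hKL => Finset.sum_le_sum_of_subset_of_nonneg
    (Finset.range_mono hKL) fun i _ _ => h0 i
  -- The partial sums may be unbounded in operator norm, but damped they form an increasing sequence
  -- of contractions. Its supremum q has trace at most B by normality and damp s ≤ s.
  obtain ⟨q, -, hq⟩ := exists_isWeakLim (hyperfilter ℕ) fun K => norm_damp_le (hs0 K)
  have hm : Monotone fun K => damp (s K) := fun K L hKL => damp_mono (hs0 K) (hsm hKL)
  obtain ⟨hq0, hlub⟩ := hq.isLUB hm fun K => damp_nonneg (hs0 K)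
  have hqM : q ∈ M := hq.mem fun K => damp_mem (hsM K)
  refine ⟨q, hqM, hq0, ?_, fun K g c hg hgs hc => ?_⟩
  · rw [τ.normal _ (Set.range_nonempty _) hm.directed_le.directedOn_range ?_ q hqM hlub]
    · rw [iSup_range]
      refine iSup_le fun K => ?_
      refine (τ.mono (damp_mem (hsM K)) (hsM K) (damp_nonneg (hs0 K))
        (damp_le_self (hs0 K))).trans ?_
      rw [τ.map_sum' _ hM h0]
      exact hB K
    · rintro _ ⟨K, rfl⟩
      exact ⟨damp_mem (hsM K), damp_nonneg (hs0 K)⟩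
  · refine (le_smul_damp hg hc).trans ?_
    have h1 : damp g ≤ q := (damp_mono hg hgs).trans (hlub.1 ⟨K, rfl⟩)
    rw [← sub_nonneg, ← smul_sub]
    exact ofReal_smul_nonneg (sub_nonneg.2 h1) _

/-- Iterating |x + y|² ≤ 2|x|² + 2|y|²: each further splitting doubles the weight of the remaining
jumps. -/
theorem star_mul_self_telescope_le (w : ℕ → H →L[ℂ] H) (N K : ℕ) :
    star (w N - w (N + K)) * (w N - w (N + K)) ≤ ∑ j ∈ Finset.range K,
      ((((2 : ℝ≥0) ^ (j + 1) : ℝ≥0) : ℝ) : ℂ) •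
        (star (w (N + j) - w (N + j + 1)) * (w (N + j) - w (N + j + 1))) := by
  induction K generalizing N with
  | zero => simp
  | succ K ih =>
    have h1 := add_sq_le (w N - w (N + 1)) (w (N + 1) - w (N + 1 + K)) one_pos
    rw [sub_add_sub_cancel, show N + 1 + K = N + (K + 1) by ring] at h1
    refine h1.trans ?_
    rw [Finset.sum_range_succ', add_comm]
    refine add_le_add ?_ ?_
    · have h2 := ih (N + 1)
      rw [show N + 1 + K = N + (K + 1) by ring] at h2
      rw [← sub_nonneg] at h2
      have h3 := ofReal_smul_nonneg h2 2
      rw [smul_sub, sub_nonneg, Finset.smul_sum] at h3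
      refine le_trans (le_of_eq ?_) (h3.trans (le_of_eq ?_))
      · congr 2; norm_num
      · refine Finset.sum_congr rfl fun j _ => ?_
        rw [smul_smul, show N + (j + 1) = N + 1 + j by ring]
        congr 1
        push_cast
        ring
    · refine le_of_eq ?_
      simp only [add_zero, zero_add]
      congr 2; norm_num

/-- A bounded sequence in `M` that is rapidly Cauchy for `‖·‖_2` converges for `‖·‖_2` to its weak
operator limit. -/
theorem toFun_sub_weakLim_le {U : Filter ℕ} [U.NeBot] (hU : U ≤ atTop) {w : ℕ → H →L[ℂ] H}
    {Y : H →L[ℂ] H} (hw : ∀ i, w i ∈ M) {C : ℝ≥0} (hC : ∀ i, ‖w i‖ ≤ C)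
    (hD : ∀ i, τ.toFun (star (w i - w (i + 1)) * (w i - w (i + 1))) ≤ (8⁻¹ : ℝ≥0∞) ^ i)
    (hY : IsWeakLim U w Y) (N : ℕ) :
    τ.toFun (star (w N - Y) * (w N - Y)) ≤ (1 + (2 * C) ^ 2 : ℝ≥0) * (4 * (8⁻¹ : ℝ≥0∞) ^ N) := by
  have hYM : Y ∈ M := hY.mem hw
  have hd : ∀ i j, w i - w j ∈ M := fun i j => sub_mem (hw i) (hw j)
  obtain ⟨q, hqM, hq0, hqτ, hq⟩ := τ.exists_dominating
    (h := fun j => ((((2 : ℝ≥0) ^ (j + 1) : ℝ≥0) : ℝ) : ℂ) •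
      (star (w (N + j) - w (N + j + 1)) * (w (N + j) - w (N + j + 1))))
    (fun j => smul_mem' (star_mul_mem (hd _ _)) _)
    (fun j => ofReal_smul_nonneg (star_mul_self_nonneg _) _)
    (B := 4 * (8⁻¹ : ℝ≥0∞) ^ N) (fun K => by
      have h1 : ∀ j, τ.toFun (((((2 : ℝ≥0) ^ (j + 1) : ℝ≥0) : ℝ) : ℂ) •
          (star (w (N + j) - w (N + j + 1)) * (w (N + j) - w (N + j + 1))))
          ≤ 2 * (8⁻¹ : ℝ≥0∞) ^ N * (2⁻¹) ^ j := fun j => by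
        rw [τ.map_smul _ _ (star_mul_mem (hd _ _)) (star_mul_self_nonneg _)]
        refine (mul_le_mul_right (hD (N + j)) _).trans ?_
        have h8 : (2 : ℝ≥0∞) ^ j * (8⁻¹) ^ j ≤ 2⁻¹ ^ j := by
          rw [← mul_pow]
          gcongr
          rw [show (8 : ℝ≥0∞) = 2 * 4 by norm_num, ENNReal.mul_inv (by simp) (by simp),
            ← mul_assoc, ENNReal.mul_inv_cancel (by simp) (by simp), one_mul]
          exact ENNReal.inv_le_inv.2 (by norm_num)
        calc ((((2 : ℝ≥0) ^ (j + 1) : ℝ≥0)) : ℝ≥0∞) * (8⁻¹ : ℝ≥0∞) ^ (N + j)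
            = 2 * (8⁻¹ : ℝ≥0∞) ^ N * (2 ^ j * 8⁻¹ ^ j) := by
              push_cast; ring
          _ ≤ _ := by gcongr
      refine (Finset.sum_le_sum fun j _ => h1 j).trans ?_
      rw [← Finset.mul_sum]
      have h2 : ∑ j ∈ Finset.range K, (2⁻¹ : ℝ≥0∞) ^ j ≤ 2 :=
        (ENNReal.sum_le_tsum _).trans (by rw [ENNReal.tsum_geometric]; simp)
      calc 2 * (8⁻¹ : ℝ≥0∞) ^ N * ∑ j ∈ Finset.range K, (2⁻¹ : ℝ≥0∞) ^ j
          ≤ 2 * (8⁻¹ : ℝ≥0∞) ^ N * 2 := by gcongr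
        _ = _ := by ring)
  -- A bound for the operator norm of |w_N - w_{N+K}|², uniform in K, which lets one q dominate all
  -- of these operators.
  set c : ℝ≥0 := (2 * C) ^ 2 with hc
  have hcq : ∀ K, star (w N - w (N + K)) * (w N - w (N + K)) ≤ (((1 + c : ℝ≥0) : ℝ) : ℂ) • q := by
    intro K
    refine hq K _ c (star_mul_self_nonneg _) (star_mul_self_telescope_le w N K) ?_
    rw [CStarRing.norm_star_mul_self, hc, NNReal.coe_pow, sq]
    have h3 : ‖w N - w (N + K)‖ ≤ ((2 * C : ℝ≥0) : ℝ) := by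
      refine (norm_sub_le _ _).trans ?_
      push_cast
      linarith [hC N, hC (N + K)]
    exact mul_le_mul h3 h3 (norm_nonneg _) (NNReal.coe_nonneg _)
  have hcq0 := ofReal_smul_nonneg hq0 (1 + c)
  -- The domination is a pointwise bound on ‖(w_N - w_{N+K}) ξ‖, hence survives the weak limit in K.
  have hfin : star (w N - Y) * (w N - Y) ≤ (((1 + c : ℝ≥0) : ℝ) : ℂ) • q := by
    have hsq := CFC.sqrt_mul_sqrt_self _ hcq0
    have hss := (CFC.sqrt_nonneg ((((1 + c : ℝ≥0) : ℝ) : ℂ) • q)).isSelfAdjoint.star_eq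
    rw [← hsq]
    nth_rw 1 [← hss]
    rw [star_mul_self_le_iff]
    intro ξ
    have hl : IsWeakLim U (fun k => w k - w N) (Y - w N) := hY.sub_const (w N)
    have e : ‖(w N - Y) ξ‖ = ‖(Y - w N) ξ‖ := by
      rw [← neg_sub, neg_apply, norm_neg]
    rw [e]
    refine hl.norm_apply_le (hU ?_)
    filter_upwards [eventually_ge_atTop N] with k hk
    have h4 := hcq (k - N)
    rw [Nat.add_sub_cancel' hk, ← hsq] at h4
    nth_rw 1 [← hss] at h4
    have h5 := star_mul_self_le_iff.1 h4 ξ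
    rwa [← neg_sub, neg_apply, norm_neg] at h5
  refine (τ.mono (star_mul_mem (sub_mem (hw N) hYM)) (smul_mem' hqM _) (star_mul_self_nonneg _)
    hfin).trans ?_
  rw [τ.map_smul _ _ hqM hq0]
  gcongr

end NSFTrace

/-! ### Trace inequalities: cyclicity, superadditivity, Hölder -/

namespace NSFTrace

variable {H : Type*} [NormedAddCommGroup H] [InnerProductSpace ℂ H] [CompleteSpace H]
variable {M : VonNeumannAlgebra H} (τ : NSFTrace M)

theorem sqrt_mul_mul_sqrt {P : H →L[ℂ] H} (hP : 0 ≤ P) :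
    CFC.sqrt P * P * CFC.sqrt P = P * P := by
  have h := CFC.sqrt_mul_sqrt_self P hP
  calc CFC.sqrt P * P * CFC.sqrt P
      = CFC.sqrt P * (CFC.sqrt P * CFC.sqrt P) * CFC.sqrt P := by rw [h]
    _ = (CFC.sqrt P * CFC.sqrt P) * (CFC.sqrt P * CFC.sqrt P) := by simp only [mul_assoc]
    _ = P * P := by rw [h]

theorem star_sqrt (P : H →L[ℂ] H) : star (CFC.sqrt P) = CFC.sqrt P :=
  (CFC.sqrt_nonneg P).isSelfAdjoint.star_eq

/-- Cyclicity in a form that stays in the positive cone, the only place where τ is meaningful: apply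
τ(z*z) = τ(zz*) to z = g P^{1/2}. -/
theorem toFun_conj {g P : H →L[ℂ] H} (hg : g ∈ M) (hP : P ∈ M) (h0 : 0 ≤ P) :
    τ.toFun (g * P * star g) = τ.toFun (CFC.sqrt P * (star g * g) * CFC.sqrt P) := by
  have h := τ.tracial (g * CFC.sqrt P) (mul_mem hg (sqrt_mem hP))
  rw [star_mul, star_sqrt] at h
  calc τ.toFun (g * P * star g)
      = τ.toFun (g * CFC.sqrt P * (CFC.sqrt P * star g)) := by
        nth_rw 1 [← CFC.sqrt_mul_sqrt_self P h0]; simp only [mul_assoc]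
    _ = _ := by rw [← h]; simp only [mul_assoc]

theorem sqrt_conj_nonneg (P : H →L[ℂ] H) {Q : H →L[ℂ] H} (hQ : 0 ≤ Q) :
    0 ≤ CFC.sqrt P * Q * CFC.sqrt P := by
  have := star_left_conjugate_nonneg hQ (CFC.sqrt P)
  rwa [star_sqrt] at this

theorem sqrt_conj_mono (P : H →L[ℂ] H) {Q R : H →L[ℂ] H} (h : Q ≤ R) :
    CFC.sqrt P * Q * CFC.sqrt P ≤ CFC.sqrt P * R * CFC.sqrt P := by
  have := star_left_conjugate_le_conjugate h (CFC.sqrt P)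
  rwa [star_sqrt] at this

theorem sqrt_conj_mem {P Q : H →L[ℂ] H} (hP : P ∈ M) (hQ : Q ∈ M) :
    CFC.sqrt P * Q * CFC.sqrt P ∈ M := mul_mem (mul_mem (sqrt_mem hP) hQ) (sqrt_mem hP)

/-- The symmetrized cross term stands for 2τ(WV). Write the square of the sum as its conjugation by
its own square root, split the middle factor, and use cyclicity on each part. -/
theorem toFun_sq_add {W V : H →L[ℂ] H} (hW : W ∈ M) (hV : V ∈ M) (hW0 : 0 ≤ W) (hV0 : 0 ≤ V) :
    τ.toFun ((W + V) * (W + V)) = τ.toFun (W * W) + τ.toFun (V * V) +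
      2 * τ.toFun (CFC.sqrt W * V * CFC.sqrt W) := by
  have hS0 : 0 ≤ W + V := add_nonneg hW0 hV0
  have hS : W + V ∈ M := add_mem hW hV
  have part : ∀ {A B : H →L[ℂ] H}, A ∈ M → B ∈ M → 0 ≤ A → 0 ≤ B →
      τ.toFun (CFC.sqrt (A + B) * A * CFC.sqrt (A + B)) =
        τ.toFun (A * A) + τ.toFun (CFC.sqrt A * B * CFC.sqrt A) := by
    intro A B hA hB hA0 hB0
    have h := τ.toFun_conj (sqrt_mem (add_mem hA hB)) hA hA0
    rw [star_sqrt, CFC.sqrt_mul_sqrt_self _ (add_nonneg hA0 hB0), mul_add, add_mul,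
      sqrt_mul_mul_sqrt hA0] at h
    rw [h, τ.map_add _ (mul_mem hA hA) _ (sqrt_conj_mem hA hB) _ (sqrt_conj_nonneg A hB0)]
    have := star_mul_self_nonneg A
    rwa [hA0.isSelfAdjoint.star_eq] at this
  have hsym : τ.toFun (CFC.sqrt V * W * CFC.sqrt V) = τ.toFun (CFC.sqrt W * V * CFC.sqrt W) := by
    have h := τ.toFun_conj (sqrt_mem hV) hW hW0
    rwa [star_sqrt, CFC.sqrt_mul_sqrt_self _ hV0] at h
  have h1 := part hW hV hW0 hV0
  have h2 := part hV hW hV0 hW0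
  rw [add_comm V W, hsym] at h2
  rw [← sqrt_mul_mul_sqrt hS0, mul_add, add_mul,
    τ.map_add _ (sqrt_conj_mem hS hW) _ (sqrt_conj_mem hS hV) (sqrt_conj_nonneg _ hW0)
      (sqrt_conj_nonneg _ hV0), h1, h2]
  ring

/-- Superadditivity of `A ↦ τ(A⁴)` on the positive cone. -/
theorem toFun_four_superadd {A B : H →L[ℂ] H} (hA : A ∈ M) (hB : B ∈ M) (hA0 : 0 ≤ A)
    (hB0 : 0 ≤ B) :
    τ.toFun ((A * A) * (A * A)) + τ.toFun ((B * B) * (B * B)) ≤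
      τ.toFun (((A + B) * (A + B)) * ((A + B) * (A + B))) := by
  have hC0 : 0 ≤ A + B := add_nonneg hA0 hB0
  have hC : A + B ∈ M := add_mem hA hB
  set C := A + B with hCdef
  have hCs : star C = C := hC0.isSelfAdjoint.star_eq
  -- g = C^{3/2}, so that C⁴ = gAg* + gBg*; each summand is compared with the corresponding fourth
  -- power.
  set g := C * CFC.sqrt C with hg
  have hgM : g ∈ M := mul_mem hC (sqrt_mem hC)
  have hgs : star g = CFC.sqrt C * C := by rw [hg, star_mul, star_sqrt, hCs]
  have hcube : star g * g = C * C * C := by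
    rw [hgs, hg]
    calc CFC.sqrt C * C * (C * CFC.sqrt C)
        = (CFC.sqrt C * (CFC.sqrt C * CFC.sqrt C)) * ((CFC.sqrt C * CFC.sqrt C) * CFC.sqrt C) := by
          rw [CFC.sqrt_mul_sqrt_self C hC0]
      _ = (CFC.sqrt C * CFC.sqrt C) * (CFC.sqrt C * CFC.sqrt C) * (CFC.sqrt C * CFC.sqrt C) := by
          simp only [mul_assoc]
      _ = C * C * C := by rw [CFC.sqrt_mul_sqrt_self C hC0]
  have hfour : (C * C) * (C * C) = g * A * star g + g * B * star g := by
    rw [← add_mul, ← mul_add, ← hCdef, hgs, hg]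
    calc C * C * (C * C) = C * (C * C) * C := by simp only [mul_assoc]
      _ = C * (CFC.sqrt C * C * CFC.sqrt C) * C := by rw [sqrt_mul_mul_sqrt hC0]
      _ = _ := by simp only [mul_assoc]
  -- The chain is τ(D⁴) ≤ τ((D^{1/2} C D^{1/2})²) = τ(D^{1/2} C D C D^{1/2}) ≤ τ(D^{1/2} C³ D^{1/2})
  -- = τ(gDg*).
  have part : ∀ {D : H →L[ℂ] H}, D ∈ M → 0 ≤ D → D ≤ C →
      τ.toFun ((D * D) * (D * D)) ≤ τ.toFun (g * D * star g) := by
    intro D hD hD0 hDC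
    rw [τ.toFun_conj hgM hD hD0, hcube]
    have hDD : 0 ≤ D * D := by
      have := star_mul_self_nonneg D
      rwa [hD0.isSelfAdjoint.star_eq] at this
    have h1 : D * D ≤ CFC.sqrt D * C * CFC.sqrt D := by
      rw [← sqrt_mul_mul_sqrt hD0]
      exact sqrt_conj_mono D hDC
    have h2 : C * D * C ≤ C * C * C := by
      have := star_left_conjugate_le_conjugate hDC C
      rwa [hCs] at this
    refine (τ.sq_mono (mul_mem hD hD) (sqrt_conj_mem hD hC) hDD h1).trans ?_
    have e : CFC.sqrt D * C * CFC.sqrt D * (CFC.sqrt D * C * CFC.sqrt D)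
        = CFC.sqrt D * (C * D * C) * CFC.sqrt D := by
      calc _ = CFC.sqrt D * (C * (CFC.sqrt D * CFC.sqrt D) * C) * CFC.sqrt D := by
            simp only [mul_assoc]
        _ = _ := by rw [CFC.sqrt_mul_sqrt_self D hD0]
    rw [e]
    refine τ.mono (sqrt_conj_mem hD (mul_mem (mul_mem hC hD) hC))
      (sqrt_conj_mem hD (mul_mem (mul_mem hC hC) hC)) (sqrt_conj_nonneg D ?_) (sqrt_conj_mono D h2)
    have := star_left_conjugate_nonneg hD0 C
    rwa [hCs] at this
  rw [hfour, τ.map_add _ (mul_mem (mul_mem hgM hA) (star_mem hgM)) _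
    (mul_mem (mul_mem hgM hB) (star_mem hgM)) (star_right_conjugate_nonneg hA0 g)
    (star_right_conjugate_nonneg hB0 g)]
  exact add_le_add (part hA hA0 (le_add_of_nonneg_right hB0))
    (part hB hB0 (le_add_of_nonneg_left hA0))

theorem mul_star_le_one {y : H →L[ℂ] H} (hy : ‖y‖ ≤ 1) : y * star y ≤ 1 := by
  have h := star_mul_self_le_iff (x := star y) (y := 1)
  rw [star_star, star_one, one_mul] at h
  refine h.2 fun ξ => ?_
  have := (star y).le_of_opNorm_le (c := 1) (by rwa [norm_star]) ξ
  simpa using this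

/-- Hölder's inequality. -/
theorem holder {u y v : H →L[ℂ] H} (hu : u ∈ τ.sub4) (hy : y ∈ M) (hy1 : ‖y‖ ≤ 1)
    (hv : v ∈ τ.sub4) : u * y * v ∈ τ.sub2 ∧ τ.nrm2 (u * y * v) ≤ τ.nrm4 u * τ.nrm4 v := by
  have huM : u ∈ M := hu.1
  have hvM : v ∈ M := hv.1
  set X := star u * u with hX
  have hXM : X ∈ M := star_mul_mem huM
  have hX0 : 0 ≤ X := star_mul_self_nonneg u
  set W := star y * X * y with hW
  set V := v * star v with hV
  have hWM : W ∈ M := mul_mem (mul_mem (star_mem hy) hXM) hy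
  have hVM : V ∈ M := mul_mem hvM (star_mem hvM)
  have hW0 : 0 ≤ W := star_left_conjugate_nonneg hX0 y
  have hV0 : 0 ≤ V := mul_star_self_nonneg v
  have hyy := mul_star_le_one hy1
  have hyyM : y * star y ∈ M := mul_mem hy (star_mem hy)
  have hWle : τ.toFun (star W * W) ≤ τ.toFun (star X * X) := by
    rw [hW0.isSelfAdjoint.star_eq, hX0.isSelfAdjoint.star_eq]
    have e : W * W = star y * (X * (y * star y) * X) * star (star y) := by
      rw [hW, star_star]; simp only [mul_assoc]
    have hQ0 : 0 ≤ X * (y * star y) * X := by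
      have := star_left_conjugate_nonneg (mul_star_self_nonneg y) X
      rwa [hX0.isSelfAdjoint.star_eq] at this
    have hQM : X * (y * star y) * X ∈ M := mul_mem (mul_mem hXM hyyM) hXM
    have hQle : X * (y * star y) * X ≤ X * X := by
      have := star_left_conjugate_le_conjugate hyy X
      rwa [hX0.isSelfAdjoint.star_eq, mul_one] at this
    rw [e, τ.toFun_conj (star_mem hy) hQM hQ0, star_star]
    refine (τ.mono (sqrt_conj_mem hQM hyyM) hQM (sqrt_conj_nonneg _ (mul_star_self_nonneg y))
      ?_).trans (τ.mono hQM (mul_mem hXM hXM) hQ0 hQle)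
    have := sqrt_conj_mono (X * (y * star y) * X) hyy
    rwa [mul_one, CFC.sqrt_mul_sqrt_self _ hQ0] at this
  have hVeq : τ.toFun (star V * V) = τ.toFun ((star v * v) ^ 2) := by
    have h := τ.toFun_conj hvM (star_mul_mem hvM) (star_mul_self_nonneg v)
    rw [sqrt_mul_mul_sqrt (star_mul_self_nonneg v), ← sq] at h
    rw [← h, hV0.isSelfAdjoint.star_eq, hV]
    simp only [mul_assoc]
  have hX2 : X ∈ τ.sub2 := τ.sq_mem_sub2 huM hu.2
  have hW2 : W ∈ τ.sub2 := ⟨hWM, hWle.trans_lt hX2.2⟩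
  have hV2 : V ∈ τ.sub2 := ⟨hVM, hVeq.trans_lt hv.2⟩
  -- ‖uyv‖_2² is half the cross term of τ((W + V)²), so the triangle inequality ‖W + V‖_2 ≤ ‖W‖_2 +
  -- ‖V‖_2 bounds it by ‖W‖_2 ‖V‖_2.
  have hx : τ.toFun (star (u * y * v) * (u * y * v)) = τ.toFun (CFC.sqrt W * V * CFC.sqrt W) := by
    have h := τ.toFun_conj (star_mem hvM) hWM hW0
    rw [star_star] at h
    rw [hV, ← h, hW, hX, star_mul, star_mul]
    simp only [mul_assoc]
  have hadd := τ.toFun_sq_add hWM hVM hW0 hV0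
  have hs : ∀ {Z : H →L[ℂ] H}, 0 ≤ Z → Z * Z = star Z * Z := fun hZ => by
    rw [hZ.isSelfAdjoint.star_eq]
  rw [hs (add_nonneg hW0 hV0), hs hW0, hs hV0, ← hx] at hadd
  have hfin := (τ.sub2.add_mem hW2 hV2).2
  have hlt : τ.toFun (star (u * y * v) * (u * y * v)) < ∞ := by
    rw [hadd] at hfin
    refine lt_of_le_of_lt ?_ (ENNReal.add_lt_top.1 hfin).2
    exact le_mul_of_one_le_left' (by norm_num)
  refine ⟨⟨mul_mem (mul_mem huM hy) hvM, hlt⟩, ?_⟩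
  have hre := congrArg ENNReal.toReal hadd
  rw [ENNReal.toReal_add (ENNReal.add_ne_top.2 ⟨hW2.2.ne, hV2.2.ne⟩)
    (ENNReal.mul_ne_top (by simp) hlt.ne), ENNReal.toReal_add hW2.2.ne hV2.2.ne,
    ENNReal.toReal_mul, ← nrm2_sq, ← nrm2_sq, ← nrm2_sq, ← nrm2_sq] at hre
  have htri := τ.nrm2_add_le hW2 hV2
  have hWX : τ.nrm2 W ≤ τ.nrm4 u ^ 2 := by
    rw [nrm4_sq]
    exact Real.rpow_le_rpow ENNReal.toReal_nonneg (ENNReal.toReal_mono hX2.2.ne hWle)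
      (by norm_num)
  have hVv : τ.nrm2 V = τ.nrm4 v ^ 2 := by
    rw [nrm4_sq, nrm2, nrm2, hVeq, star_sq]
  have h0 := τ.nrm2_nonneg (W + V)
  have h1 := τ.nrm2_nonneg W
  have h2 := τ.nrm2_nonneg V
  have hsq : τ.nrm2 (u * y * v) ^ 2 ≤ τ.nrm2 W * τ.nrm2 V := by
    have h3 : τ.nrm2 (W + V) ^ 2 ≤ (τ.nrm2 W + τ.nrm2 V) ^ 2 := by gcongr
    have h4 : (2 : ℝ≥0∞).toReal = 2 := rfl
    rw [h4] at hre
    nlinarith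
  refine le_of_sq_le_sq (hsq.trans ?_) (mul_nonneg (τ.nrm4_nonneg u) (τ.nrm4_nonneg v))
  rw [mul_pow, hVv]
  gcongr

/-! ### `L_2(M)` as a Hilbert space -/

theorem parallelogram_op {x y : H →L[ℂ] H} (hx : x ∈ τ.sub2) (hy : y ∈ τ.sub2) :
    τ.nrm2 (x + y) ^ 2 + τ.nrm2 (x - y) ^ 2 = 2 * (τ.nrm2 x ^ 2 + τ.nrm2 y ^ 2) := by
  have hp := τ.sub2.add_mem hx hy
  have hm := τ.sub2.sub_mem hx hy
  have h1 := τ.map_add _ (star_mul_mem hp.1) _ (star_mul_mem hm.1) (star_mul_self_nonneg _)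
    (star_mul_self_nonneg _)
  have h2 := τ.map_comb (star_mul_mem hx.1) (star_mul_mem hy.1) (star_mul_self_nonneg _)
    (star_mul_self_nonneg _) 2 2
  have e : star (x + y) * (x + y) + star (x - y) * (x - y) =
      (((2 : ℝ≥0) : ℝ) : ℂ) • (star x * x) + (((2 : ℝ≥0) : ℝ) : ℂ) • (star y * y) := by
    have : (((2 : ℝ≥0) : ℝ) : ℂ) = 1 + 1 := by norm_num
    rw [this]
    simp only [star_add, star_sub, add_mul, mul_add, sub_mul, mul_sub, add_smul, one_smul]
    abel
  rw [e, h2] at h1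
  have h3 := congrArg ENNReal.toReal h1
  rw [ENNReal.toReal_add hp.2.ne hm.2.ne, ENNReal.toReal_add
    (ENNReal.mul_ne_top ENNReal.coe_ne_top hx.2.ne)
    (ENNReal.mul_ne_top ENNReal.coe_ne_top hy.2.ne), ENNReal.toReal_mul, ENNReal.toReal_mul,
    ← nrm2_sq, ← nrm2_sq, ← nrm2_sq, ← nrm2_sq] at h3
  rw [← h3]
  simp
  ring

theorem parallelogram (x y : τ.L2) :
    ‖x + y‖ * ‖x + y‖ + ‖x - y‖ * ‖x - y‖ = 2 * (‖x‖ * ‖x‖ + ‖y‖ * ‖y‖) := by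
  induction x, y using UniformSpace.Completion.induction_on₂ with
  | hp => exact isClosed_eq (by fun_prop) (by fun_prop)
  | ih x y =>
    rw [← UniformSpace.Completion.coe_add, ← UniformSpace.Completion.coe_sub,
      UniformSpace.Completion.norm_coe, UniformSpace.Completion.norm_coe,
      UniformSpace.Completion.norm_coe, UniformSpace.Completion.norm_coe]
    simp only [← sq]
    exact τ.parallelogram_op x.2 y.2

/-- `L_2(M)` is a Hilbert space. -/
@[reducible]
noncomputable def innerL2 : InnerProductSpace ℂ τ.L2 := 
  InnerProductSpace.ofNorm ℂ τ.parallelogram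

theorem toFun_eq_norm_sq (x : τ.PreL2) :
    τ.toFun (star x.op * x.op) = ENNReal.ofReal (‖(x : τ.L2)‖ ^ 2) := by
  rw [UniformSpace.Completion.norm_coe]
  change _ = ENNReal.ofReal (τ.nrm2 x.op ^ 2)
  rw [nrm2_sq]
  exact (ENNReal.ofReal_toReal x.2.2.ne).symm

/-- Faithfulness of τ makes ‖·‖_2 a genuine norm on M ∩ L_2(M). -/
theorem op_injective_L2 {x y : τ.PreL2} (h : (x : τ.L2) = y) : x.op = y.op := by
  have h1 : ((x - y : τ.PreL2) : τ.L2) = 0 := by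
    rw [UniformSpace.Completion.coe_sub, h, sub_self]
  have h2 := τ.toFun_eq_norm_sq (x - y)
  rw [h1, norm_zero] at h2
  have h3 := τ.faithful _ (star_mul_mem (x - y).2.1) (star_mul_self_nonneg _)
    (h2.trans (by simp))
  have h4 : (x - y).op = 0 := CStarRing.star_mul_self_eq_zero_iff _ |>.1 h3
  exact sub_eq_zero.1 h4

/-- The vectors `x̂ ∈ L_2(M)` in the weak closure of an operator norm bounded set of `M ∩ L_2(M)`
come from operators of `M`, compatibly with weak operator limits. -/
theorem exists_op_of_weak_limit {z : ℕ → τ.PreL2} {Z : H →L[ℂ] H} {C : ℝ≥0}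
    (hC : ∀ k, ‖(z k).op‖ ≤ C) {ζ : τ.L2}
    (hζ : ∀ f : StrongDual ℂ τ.L2,
      Tendsto (fun k => f (z k : τ.L2)) (hyperfilter ℕ) (𝓝 (f ζ)))
    (hZ : IsWeakLim (hyperfilter ℕ : Filter ℕ) (fun k => (z k).op) Z) (ξ : H) :
    ∃ w : τ.PreL2, (w : τ.L2) = ζ ∧ w.op ξ = Z ξ := by
  -- Mazur's argument in L_2(M) × H: the image of an operator norm ball is convex, so Hahn–Banach
  -- puts the weak limit (ζ, Z ξ) in its norm closure. Strong approximation is thus achieved for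
  -- both components at once.
  let Φ : τ.PreL2 →ₗ[ℝ] τ.L2 × H :=
    { toFun := fun x => ((x : τ.L2), x.op ξ)
      map_add' := fun x y => Prod.ext (UniformSpace.Completion.coe_add x y) rfl
      map_smul' := fun c x => Prod.ext (UniformSpace.Completion.coe_smul c x) rfl }
  let B : Set τ.PreL2 := {x | ‖x.op‖ ≤ C}
  have hB : Convex ℝ B := by
    intro x hx y hy s t hs ht hst
    change ‖s • x.op + t • y.op‖ ≤ C
    refine (norm_add_le _ _).trans ?_
    rw [norm_smul, norm_smul, Real.norm_of_nonneg hs, Real.norm_of_nonneg ht]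
    have hx' : ‖x.op‖ ≤ C := hx
    have hy' : ‖y.op‖ ≤ C := hy
    calc s * ‖x.op‖ + t * ‖y.op‖ ≤ s * C + t * C := by gcongr
      _ = C := by rw [← add_mul, hst, one_mul]
  have hK : Convex ℝ (Φ '' B) := hB.linear_image Φ
  have hmem : (ζ, Z ξ) ∈ closure (Φ '' B) := by
    by_contra hn
    obtain ⟨f, u, hu, hu'⟩ := RCLike.geometric_hahn_banach_closed_point (𝕜 := ℂ) hK.closure
      isClosed_closure hn
    have h1 := hζ (f.comp (ContinuousLinearMap.inl ℂ τ.L2 H))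
    have h2 := hZ ξ ((InnerProductSpace.toDual ℂ H).symm (f.comp (ContinuousLinearMap.inr ℂ τ.L2 H)))
    simp only [InnerProductSpace.toDual_symm_apply] at h2
    have h3 := (Complex.continuous_re.tendsto _).comp (h1.add h2)
    have e : ∀ (a : τ.L2) (b : H), f.comp (ContinuousLinearMap.inl ℂ τ.L2 H) a +
        f.comp (ContinuousLinearMap.inr ℂ τ.L2 H) b = f (a, b) := fun a b => by
      rw [ContinuousLinearMap.comp_apply, ContinuousLinearMap.comp_apply,
        ← _root_.map_add]
      simp
    simp only [Function.comp_def, e] at h3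
    have h4 : (f (ζ, Z ξ)).re ≤ u := le_of_tendsto h3 (.of_forall fun k =>
      (hu _ (subset_closure ⟨z k, hC k, rfl⟩)).le)
    exact absurd hu' (not_lt.2 h4)
  -- At this rate consecutive terms are within 4⁻ⁱ, and 16⁻ⁱ ≤ 8⁻ⁱ is the rapid Cauchy condition of
  -- `toFun_sub_weakLim_le`.
  have happ : ∀ i : ℕ, ∃ x : τ.PreL2, ‖x.op‖ ≤ C ∧ dist (x : τ.L2) ζ < 2⁻¹ * 4⁻¹ ^ i ∧
      dist (x.op ξ) (Z ξ) < 2⁻¹ * 4⁻¹ ^ i := by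
    intro i
    obtain ⟨_, ⟨x, hx, rfl⟩, hd⟩ := Metric.mem_closure_iff.1 hmem (2⁻¹ * 4⁻¹ ^ i) (by positivity)
    rw [dist_comm, Prod.dist_eq, max_lt_iff] at hd
    exact ⟨x, hx, hd.1, hd.2⟩
  choose x hxC hxζ hxZ using happ
  obtain ⟨w, -, hw⟩ := exists_isWeakLim (hyperfilter ℕ) hxC
  have hle : (hyperfilter ℕ : Filter ℕ) ≤ atTop := Nat.hyperfilter_le_atTop
  have hr : Tendsto (fun i : ℕ => (2⁻¹ * 4⁻¹ ^ i : ℝ)) atTop (𝓝 0) := by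
    simpa using (tendsto_pow_atTop_nhds_zero_of_lt_one (r := (4⁻¹ : ℝ)) (by norm_num)
      (by norm_num)).const_mul 2⁻¹
  have hlimζ : Tendsto (fun i => (x i : τ.L2)) atTop (𝓝 ζ) :=
    tendsto_iff_dist_tendsto_zero.2 (squeeze_zero (fun _ => dist_nonneg) (fun i => (hxζ i).le) hr)
  have hlimZ : Tendsto (fun i => (x i).op ξ) atTop (𝓝 (Z ξ)) :=
    tendsto_iff_dist_tendsto_zero.2 (squeeze_zero (fun _ => dist_nonneg) (fun i => (hxZ i).le) hr)
  have hD : ∀ i, τ.toFun (star ((x i).op - (x (i + 1)).op) * ((x i).op - (x (i + 1)).op))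
      ≤ (8⁻¹ : ℝ≥0∞) ^ i := by
    intro i
    refine (τ.toFun_eq_norm_sq (x i - x (i + 1))).trans_le ?_
    have h1 : ‖((x i - x (i + 1) : τ.PreL2) : τ.L2)‖ ≤ 4⁻¹ ^ i := by
      rw [UniformSpace.Completion.coe_sub, ← dist_eq_norm]
      have h2 := dist_triangle_right (x i : τ.L2) (x (i + 1)) ζ
      have h3 := hxζ i
      have h4 := hxζ (i + 1)
      have h5 : (0 : ℝ) < 4⁻¹ ^ i := by positivity
      rw [pow_succ] at h4
      linarith
    have h6 : (8⁻¹ : ℝ≥0∞) = ENNReal.ofReal 8⁻¹ := by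
      rw [ENNReal.ofReal_inv_of_pos (by norm_num)]; norm_num
    rw [h6, ← ENNReal.ofReal_pow (by norm_num)]
    refine ENNReal.ofReal_le_ofReal ?_
    calc ‖((x i - x (i + 1) : τ.PreL2) : τ.L2)‖ ^ 2 ≤ (4⁻¹ ^ i) ^ 2 := by gcongr
      _ = (16⁻¹ : ℝ) ^ i := by rw [← pow_mul, mul_comm, pow_mul]; norm_num
      _ ≤ 8⁻¹ ^ i := by gcongr; norm_num
  have hconv := τ.toFun_sub_weakLim_le hle (fun i => (x i).2.1) hxC hD hw
  have hwM : w ∈ M := hw.mem fun i => (x i).2.1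
  have hdiff : ∀ N, (x N).op - w ∈ τ.sub2 := fun N => by
    refine ⟨sub_mem (x N).2.1 hwM, (hconv N).trans_lt ?_⟩
    refine ENNReal.mul_lt_top ENNReal.coe_lt_top (ENNReal.mul_lt_top (by simp) ?_)
    exact ENNReal.pow_lt_top (by simp)
  have hw2 : w ∈ τ.sub2 := by
    have := τ.sub2.sub_mem (x 0).2 (hdiff 0)
    have e : (x 0).op - ((x 0).op - w) = w := sub_sub_cancel _ _
    exact e ▸ this
  let W : τ.PreL2 := ⟨w, hw2⟩
  refine ⟨W, ?_, ?_⟩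
  · refine tendsto_nhds_unique (f := fun i => (x i : τ.L2)) (l := atTop) ?_ hlimζ
    rw [tendsto_iff_norm_sub_tendsto_zero]
    have h1 : Tendsto (fun N : ℕ => ((1 + (2 * C) ^ 2 : ℝ≥0) : ℝ≥0∞) * (4 * (8⁻¹ : ℝ≥0∞) ^ N)) atTop
        (𝓝 0) := by
      have h := ENNReal.tendsto_pow_atTop_nhds_zero_of_lt_one (r := (8⁻¹ : ℝ≥0∞))
        (ENNReal.inv_lt_one.2 (by norm_num))
      have h' := ENNReal.Tendsto.const_mul (a := (4 : ℝ≥0∞)) h (Or.inr (by simp))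
      rw [mul_zero] at h'
      have h'' := ENNReal.Tendsto.const_mul (a := ((1 + (2 * C) ^ 2 : ℝ≥0) : ℝ≥0∞)) h'
        (Or.inr ENNReal.coe_ne_top)
      rwa [mul_zero] at h''
    have h2 : Tendsto (fun N => ENNReal.ofReal (‖(x N : τ.L2) - W‖ ^ 2)) atTop (𝓝 0) := by
      refine tendsto_of_tendsto_of_tendsto_of_le_of_le tendsto_const_nhds h1 (fun _ => zero_le)
        fun N => ?_
      have := τ.toFun_eq_norm_sq (x N - W)
      rw [UniformSpace.Completion.coe_sub] at this
      exact this.symm.trans_le (hconv N)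
    have h3 := (ENNReal.tendsto_toReal ENNReal.zero_ne_top).comp h2
    have h4 := (Real.continuous_sqrt.tendsto _).comp h3
    simp only [Function.comp_def, ENNReal.toReal_zero, Real.sqrt_zero] at h4
    refine h4.congr fun N => ?_
    rw [ENNReal.toReal_ofReal (by positivity), Real.sqrt_sq (norm_nonneg _)]
  · refine ext_inner_left ℂ fun η => tendsto_nhds_unique (hw ξ η) ?_
    exact ((tendsto_const_nhds.inner hlimZ).mono_left hle)

/-- Lower semicontinuity of `‖·‖_2` under bounded weak operator limits. -/
theorem toFun_weakLim_le {z : ℕ → H →L[ℂ] H} {Z : H →L[ℂ] H} {C : ℝ≥0} (hz : ∀ k, z k ∈ M)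
    (hC : ∀ k, ‖z k‖ ≤ C) {ε : ℝ} (hε0 : 0 ≤ ε)
    (hε : ∀ k, τ.toFun (star (z k) * z k) ≤ ENNReal.ofReal (ε ^ 2))
    (hZ : IsWeakLim (hyperfilter ℕ : Filter ℕ) z Z) :
    τ.toFun (star Z * Z) ≤ ENNReal.ofReal (ε ^ 2) := by
  let zz : ℕ → τ.PreL2 := fun k => ⟨z k, hz k, (hε k).trans_lt ENNReal.ofReal_lt_top⟩
  have hn : ∀ k, ‖(zz k : τ.L2)‖ ≤ ε := fun k => by
    have h := (τ.toFun_eq_norm_sq (zz k)).symm.trans_le (hε k)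
    exact le_of_sq_le_sq ((ENNReal.ofReal_le_ofReal_iff (by positivity)).1 h) hε0
  obtain ⟨ζ, hζ, hlim⟩ : ∃ ζ : τ.L2, ‖ζ‖ ≤ ε ∧ ∀ f : StrongDual ℂ τ.L2,
      Tendsto (fun k => f (zz k : τ.L2)) (hyperfilter ℕ) (𝓝 (f ζ)) :=
    let _ := τ.innerL2
    exists_weak_limit (hyperfilter ℕ) hn
  -- The operator obtained depends a priori on ξ, but all of them represent ζ, so injectivity
  -- identifies them with a single w, which is then Z.
  have h := fun ξ => τ.exists_op_of_weak_limit (z := zz) hC hlim hZ ξ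
  obtain ⟨w, hw, -⟩ := h 0
  have hZw : Z = w.op := by
    ext ξ
    obtain ⟨w', hw', e⟩ := h ξ
    rw [← e, τ.op_injective_L2 (hw'.trans hw.symm)]
  rw [hZw, toFun_eq_norm_sq, hw]
  exact ENNReal.ofReal_le_ofReal (by gcongr)

end NSFTrace

/-! ### Common factorization of finitely many vectors of `L_2(M)` -/

namespace NSFTrace

variable {H : Type*} [NormedAddCommGroup H] [InnerProductSpace ℂ H] [CompleteSpace H]
variable {M : VonNeumannAlgebra H} (τ : NSFTrace M)

theorem nrm2_sum_le {F : Finset ℕ} {S : ℕ → H →L[ℂ] H} (hS : ∀ j, S j ∈ τ.sub2) :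
    τ.nrm2 (∑ j ∈ F, S j) ≤ ∑ j ∈ F, τ.nrm2 (S j) := by
  induction F using Finset.induction_on with
  | empty =>
    simp only [Finset.sum_empty]
    rw [nrm2]
    simp [τ.map_zero']
  | insert i F hi ih =>
    rw [Finset.sum_insert hi, Finset.sum_insert hi]
    exact (τ.nrm2_add_le (hS i) (τ.sub2.sum_mem fun j _ => hS j)).trans (by gcongr)

theorem sqrt_mem_sub4 {A : H →L[ℂ] H} (hA : A ∈ τ.sub2) (h0 : 0 ≤ A) :
    CFC.sqrt A ∈ τ.sub4 ∧ τ.nrm4 (CFC.sqrt A) ^ 2 = τ.nrm2 A := by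
  have e : star (CFC.sqrt A) * CFC.sqrt A = A := by
    rw [star_sqrt, CFC.sqrt_mul_sqrt_self A h0]
  refine ⟨⟨sqrt_mem hA.1, ?_⟩, ?_⟩
  · rw [e, sq]
    have := hA.2
    rwa [h0.isSelfAdjoint.star_eq] at this
  · rw [nrm4_sq, e]

theorem nrm4_pow_four {x : H →L[ℂ] H} : τ.nrm4 x ^ 4 = (τ.toFun ((star x * x) ^ 2)).toReal := by
  rw [show (4 : ℕ) = 2 * 2 from rfl, pow_mul, nrm4_sq, nrm2_sq, star_sq]

/-- Superadditivity of τ(A⁴) applied to A and B - A: along increasing sequences, L_4 distances are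
controlled by increments of the fourth powers of the norms. -/
theorem nrm4_superadd {A B : H →L[ℂ] H} (hA : A ∈ τ.sub4) (hB : B ∈ τ.sub4) (hA0 : 0 ≤ A)
    (h : A ≤ B) : τ.nrm4 (B - A) ^ 4 ≤ τ.nrm4 B ^ 4 - τ.nrm4 A ^ 4 := by
  have hD := τ.sub4.sub_mem hB hA
  have hD0 : 0 ≤ B - A := sub_nonneg.2 h
  have h1 := τ.toFun_four_superadd hA.1 hD.1 hA0 hD0
  rw [add_sub_cancel] at h1
  have e : ∀ {C : H →L[ℂ] H}, 0 ≤ C → (C * C) * (C * C) = (star C * C) ^ 2 := fun hC => by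
    rw [hC.isSelfAdjoint.star_eq, sq]
  rw [e hA0, e hD0, e (hA0.trans h)] at h1
  have h2 := ENNReal.toReal_mono hB.2.ne h1
  rw [ENNReal.toReal_add hA.2.ne hD.2.ne, ← nrm4_pow_four, ← nrm4_pow_four, ← nrm4_pow_four] at h2
  linarith

/-- The square roots of the partial sums of a series of positive elements that converges
absolutely in `L_2(M)` converge in `L_4(M)`. -/
theorem exists_sqrt_limit {S : ℕ → H →L[ℂ] H} (hS : ∀ j, S j ∈ τ.sub2) (h0 : ∀ j, 0 ≤ S j) {s : ℝ}
    (hs : ∀ n, ∑ j ∈ Finset.range n, τ.nrm2 (S j) ≤ s) :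
    ∃ u : ℕ → τ.PreL4, ∃ a : τ.L4,
      (∀ k, (u k).op = CFC.sqrt (∑ j ∈ Finset.range (k + 1), S j)) ∧ (∀ k, ‖u k‖ ^ 2 ≤ s) ∧
      Tendsto (fun k => (u k : τ.L4)) atTop (𝓝 a) ∧ ‖a‖ ^ 2 ≤ s := by
  let A : ℕ → H →L[ℂ] H := fun k => ∑ j ∈ Finset.range (k + 1), S j
  have hA : ∀ k, A k ∈ τ.sub2 := fun k => τ.sub2.sum_mem fun j _ => hS j
  have hA0 : ∀ k, 0 ≤ A k := fun k => Finset.sum_nonneg fun j _ => h0 j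
  have hAm : Monotone A := fun k l hkl => Finset.sum_le_sum_of_subset_of_nonneg
    (Finset.range_mono (by lia)) fun i _ _ => h0 i
  let u : ℕ → τ.PreL4 := fun k => ⟨CFC.sqrt (A k), (τ.sqrt_mem_sub4 (hA k) (hA0 k)).1⟩
  have hun : ∀ k, ‖u k‖ ^ 2 ≤ s := fun k => by
    change τ.nrm4 (CFC.sqrt (A k)) ^ 2 ≤ s
    rw [(τ.sqrt_mem_sub4 (hA k) (hA0 k)).2]
    exact (τ.nrm2_sum_le hS).trans (hs _)
  -- The square root is operator monotone, so the u_k increase; their bounded increasing fourth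
  -- powers then force the Cauchy property.
  have hu : ∀ k l, k ≤ l → ‖u l - u k‖ ^ 4 ≤ ‖u l‖ ^ 4 - ‖u k‖ ^ 4 := fun k l hkl =>
    τ.nrm4_superadd (u k).2 (u l).2 (CFC.sqrt_nonneg _) (CFC.sqrt_le_sqrt _ _ (hAm hkl))
  have hmono : Monotone fun k => ‖u k‖ ^ 4 := fun k l hkl => by
    have := hu k l hkl
    have h1 : 0 ≤ ‖u l - u k‖ ^ 4 := by positivity
    change ‖u k‖ ^ 4 ≤ ‖u l‖ ^ 4
    linarith
  have hbdd : BddAbove (Set.range fun k => ‖u k‖ ^ 4) := by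
    refine ⟨s ^ 2, ?_⟩
    rintro _ ⟨k, rfl⟩
    change ‖u k‖ ^ (2 * 2) ≤ _
    rw [pow_mul]
    have := hun k
    gcongr
  have hc := (tendsto_atTop_ciSup hmono hbdd).cauchySeq
  have huc : CauchySeq fun k => (u k : τ.L4) := by
    rw [Metric.cauchySeq_iff'] at hc ⊢
    intro ε hε
    obtain ⟨N, hN⟩ := hc (ε ^ 4) (by positivity)
    refine ⟨N, fun n hn => ?_⟩
    have h1 := hN n hn
    rw [Real.dist_eq] at h1
    have h2 := (hu N n hn).trans ((le_abs_self _).trans h1.le)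
    have h3 := (hu N n hn).trans_lt ((le_abs_self _).trans_lt h1)
    rw [dist_eq_norm, ← UniformSpace.Completion.coe_sub, UniformSpace.Completion.norm_coe]
    exact lt_of_pow_lt_pow_left₀ 4 hε.le h3
  obtain ⟨a, ha⟩ := cauchySeq_tendsto_of_complete huc
  refine ⟨u, a, fun k => rfl, hun, ha, le_of_tendsto (ha.norm.pow 2) (.of_forall fun k => ?_)⟩
  rw [UniformSpace.Completion.norm_coe]
  exact hun k

theorem PreL2.op_sum {F : Finset ℕ} (g : ℕ → τ.PreL2) :
    (∑ j ∈ F, g j : τ.PreL2).op = ∑ j ∈ F, (g j).op :=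
  map_sum τ.sub2.subtype g F

theorem PreL2.coe_sum {F : Finset ℕ} (g : ℕ → τ.PreL2) :
    ((∑ j ∈ F, g j : τ.PreL2) : τ.L2) = ∑ j ∈ F, (g j : τ.L2) :=
  map_sum (UniformSpace.Completion.toCompl : τ.PreL2 →+ τ.L2) g F

/-- The square function of a finite family. -/
theorem square_function {ι : Type*} [Fintype ι] {X : ι → H →L[ℂ] H} (hX : ∀ i, X i ∈ M) {c : ℝ}
    (hc : ∑ i, τ.toFun (star (X i) * X i) = ENNReal.ofReal c) :
    CFC.sqrt (∑ i, star (X i) * X i) ∈ τ.sub2 ∧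
      τ.nrm2 (CFC.sqrt (∑ i, star (X i) * X i)) ^ 2 = (ENNReal.ofReal c).toReal ∧
      ∀ i, star (X i) * X i ≤
        CFC.sqrt (∑ i, star (X i) * X i) * CFC.sqrt (∑ i, star (X i) * X i) := by
  have h0 : 0 ≤ ∑ i, star (X i) * X i := Finset.sum_nonneg fun i _ => star_mul_self_nonneg _
  have hM : ∑ i, star (X i) * X i ∈ M := sum_mem fun i _ => star_mul_mem (hX i)
  have e : τ.toFun (star (CFC.sqrt (∑ i, star (X i) * X i)) * CFC.sqrt (∑ i, star (X i) * X i)) =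
      ENNReal.ofReal c := by
    rw [star_sqrt, CFC.sqrt_mul_sqrt_self _ h0, τ.map_sum' _ (fun i => star_mul_mem (hX i))
      (fun i => star_mul_self_nonneg _), hc]
  refine ⟨⟨sqrt_mem hM, e.trans_lt ENNReal.ofReal_lt_top⟩, by rw [nrm2_sq, e], fun i => ?_⟩
  rw [CFC.sqrt_mul_sqrt_self _ h0]
  exact Finset.single_le_sum (f := fun i => star (X i) * X i)
    (fun j _ => star_mul_self_nonneg (X j)) (Finset.mem_univ i)

/-- Approximation of finitely many vectors of `L_2(M)` by series in `M ∩ L_2(M)` with almost no loss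
in the `ℓ_2` sum of the norms. -/
theorem exists_series {ι : Type*} [Fintype ι] (x : ι → τ.L2) {ε : ℝ} (hε : 0 < ε) :
    ∃ g : ι → ℕ → τ.PreL2,
      (∀ i, Tendsto (fun n => ((∑ j ∈ Finset.range (n + 1), g i j : τ.PreL2) : τ.L2)) atTop
        (𝓝 (x i))) ∧
      ∀ n, ∑ j ∈ Finset.range n, √(∑ i, ‖g i j‖ ^ 2) ≤ √(∑ i, ‖x i‖ ^ 2) + ε := by
  let N : (ι → τ.L2) → ℝ := fun v => ‖(WithLp.toLp 2 v : PiLp 2 fun _ : ι => τ.L2)‖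
  have hN : ∀ v, N v = √(∑ i, ‖v i‖ ^ 2) := fun v => PiLp.norm_eq_of_L2 _
  have hN1 : ∀ v, N v ≤ ∑ i, ‖v i‖ := fun v => by
    rw [hN]
    refine Real.sqrt_le_iff.2 ⟨by positivity, ?_⟩
    exact Finset.sum_sq_le_sq_sum_of_nonneg fun i _ => norm_nonneg _
  -- An ι-family with entries at most b_j has ℓ_2 norm at most c b_j; the summand 1 keeps c nonzero
  -- when ι is empty.
  let c : ℝ := Fintype.card ι + 1
  have hc : 0 < c := by positivity
  let b : ℕ → ℝ := fun n => ε / c * (2⁻¹ * 2⁻¹ ^ n)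
  have hb : ∀ n, 0 < b n := fun n => by positivity
  have h : ∀ i, ∃ g : ℕ → τ.PreL2,
      Tendsto (fun n => ∑ j ∈ Finset.range (n + 1), (g j : τ.L2)) atTop (𝓝 (x i)) ∧
      ‖(g 0 : τ.L2) - x i‖ < b 0 ∧ ∀ n, 0 < n → ‖(g n : τ.L2)‖ < b n := fun i => by
    obtain ⟨g, h1, h2, h3⟩ := controlled_sum_of_mem_closure_range
      (j := (UniformSpace.Completion.toCompl : τ.PreL2 →+ τ.L2))
      (UniformSpace.Completion.denseRange_coe (x i)) hb
    refine ⟨g, h1, ?_, h3⟩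
    rw [norm_sub_rev, sub_eq_neg_add]
    exact h2
  choose g hg hg0 hgn using h
  refine ⟨g, fun i => ?_, fun n => ?_⟩
  · simpa only [PreL2.coe_sum] using hg i
  · have hterm : ∀ j, √(∑ i, ‖g i j‖ ^ 2) ≤ (if j = 0 then √(∑ i, ‖x i‖ ^ 2) else 0) + c * b j := by
      intro j
      have e : √(∑ i, ‖g i j‖ ^ 2) = N fun i => (g i j : τ.L2) := by
        rw [hN]; simp only [UniformSpace.Completion.norm_coe]
      have hcb : ∀ v : ι → τ.L2, (∀ i, ‖v i‖ ≤ b j) → N v ≤ c * b j := fun v hv => by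
        refine (hN1 v).trans ((Finset.sum_le_sum fun i _ => hv i).trans ?_)
        rw [Finset.sum_const, Finset.card_univ, nsmul_eq_mul]
        have := (hb j).le
        gcongr
        simp [c]
      rw [e]
      rcases Nat.eq_zero_or_pos j with rfl | hj
      · rw [if_pos rfl, ← hN]
        have h1 : N (fun i => (g i 0 : τ.L2)) ≤ N x + N fun i => (g i 0 : τ.L2) - x i := by
          have e2 : (WithLp.toLp 2 (fun i => (g i 0 : τ.L2)) : PiLp 2 fun _ : ι => τ.L2) =
              WithLp.toLp 2 x + WithLp.toLp 2 fun i => (g i 0 : τ.L2) - x i := by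
            ext i; simp
          change ‖(WithLp.toLp 2 (fun i => (g i 0 : τ.L2)) : PiLp 2 fun _ : ι => τ.L2)‖ ≤ _
          rw [e2]
          exact norm_add_le _ _
        exact h1.trans (by gcongr; exact hcb _ fun i => (hg0 i).le)
      · rw [if_neg hj.ne', zero_add]
        exact hcb _ fun i => (hgn i j hj).le
    refine (Finset.sum_le_sum fun j _ => hterm j).trans ?_
    rw [Finset.sum_add_distrib]
    refine add_le_add ?_ ?_
    · rw [Finset.sum_ite_eq']
      split_ifs
      · exact le_rfl
      · positivity
    · have h2 : ∀ j, c * b j = ε * 2⁻¹ * 2⁻¹ ^ j := fun j => by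
        simp only [b]; field_simp
      simp only [h2]
      rw [← Finset.mul_sum]
      have h3 : ∑ j ∈ Finset.range n, (2⁻¹ : ℝ) ^ j ≤ 2 := by
        have h4 := Summable.sum_le_tsum (f := fun j : ℕ => (2⁻¹ : ℝ) ^ j) (Finset.range n)
          (fun j _ => by positivity) (summable_geometric_of_lt_one (by norm_num) (by norm_num))
        rw [tsum_geometric_of_lt_one (by norm_num) (by norm_num)] at h4
        norm_num at h4 ⊢
        exact h4
      calc ε * 2⁻¹ * ∑ j ∈ Finset.range n, (2⁻¹ : ℝ) ^ j ≤ ε * 2⁻¹ * 2 := by gcongr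
        _ = ε := by ring

theorem _root_.IsWeakLim.congr' {U : Filter ℕ} {y z : ℕ → H →L[ℂ] H} {Y : H →L[ℂ] H}
    (h : IsWeakLim U y Y) (he : ∀ᶠ k in U, y k = z k) : IsWeakLim U z Y := fun ξ η =>
  (h ξ η).congr' (he.mono fun k hk => by rw [hk])

/-- If `u k → a`, `v k → b` in `L_4(M)`, `u k * y k * v k → x` in `L_2(M)` and `y k → Y` weakly, with
contractions `y k`, then `a Y b = x`. -/
theorem isProd_of_isWeakLim {u v : ℕ → τ.PreL4} {X : ℕ → τ.PreL2} {a b : τ.L4} {x : τ.L2}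
    (hu : Tendsto (fun k => (u k : τ.L4)) atTop (𝓝 a))
    (hv : Tendsto (fun k => (v k : τ.L4)) atTop (𝓝 b))
    (hX : Tendsto (fun k => (X k : τ.L2)) atTop (𝓝 x))
    {y : ℕ → H →L[ℂ] H} (hy : ∀ k, y k ∈ M) (hy1 : ∀ k, ‖y k‖ ≤ 1)
    (hprod : ∀ k, (X k).op = (u k).op * y k * (v k).op) {Y : H →L[ℂ] H} (hY1 : ‖Y‖ ≤ 1)
    (hY : IsWeakLim (hyperfilter ℕ : Filter ℕ) y Y) : τ.IsProd a Y b x := by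
  have hle : (hyperfilter ℕ : Filter ℕ) ≤ atTop := Nat.hyperfilter_le_atTop
  have hYM : Y ∈ M := hY.mem hy
  let w : ℕ → τ.PreL2 := fun k =>
    ⟨(u k).op * Y * (v k).op, (τ.holder (u k).2 hYM hY1 (v k).2).1⟩
  refine ⟨u, v, w, fun _ => rfl, hu, hv, ?_⟩
  obtain ⟨Cu, hCu⟩ := (Metric.isBounded_range_of_tendsto _ hu).exists_norm_le
  obtain ⟨Cv, hCv⟩ := (Metric.isBounded_range_of_tendsto _ hv).exists_norm_le
  have hCu' : ∀ k, τ.nrm4 (u k).op ≤ Cu := fun k => by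
    have := hCu _ ⟨k, rfl⟩
    rwa [UniformSpace.Completion.norm_coe] at this
  have hCv' : ∀ k, τ.nrm4 (v k).op ≤ Cv := fun k => by
    have := hCv _ ⟨k, rfl⟩
    rwa [UniformSpace.Completion.norm_coe] at this
  have hCu0 : 0 ≤ Cu := (τ.nrm4_nonneg _).trans (hCu' 0)
  have hCv0 : 0 ≤ Cv := (τ.nrm4_nonneg _).trans (hCv' 0)
  -- Exchanging u_l, v_l for u_k, v_k turns the product with y_k into X_k; Hölder makes the error
  -- small uniformly in k ≥ l.
  have hbound : ∀ l k, τ.nrm2 ((u l).op * y k * (v l).op - (X l).op) ≤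
      ‖(u l : τ.L4) - u k‖ * Cv + Cu * ‖(v l : τ.L4) - v k‖ + ‖(X k : τ.L2) - X l‖ := by
    intro l k
    have e : (u l).op * y k * (v l).op - (X l).op = (u l - u k : τ.PreL4).op * y k * (v l).op
        + (u k).op * y k * (v l - v k : τ.PreL4).op + (X k - X l : τ.PreL2).op := by
      change _ = ((u l).op - (u k).op) * y k * (v l).op + (u k).op * y k * ((v l).op - (v k).op)
        + ((X k).op - (X l).op)
      rw [hprod k, sub_mul, sub_mul, mul_sub]
      abel
    have h1 := τ.holder (u l - u k : τ.PreL4).2 (hy k) (hy1 k) (v l).2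
    have h2 := τ.holder (u k).2 (hy k) (hy1 k) (v l - v k : τ.PreL4).2
    rw [e]
    refine (τ.nrm2_add_le (τ.sub2.add_mem h1.1 h2.1) (X k - X l : τ.PreL2).2).trans ?_
    refine add_le_add ((τ.nrm2_add_le h1.1 h2.1).trans (add_le_add (h1.2.trans ?_)
      (h2.2.trans ?_))) ?_
    · rw [← UniformSpace.Completion.coe_sub, UniformSpace.Completion.norm_coe]
      exact mul_le_mul_of_nonneg_left (hCv' l) (τ.nrm4_nonneg _)
    · rw [← UniformSpace.Completion.coe_sub, UniformSpace.Completion.norm_coe]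
      exact mul_le_mul_of_nonneg_right (hCu' k) (τ.nrm4_nonneg _)
    · rw [← UniformSpace.Completion.coe_sub, UniformSpace.Completion.norm_coe]
      exact le_rfl
  have hlim : Tendsto (fun l => (w l : τ.L2) - X l) atTop (𝓝 0) := by
    rw [Metric.tendsto_atTop]
    intro e he
    set d : ℝ := e / 2 / (Cv + Cu + 1) with hd
    have hd0 : 0 < d := by positivity
    obtain ⟨N1, hN1⟩ := Metric.cauchySeq_iff.1 hu.cauchySeq d hd0
    obtain ⟨N2, hN2⟩ := Metric.cauchySeq_iff.1 hv.cauchySeq d hd0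
    obtain ⟨N3, hN3⟩ := Metric.cauchySeq_iff.1 hX.cauchySeq d hd0
    refine ⟨max N1 (max N2 N3), fun l hl => ?_⟩
    have hl1 : N1 ≤ l := (le_max_left _ _).trans hl
    have hl2 : N2 ≤ l := (le_max_left _ _).trans ((le_max_right _ _).trans hl)
    have hl3 : N3 ≤ l := (le_max_right _ _).trans ((le_max_right _ _).trans hl)
    have hb : ∀ k, l ≤ k → τ.nrm2 ((u l).op * y k * (v l).op - (X l).op) ≤ e / 2 := by
      intro k hk
      refine (hbound l k).trans ?_
      have h1 := (hN1 l hl1 k (hl1.trans hk)).le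
      have h2 := (hN2 l hl2 k (hl2.trans hk)).le
      have h3 := (hN3 k (hl3.trans hk) l hl3).le
      rw [dist_eq_norm] at h1 h2 h3
      calc _ ≤ d * Cv + Cu * d + d := by gcongr
        _ = d * (Cv + Cu + 1) := by ring
        _ = e / 2 := by rw [hd]; field_simp
    -- With l fixed and k tending to infinity, lower semicontinuity carries the estimate from y_k to
    -- Y. The index max l k below makes the bound hold for every k.
    have hz := (hY.mul_mul (u l).op (v l).op).sub_const (X l).op
    have hz' := hz.congr' (z := fun k => (u l).op * y (max l k) * (v l).op - (X l).op)
      (hle ((eventually_ge_atTop l).mono fun k hk => by rw [max_eq_right hk]))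
    have hzM : ∀ k, (u l).op * y (max l k) * (v l).op - (X l).op ∈ τ.sub2 := fun k =>
      τ.sub2.sub_mem (τ.holder (u l).2 (hy _) (hy1 _) (v l).2).1 (X l).2
    have hfin := τ.toFun_weakLim_le (C := ‖(u l).op‖₊ * ‖(v l).op‖₊ + ‖(X l).op‖₊)
      (fun k => (hzM k).1) (fun k => by
        refine (norm_sub_le _ _).trans ?_
        push_cast
        gcongr
        refine (norm_mul_le _ _).trans ?_
        gcongr
        refine (norm_mul_le _ _).trans ?_
        exact mul_le_of_le_one_right (norm_nonneg _) (hy1 _)) (by positivity : 0 ≤ e / 2)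
      (fun k => by
        rw [← ENNReal.ofReal_toReal (hzM k).2.ne, ← nrm2_sq]
        have := hb _ (le_max_left l k)
        have h0 := τ.nrm2_nonneg ((u l).op * y (max l k) * (v l).op - (X l).op)
        gcongr) hz'
    rw [dist_zero_right, ← UniformSpace.Completion.coe_sub]
    have h5 := (τ.toFun_eq_norm_sq (w l - X l)).symm.trans_le hfin
    have h6 := le_of_sq_le_sq ((ENNReal.ofReal_le_ofReal_iff (by positivity)).1 h5) (by positivity)
    linarith
  simpa using hlim.add hX

/-- Common factorization of finitely many vectors of `L_2(M)`. -/
theorem exists_common_factorization_sqrt {ι : Type*} [Fintype ι] (x : ι → τ.L2) {ε : ℝ}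
    (hε : 0 < ε) :
    ∃ (a b : τ.L4) (y : ι → H →L[ℂ] H),
      (∀ i, y i ∈ M ∧ ‖y i‖ ≤ 1 ∧ τ.IsProd a (y i) b (x i)) ∧
      ‖a‖ ^ 2 ≤ √(∑ i, ‖x i‖ ^ 2) + ε ∧ ‖b‖ ^ 2 ≤ √(∑ i, ‖x i‖ ^ 2) + ε := by
  obtain ⟨g, hg, hgs⟩ := τ.exists_series x hε
  have hsumT : ∀ j, ∑ i, τ.toFun (star (g i j).op * (g i j).op)
      = ENNReal.ofReal (∑ i, ‖g i j‖ ^ 2) := fun j => by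
    rw [ENNReal.ofReal_sum_of_nonneg fun i _ => by positivity]
    refine Finset.sum_congr rfl fun i _ => ?_
    rw [toFun_eq_norm_sq, UniformSpace.Completion.norm_coe]
  have hsumS : ∀ j, ∑ i, τ.toFun (star (star (g i j).op) * star (g i j).op)
      = ENNReal.ofReal (∑ i, ‖g i j‖ ^ 2) := fun j => by
    rw [← hsumT]
    refine Finset.sum_congr rfl fun i _ => ?_
    rw [star_star]
    exact (τ.tracial _ (g i j).2.1).symm
  -- Column and row square functions of the j-th terms. Both have 2-norm √(Σ_i ‖g_ij‖²), because τ
  -- is tracial.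
  let T : ℕ → H →L[ℂ] H := fun j => CFC.sqrt (∑ i, star (g i j).op * (g i j).op)
  let S : ℕ → H →L[ℂ] H :=
    fun j => CFC.sqrt (∑ i, star (star (g i j).op) * star (g i j).op)
  have hT : ∀ j, T j ∈ τ.sub2 ∧ τ.nrm2 (T j) ^ 2 = (ENNReal.ofReal (∑ i, ‖g i j‖ ^ 2)).toReal ∧
      ∀ i, star (g i j).op * (g i j).op ≤ T j * T j := fun j =>
    τ.square_function (X := fun i => (g i j).op) (fun i => (g i j).2.1) (hsumT j)
  have hS : ∀ j, S j ∈ τ.sub2 ∧ τ.nrm2 (S j) ^ 2 = (ENNReal.ofReal (∑ i, ‖g i j‖ ^ 2)).toReal ∧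
      ∀ i, star (star (g i j).op) * star (g i j).op ≤ S j * S j := fun j =>
    τ.square_function (X := fun i => star (g i j).op) (fun i => star_mem (g i j).2.1) (hsumS j)
  have hT0 : ∀ j, 0 ≤ T j := fun j => CFC.sqrt_nonneg _
  have hS0 : ∀ j, 0 ≤ S j := fun j => CFC.sqrt_nonneg _
  have hnrm : ∀ {Z : H →L[ℂ] H} {c : ℝ}, 0 ≤ c → τ.nrm2 Z ^ 2 = (ENNReal.ofReal c).toReal →
      τ.nrm2 Z = √c := fun hc h => by
    rw [ENNReal.toReal_ofReal hc] at h
    rw [← h, Real.sqrt_sq (τ.nrm2_nonneg _)]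
  have hTn : ∀ j, τ.nrm2 (T j) = √(∑ i, ‖g i j‖ ^ 2) := fun j =>
    hnrm (by positivity) (hT j).2.1
  have hSn : ∀ j, τ.nrm2 (S j) = √(∑ i, ‖g i j‖ ^ 2) := fun j =>
    hnrm (by positivity) (hS j).2.1
  obtain ⟨u, a, hu, -, hua, ha⟩ := τ.exists_sqrt_limit (fun j => (hS j).1) hS0
    (s := √(∑ i, ‖x i‖ ^ 2) + ε) (fun n => by rw [Finset.sum_congr rfl fun j _ => hSn j]; exact hgs n)
  obtain ⟨v, b, hv, -, hvb, hb⟩ := τ.exists_sqrt_limit (fun j => (hT j).1) hT0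
    (s := √(∑ i, ‖x i‖ ^ 2) + ε) (fun n => by rw [Finset.sum_congr rfl fun j _ => hTn j]; exact hgs n)
  have hsqrt : ∀ {R : ℕ → H →L[ℂ] H} (k : ℕ) (ξ : H), (∀ j, 0 ≤ R j) →
      √(∑ j ∈ Finset.range (k + 1), ‖CFC.sqrt (R j) ξ‖ ^ 2) =
        ‖CFC.sqrt (∑ j ∈ Finset.range (k + 1), R j) ξ‖ := by
    intro R k ξ hR
    rw [← Real.sqrt_sq (norm_nonneg (CFC.sqrt (∑ j ∈ Finset.range (k + 1), R j) ξ)),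
      inner_sqrt (Finset.sum_nonneg fun j _ => hR j)]
    congr 1
    rw [sum_apply, sum_inner, Complex.re_sum]
    exact Finset.sum_congr rfl fun j _ => inner_sqrt (hR j) ξ
  -- Mixed Schwarz for each term and Cauchy–Schwarz over j give the hypothesis of Douglas
  -- factorization for the partial sums.
  have hfac : ∀ i k, ∃ y ∈ M, ‖y‖ ≤ 1 ∧
      (∑ j ∈ Finset.range (k + 1), g i j : τ.PreL2).op = (u k).op * y * (v k).op := by
    intro i k
    refine exists_factorization (u k).2.1 (v k).2.1
      (∑ j ∈ Finset.range (k + 1), g i j : τ.PreL2).2.1 ?_ ?_ fun ξ η => ?_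
    · rw [hu]; exact CFC.sqrt_nonneg _
    · rw [hv]; exact CFC.sqrt_nonneg _
    · rw [PreL2.op_sum, sum_apply, inner_sum, hu, hv, ← hsqrt k η hS0,
        ← hsqrt k ξ hT0]
      refine (norm_sum_le _ _).trans (le_trans (Finset.sum_le_sum fun j _ => ?_)
        (Real.sum_mul_le_sqrt_mul_sqrt _ _ _))
      refine norm_inner_le_sqrt_mul_sqrt (hS0 j) (hT0 j) ?_ ((hT j).2.2 i) ξ η
      have := (hS j).2.2 i
      rwa [star_star] at this
  choose y hyM hy1 hyp using hfac
  choose Y hY1 hY using fun i => exists_isWeakLim (hyperfilter ℕ) (hy1 i)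
  exact ⟨a, b, Y, fun i => ⟨(hY i).mem (hyM i), hY1 i,
    τ.isProd_of_isWeakLim hua hvb (hg i) (hyM i) (hy1 i) (hyp i) (hY1 i) (hY i)⟩, ha, hb⟩

/-- The fourth-power form, ready for integration over Ω: δ is chosen so that (c + δ)² = c² + ε. -/
theorem exists_common_factorization {ι : Type*} [Fintype ι] (x : ι → τ.L2) {ε : ℝ}
    (hε : 0 < ε) :
    ∃ (a b : τ.L4) (y : ι → H →L[ℂ] H),
      (∀ i, y i ∈ M ∧ ‖y i‖ ≤ 1 ∧ τ.IsProd a (y i) b (x i)) ∧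
      ‖a‖ ^ 4 ≤ ∑ i, ‖x i‖ ^ 2 + ε ∧ ‖b‖ ^ 4 ≤ ∑ i, ‖x i‖ ^ 2 + ε := by
  set c := √(∑ i, ‖x i‖ ^ 2) with hc
  have hc2 : c ^ 2 = ∑ i, ‖x i‖ ^ 2 := Real.sq_sqrt (by positivity)
  have hc0 : 0 ≤ c := Real.sqrt_nonneg _
  set δ := √(c ^ 2 + ε) - c with hδ
  have hδ0 : 0 < δ := by
    rw [hδ, sub_pos]
    exact Real.lt_sqrt_of_sq_lt (by linarith)
  obtain ⟨a, b, y, h, ha, hb⟩ := τ.exists_common_factorization_sqrt x hδ0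
  have hsq : (c + δ) ^ 2 = c ^ 2 + ε := by
    rw [hδ, add_sub_cancel, Real.sq_sqrt (by positivity)]
  have key : ∀ {t : ℝ}, t ^ 2 ≤ c + δ → t ^ 4 ≤ ∑ i, ‖x i‖ ^ 2 + ε := fun {t} ht => by
    rw [← hc2, ← hsq, show (4 : ℕ) = 2 * 2 from rfl, pow_mul]
    gcongr
  exact ⟨a, b, y, h, key ha, key hb⟩

end NSFTrace

/-! ### Operators with finitely many distinct fibres -/

section FibreOperators

variable {H : Type*} [NormedAddCommGroup H] [InnerProductSpace ℂ H] [CompleteSpace H]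
variable {Ω : Type*} [MeasurableSpace Ω] (μ : Measure Ω)
variable {Q : Type*} [Fintype Q] [MeasurableSpace Q] [MeasurableSingletonClass Q]
variable {π : Ω → Q}

theorem norm_apply_le_sum (y : Q → H →L[ℂ] H) (q : Q) (ξ : H) : ‖y q ξ‖ ≤ (∑ p, ‖y p‖) * ‖ξ‖ :=
  ((y q).le_opNorm ξ).trans (by
    gcongr
    exact Finset.single_le_sum (f := fun p => ‖y p‖) (fun p _ => norm_nonneg _)
      (Finset.mem_univ q))

theorem memLp_fibre (hπ : Measurable π) (y : Q → H →L[ℂ] H) (ξ : Lp H 2 μ) :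
    MemLp (fun t => y (π t) (ξ t)) 2 μ := by
  classical
  refine MemLp.of_le_mul (c := ∑ p, ‖y p‖) (Lp.memLp ξ) ?_
    (.of_forall fun t => norm_apply_le_sum y _ _)
  have e : (fun t => y (π t) (ξ t)) =
      fun t => ∑ q, (π ⁻¹' {q}).indicator (fun t => y q (ξ t) : Ω → H) t := by
    funext t
    rw [Finset.sum_eq_single (π t)]
    · simp
    · intro q _ hq
      have hn : t ∉ π ⁻¹' {q} := fun h => hq (Set.mem_singleton_iff.1 h).symm
      exact Set.indicator_of_notMem hn _
    · simp
  rw [e]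
  refine Finset.aestronglyMeasurable_fun_sum _ fun q _ => ?_
  exact ((y q).continuous.comp_aestronglyMeasurable (Lp.aestronglyMeasurable ξ)).indicator
    (hπ (measurableSet_singleton q))

variable (hπ : Measurable π)

/-- The operator on `L_2(Ω; H)` whose fibre at `t` is `y (π t)`. -/
noncomputable def fibreOp (y : Q → H →L[ℂ] H) : Lp H 2 μ →L[ℂ] Lp H 2 μ :=
  LinearMap.mkContinuous
    { toFun := fun ξ => (memLp_fibre μ hπ y ξ).toLp _
      map_add' := fun ξ η => by
        refine Lp.ext ?_
        filter_upwards [(memLp_fibre μ hπ y (ξ + η)).coeFn_toLp, (memLp_fibre μ hπ y ξ).coeFn_toLp,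
          (memLp_fibre μ hπ y η).coeFn_toLp, Lp.coeFn_add ξ η, Lp.coeFn_add
          ((memLp_fibre μ hπ y ξ).toLp _) ((memLp_fibre μ hπ y η).toLp _)] with t h1 h2 h3 h4 h5
        rw [h1, h5, Pi.add_apply, h2, h3, h4, Pi.add_apply, map_add]
      map_smul' := fun c ξ => by
        refine Lp.ext ?_
        filter_upwards [(memLp_fibre μ hπ y (c • ξ)).coeFn_toLp, (memLp_fibre μ hπ y ξ).coeFn_toLp,
          Lp.coeFn_smul c ξ, Lp.coeFn_smul c ((memLp_fibre μ hπ y ξ).toLp _)] with t h1 h2 h3 h4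
        rw [h1, RingHom.id_apply, h4, Pi.smul_apply, h2, h3, Pi.smul_apply, map_smul] }
    (∑ p, ‖y p‖) fun ξ => by
      refine Lp.norm_le_mul_norm_of_ae_le_mul ?_
      filter_upwards [(memLp_fibre μ hπ y ξ).coeFn_toLp] with t h
      exact (congrArg norm h).trans_le (norm_apply_le_sum y _ _)

theorem fibreOp_apply (y : Q → H →L[ℂ] H) (ξ : Lp H 2 μ) :
    fibreOp μ hπ y ξ =ᵐ[μ] fun t => y (π t) (ξ t) :=
  (memLp_fibre μ hπ y ξ).coeFn_toLp

theorem norm_fibreOp_le {y : Q → H →L[ℂ] H} (hy : ∀ q, ‖y q‖ ≤ 1) : ‖fibreOp μ hπ y‖ ≤ 1 := by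
  refine ContinuousLinearMap.opNorm_le_bound _ zero_le_one fun ξ => ?_
  rw [one_mul]
  refine Lp.norm_le_norm_of_ae_le ?_
  filter_upwards [fibreOp_apply μ hπ y ξ] with t h
  rw [h]
  simpa using (y (π t)).le_of_opNorm_le (hy _) (ξ t)

theorem fibreOp_add (y z : Q → H →L[ℂ] H) :
    fibreOp μ hπ (y + z) = fibreOp μ hπ y + fibreOp μ hπ z := by
  ext1 ξ
  refine Lp.ext ?_
  filter_upwards [fibreOp_apply μ hπ (y + z) ξ, fibreOp_apply μ hπ y ξ, fibreOp_apply μ hπ z ξ,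
    Lp.coeFn_add (fibreOp μ hπ y ξ) (fibreOp μ hπ z ξ)] with t h1 h2 h3 h4
  exact h1.trans (Eq.trans (congrArg₂ (· + ·) h2 h3).symm h4.symm)

theorem fibreOp_mul (y z : Q → H →L[ℂ] H) :
    fibreOp μ hπ (y * z) = fibreOp μ hπ y * fibreOp μ hπ z := by
  ext1 ξ
  refine Lp.ext ?_
  filter_upwards [fibreOp_apply μ hπ (y * z) ξ, fibreOp_apply μ hπ y (fibreOp μ hπ z ξ),
    fibreOp_apply μ hπ z ξ] with t h1 h2 h3
  refine h1.trans (Eq.trans ?_ h2.symm)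
  rw [h3]
  rfl

/-- A set is contained in its double commutant. -/
theorem tensorGenerators_subset (M : VonNeumannAlgebra H) :
    tensorGenerators M μ ⊆ (tensorVN M μ : Set (Lp H 2 μ →L[ℂ] Lp H 2 μ)) := by
  intro T hT
  change T ∈ StarSubalgebra.centralizer ℂ _
  rw [StarSubalgebra.mem_centralizer_iff]
  intro z hz
  have hz' := StarSubalgebra.mem_centralizer_iff ℂ |>.1 hz T hT
  refine ⟨hz'.1.symm, ?_⟩
  have := congrArg star hz'.2
  simpa using this

/-- The operator is the finite sum over q of 1_{π = q} ⊗ y_q, each term being a product of two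
generators. -/
theorem fibreOp_mem [IsFiniteMeasure μ] {M : VonNeumannAlgebra H} {y : Q → H →L[ℂ] H}
    (hy : ∀ q, y q ∈ M) : fibreOp μ hπ y ∈ tensorVN M μ := by
  classical
  have e : y = ∑ q, (fun p => if p = q then 1 else 0) * fun _ => y q := by
    funext p
    rw [Finset.sum_apply, Finset.sum_eq_single p]
    · simp
    · intro q _ hq
      simp [hq.symm]
    · simp
  let L : (Q → H →L[ℂ] H) →+ (Lp H 2 μ →L[ℂ] Lp H 2 μ) :=
    AddMonoidHom.mk' (fibreOp μ hπ) (fibreOp_add μ hπ)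
  have e2 : fibreOp μ hπ y =
      ∑ q, fibreOp μ hπ (fun p => if p = q then 1 else 0) * fibreOp μ hπ fun _ => y q := by
    conv_lhs => rw [e]
    refine (map_sum L _ _).trans (Finset.sum_congr rfl fun q _ => ?_)
    exact fibreOp_mul μ hπ _ _
  rw [e2]
  refine sum_mem fun q _ => mul_mem ?_ ?_
  · refine tensorGenerators_subset μ M (Or.inl ⟨(π ⁻¹' {q}).indicator fun _ => 1,
      (memLp_const (1 : ℂ)).indicator (hπ (measurableSet_singleton q)), fun ξ => ?_⟩)
    filter_upwards [fibreOp_apply μ hπ (fun p => if p = q then (1 : H →L[ℂ] H) else 0) ξ] with t h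
    rw [h]
    by_cases hq : π t = q <;> simp [hq]
  · exact tensorGenerators_subset μ M (Or.inr ⟨y q, hy q, fun ξ => fibreOp_apply μ hπ _ ξ⟩)

end FibreOperators

/-! ### The maximal norm is bounded by a square function -/

section MaxNorm

variable {H : Type*} [NormedAddCommGroup H] [InnerProductSpace ℂ H] [CompleteSpace H]
variable {M : VonNeumannAlgebra H} (τ : NSFTrace M)
variable {Ω : Type*} [MeasurableSpace Ω] (μ : Measure Ω) [IsProbabilityMeasure μ]
variable {Q : Type*} [Fintype Q] [MeasurableSpace Q] [MeasurableSingletonClass Q]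
variable {π : Ω → Q}

theorem enorm_toLp_pow_four_le {E : Type*} [NormedAddCommGroup E] {a : Ω → E} (ha : MemLp a 4 μ)
    {F : Ω → ℝ≥0∞} {ε R : ℝ≥0∞} (h : ∀ t, ‖a t‖ₑ ^ 4 ≤ F t + ε) (hF : ∫⁻ t, F t ∂μ ≤ R) :
    ‖ha.toLp a‖ₑ ^ 4 ≤ R + ε := by
  have h1 := eLpNorm_nnreal_pow_eq_lintegral (f := a) (μ := μ) (p := 4) (by norm_num)
  rw [Lp.enorm_toLp]
  have e : ((4 : ℝ≥0) : ℝ) = ((4 : ℕ) : ℝ) := by norm_num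
  simp only [e, ENNReal.rpow_natCast] at h1
  have e' : ((4 : ℝ≥0) : ℝ≥0∞) = 4 := rfl
  rw [e'] at h1
  rw [h1]
  refine (lintegral_mono h).trans ?_
  rw [lintegral_add_right _ measurable_const, lintegral_const, measure_univ, mul_one]
  gcongr

/-- The maximal norm of a family of finite-valued functions is controlled by the `L_2` norm of a
square function: at each point `t` the members of the family are among the vectors
`X d (π t)`, `d ∈ D`. -/
theorem maxNorm_le_of_finite (hπ : Measurable π) {D ι : Type*} [Fintype D] (δ : ι → Q → D)
    (X : D → Q → τ.L2) (x : ι → L2N τ μ) (hx : ∀ i, x i =ᵐ[μ] fun t => X (δ i (π t)) (π t))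
    {R : ℝ≥0∞} (hR : ∫⁻ t, ∑ d, ‖X d (π t)‖ₑ ^ 2 ∂μ ≤ R ^ 2) : maxNorm τ μ x ≤ R := by
  have key : ∀ ε : ℝ≥0, 0 < ε → maxNorm τ μ x ^ 2 ≤ R ^ 2 + ε := by
    intro ε hε
    -- At each q all vectors X d q are factored through the same a and b; the index i enters only
    -- through the choice of the contraction, y q (δ i q).
    choose a b y hy ha hb using fun q =>
      τ.exists_common_factorization (fun d => X d q) (ε := ε) hε
    have hmeas : ∀ c : Q → τ.L4, MemLp (fun t => c (π t)) 4 μ := fun c => by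
      obtain ⟨C, hC⟩ := Finite.exists_le (‖c ·‖)
      exact MemLp.of_bound (StronglyMeasurable.of_discrete.comp_measurable hπ).aestronglyMeasurable
        C (.of_forall fun t => hC _)
    have hpow : ∀ {c : Q → τ.L4}, (∀ q, ‖c q‖ ^ 4 ≤ ∑ d, ‖X d q‖ ^ 2 + ε) →
        ‖(hmeas c).toLp _‖ₑ ^ 4 ≤ R ^ 2 + ε := fun {c} hc => by
      refine enorm_toLp_pow_four_le μ (hmeas c) (F := fun t => ∑ d, ‖X d (π t)‖ₑ ^ 2)
        (fun t => ?_) hR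
      have h1 := ENNReal.ofReal_le_ofReal (hc (π t))
      rw [ENNReal.ofReal_add (by positivity) (NNReal.coe_nonneg ε), ENNReal.ofReal_sum_of_nonneg
        (fun _ _ => by positivity), ENNReal.ofReal_coe_nnreal,
        ENNReal.ofReal_pow (norm_nonneg _), ofReal_norm] at h1
      simpa only [ENNReal.ofReal_pow (norm_nonneg _), ofReal_norm] using h1
    let Y : ι → tensorVN M μ := fun i =>
      ⟨fibreOp μ hπ fun q => y q (δ i q), fibreOp_mem μ hπ fun q => (hy q _).1⟩
    have hY : ∀ i, ‖(Y i : Lp H 2 μ →L[ℂ] Lp H 2 μ)‖ ≤ 1 := fun i =>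
      norm_fibreOp_le μ hπ fun q => (hy q _).2.1
    have hle : maxNorm τ μ x ≤ (⨆ i, ‖(Y i : Lp H 2 μ →L[ℂ] Lp H 2 μ)‖ₑ) *
        ‖(hmeas a).toLp _‖ₑ * ‖(hmeas b).toLp _‖ₑ := by
      refine iInf_le_of_le ((hmeas a).toLp _) (iInf_le_of_le ((hmeas b).toLp _)
        (iInf_le_of_le Y (iInf_le_of_le ⟨1, hY⟩ (iInf_le_of_le (fun i => ?_) le_rfl))))
      refine ⟨fun t => y (π t) (δ i (π t)), ⟨fun t => (hy _ _).1, fun ξ =>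
        fibreOp_apply μ hπ _ ξ⟩, ?_⟩
      filter_upwards [(hmeas a).coeFn_toLp, (hmeas b).coeFn_toLp, hx i] with t h1 h2 h3
      rw [h1, h2, h3]
      exact (hy _ _).2.2
    have hsup : (⨆ i, ‖(Y i : Lp H 2 μ →L[ℂ] Lp H 2 μ)‖ₑ) ≤ 1 := iSup_le fun i => by
      rw [← ofReal_norm]
      exact ENNReal.ofReal_le_one.2 (hY i)
    have hle' : maxNorm τ μ x ≤ ‖(hmeas a).toLp _‖ₑ * ‖(hmeas b).toLp _‖ₑ := by
      refine hle.trans ?_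
      calc _ ≤ 1 * ‖(hmeas a).toLp _‖ₑ * ‖(hmeas b).toLp _‖ₑ := by gcongr
        _ = _ := by rw [one_mul]
    have h4 : (maxNorm τ μ x ^ 2) ^ 2 ≤ (R ^ 2 + ε) ^ 2 := by
      rw [← pow_mul]
      calc maxNorm τ μ x ^ (2 * 2)
          ≤ (‖(hmeas a).toLp _‖ₑ * ‖(hmeas b).toLp _‖ₑ) ^ 4 := by gcongr
        _ = ‖(hmeas a).toLp _‖ₑ ^ 4 * ‖(hmeas b).toLp _‖ₑ ^ 4 := mul_pow _ _ _
        _ ≤ (R ^ 2 + ε) * (R ^ 2 + ε) := by gcongr; exacts [hpow ha, hpow hb]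
        _ = _ := (sq _).symm
    exact (ENNReal.pow_le_pow_left_iff two_ne_zero).1 h4
  refine (ENNReal.pow_le_pow_left_iff two_ne_zero).1 ?_
  exact ENNReal.le_of_forall_pos_le_add fun ε hε _ => key ε hε

end MaxNorm

/-! ### Orthogonality of irreducible characters -/

section Characters

variable {K : Type*} [Group K]

open scoped ComplexOrder in
/-- Weyl's unitary trick for characters: `χ(g⁻¹)` is the complex conjugate of `χ(g)`. -/
theorem character_inv_eq_conj [Finite K] {d : ℕ} (ρ : Representation ℂ K (Fin d → ℂ)) (g : K) :
    ρ.character g⁻¹ = conj (ρ.character g) := by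
  have := Fintype.ofFinite K
  let A : K → Matrix (Fin d) (Fin d) ℂ := fun k => LinearMap.toMatrix' (ρ k)
  have hA1 : A 1 = 1 := by simp [A]
  have hAm : ∀ k l, A (k * l) = A k * A l := fun k l => by
    simp only [A, map_mul]
    exact LinearMap.toMatrix'_comp _ _
  have htr : ∀ k, ρ.character k = (A k).trace := fun k => by
    rw [Representation.character, ← Matrix.trace_toLin'_eq]
    simp [A]
  -- The averaged invariant form is positive definite and yields A(g)* = P A(g⁻¹) P⁻¹; take traces.
  let P : Matrix (Fin d) (Fin d) ℂ := ∑ k, (A k).conjTranspose * A k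
  have hinv : (A g).conjTranspose * P * A g = P := by
    simp only [P, Finset.mul_sum, Finset.sum_mul]
    refine Fintype.sum_equiv (Equiv.mulRight g) _ _ fun k => ?_
    simp only [Equiv.coe_mulRight]
    rw [hAm, Matrix.conjTranspose_mul]
    simp only [Matrix.mul_assoc]
  have hP : P.PosDef := by
    classical
    have e : P = 1 + ∑ k ∈ Finset.univ.erase 1, (A k).conjTranspose * A k := by
      simp only [P]
      rw [← Finset.add_sum_erase _ _ (Finset.mem_univ (1 : K)), hA1]
      simp
    rw [e]
    exact Matrix.PosDef.one.add_posSemidef (Matrix.posSemidef_sum _ fun k _ =>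
      Matrix.posSemidef_conjTranspose_mul_self _)
  have hPu : IsUnit P.det := (Matrix.isUnit_iff_isUnit_det P).1 hP.isUnit
  have hg : A g * A g⁻¹ = 1 := by rw [← hAm, mul_inv_cancel, hA1]
  have hstar : (A g).conjTranspose = P * A g⁻¹ * P⁻¹ := by
    have h1 : (A g).conjTranspose * P = P * A g⁻¹ := by
      calc (A g).conjTranspose * P = (A g).conjTranspose * P * (A g * A g⁻¹) := by
            rw [hg, Matrix.mul_one]
        _ = ((A g).conjTranspose * P * A g) * A g⁻¹ := by simp only [Matrix.mul_assoc]
        _ = _ := by rw [hinv]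
    rw [← h1, Matrix.mul_assoc, Matrix.mul_nonsing_inv P hPu, Matrix.mul_one]
  have h2 := congrArg Matrix.trace hstar
  rw [Matrix.trace_conjTranspose, Matrix.trace_mul_comm, ← Matrix.mul_assoc,
    Matrix.nonsing_inv_mul P hPu, Matrix.one_mul] at h2
  rw [htr, htr, ← h2]
  rfl

theorem irrChars_orthonormal [Fintype K] {φ ψ : K → ℂ} (hφ : φ ∈ irrChars K)
    (hψ : ψ ∈ irrChars K) :
    (Nat.card K : ℂ)⁻¹ * ∑ g, φ g * conj (ψ g) = (if φ = ψ then 1 else 0 : ℂ) := by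
  classical
  obtain ⟨d, ρ, hρ, rfl⟩ := hφ
  obtain ⟨e, σ, hσ, rfl⟩ := hψ
  have hc : (Nat.card K : ℂ) ≠ 0 := by exact_mod_cast Nat.card_pos.ne'
  let _ : Invertible (Nat.card K : ℂ) := invertibleOfNonzero hc
  have h := Representation.char_orthonormal ρ σ
  simp only [character_inv_eq_conj] at h
  -- For equal characters, replacing σ by ρ avoids having to know that the character determines the
  -- representation.
  by_cases hne : ρ.character = σ.character
  · have h' := Representation.char_orthonormal ρ ρ
    rw [if_pos ⟨Representation.Equiv.refl ρ⟩] at h'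
    simp only [character_inv_eq_conj] at h'
    rw [← hne, if_pos rfl, h']
  · rw [if_neg hne, h, if_neg]
    rintro ⟨φ⟩
    exact hne (Representation.char_iso φ).symm

end Characters

/-! ### Bessel's inequality with Hilbert space values -/

section Bessel

variable {Ω : Type*} [MeasurableSpace Ω] {μ : Measure Ω} [IsFiniteMeasure μ]

/-- Bessel's inequality for Hilbert space valued functions. -/
theorem sum_norm_integral_sq_le {E : Type*} [NormedAddCommGroup E] [InnerProductSpace ℂ E]
    [CompleteSpace E] {I : Type*} [Fintype I] [DecidableEq I] {Ψ : I → Ω → ℂ}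
    (hΨ : ∀ i, MemLp (Ψ i) ∞ μ)
    (hortho : ∀ i j, ∫ x, Ψ i x * conj (Ψ j x) ∂μ = (if i = j then 1 else 0 : ℂ)) (f : Lp E 2 μ) :
    ∑ i, ‖∫ x, conj (Ψ i x) • f x ∂μ‖ ^ 2 ≤ ‖f‖ ^ 2 := by
  set v : I → E := fun i => ∫ x, conj (Ψ i x) • f x ∂μ with hv
  have hU : ∀ i, MemLp (fun x => Ψ i x • v i) 2 μ := fun i =>
    MemLp.smul (p := 2) (q := ∞) (memLp_const (v i)) ((hΨ i).mono_exponent le_top)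
  set U : I → Lp E 2 μ := fun i => (hU i).toLp _
  have hconj : ∀ i, MemLp (fun x => conj (Ψ i x)) ∞ μ := fun i => (hΨ i).star
  have hint : ∀ i, Integrable (fun x => conj (Ψ i x) • f x) μ := fun i => by
    have h1 : MemLp (fun x => f x) 1 μ := (Lp.memLp f).mono_exponent (by norm_num)
    exact memLp_one_iff_integrable.1 (h1.smul (hconj i))
  have hUf : ∀ i, inner ℂ (U i) f = ((‖v i‖ ^ 2 : ℝ) : ℂ) := fun i => by
    rw [L2.inner_def]
    calc ∫ x, inner ℂ (U i x) (f x) ∂μ = ∫ x, inner ℂ (v i) (conj (Ψ i x) • f x) ∂μ := by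
          refine integral_congr_ae ?_
          filter_upwards [(hU i).coeFn_toLp] with x hx
          rw [hx, inner_smul_left, inner_smul_right]
      _ = inner ℂ (v i) (v i) := integral_inner (hint i) (v i)
      _ = _ := by rw [inner_self_eq_norm_sq_to_K]; norm_cast
  have hUU : ∀ i j, inner ℂ (U i) (U j) = if i = j then ((‖v i‖ ^ 2 : ℝ) : ℂ) else 0 := by
    intro i j
    rw [L2.inner_def]
    calc ∫ x, inner ℂ (U i x) (U j x) ∂μ
        = ∫ x, (Ψ j x * conj (Ψ i x)) * inner ℂ (v i) (v j) ∂μ := by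
          refine integral_congr_ae ?_
          filter_upwards [(hU i).coeFn_toLp, (hU j).coeFn_toLp] with x hx hy
          rw [hx, hy, inner_smul_left, inner_smul_right]
          ring
      _ = _ := by
          rw [integral_mul_const, hortho]
          by_cases h : i = j
          · subst h
            rw [if_pos rfl, if_pos rfl, one_mul, inner_self_eq_norm_sq_to_K]
            norm_cast
          · rw [if_neg h, if_neg (Ne.symm h), zero_mul]
  -- The U_i = Ψ_i v_i are orthogonal with ⟨U_i, f⟩ = ‖v_i‖², so this square expands to ‖f‖² - Σ
  -- ‖v_i‖².
  have h0 : 0 ≤ ‖f - ∑ i, U i‖ ^ 2 := by positivity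
  have hsumf : inner ℂ (∑ i, U i) f = ((∑ i, ‖v i‖ ^ 2 : ℝ) : ℂ) := by
    rw [sum_inner, Complex.ofReal_sum]
    exact Finset.sum_congr rfl fun i _ => hUf i
  have hsums : inner ℂ (∑ i, U i) (∑ i, U i) = ((∑ i, ‖v i‖ ^ 2 : ℝ) : ℂ) := by
    rw [sum_inner, Complex.ofReal_sum]
    refine Finset.sum_congr rfl fun i _ => ?_
    rw [inner_sum, Finset.sum_congr rfl fun j _ => hUU i j]
    simp
  have hsn : ‖∑ i, U i‖ ^ 2 = ∑ i, ‖v i‖ ^ 2 := by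
    have := inner_self_eq_norm_sq (𝕜 := ℂ) (∑ i, U i)
    rw [hsums] at this
    exact this.symm
  rw [@norm_sub_sq ℂ, hsn, ← inner_conj_symm, hsumf] at h0
  have hre : RCLike.re (conj ((∑ i, ‖v i‖ ^ 2 : ℝ) : ℂ)) = ∑ i, ‖v i‖ ^ 2 := by
    rw [Complex.conj_ofReal]; rfl
  rw [hre] at h0
  linarith

end Bessel

/-! ### Integration of finite products -/

section ProductMeasure

variable {Γ : ℕ → Type*} [∀ k, MeasurableSpace (Γ k)]

theorem integral_finset_prod_infinitePi (μ : ∀ k, Measure (Γ k)) [∀ k, IsProbabilityMeasure (μ k)]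
    (I : Finset ℕ) (h : ∀ k : I, Γ k → ℂ) (hh : ∀ k, StronglyMeasurable (h k)) :
    ∫ x, ∏ k : I, h k (x k) ∂(Measure.infinitePi μ) = ∏ k : I, ∫ z, h k z ∂(μ k) := by
  rw [← integral_fintype_prod_eq_prod, ← Measure.infinitePi_map_restrict, integral_map]
  · rfl
  · exact (Finset.measurable_restrict I).aemeasurable
  · refine StronglyMeasurable.aestronglyMeasurable ?_
    exact Finset.stronglyMeasurable_fun_prod _ fun k _ =>
      (hh k).comp_measurable (measurable_pi_apply k)

end ProductMeasure

/-! ### Mixed radix digits and truncated characters -/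

section Digits

variable (Γ : ℕ → Type*) [∀ k, Group (Γ k)] [∀ k, Finite (Γ k)]

theorem numClasses_pos (k : ℕ) : 0 < numClasses Γ k := Nat.card_pos

theorem two_le_numClasses [∀ k, Nontrivial (Γ k)] (k : ℕ) : 2 ≤ numClasses Γ k := by
  obtain ⟨g, hg⟩ := exists_ne (1 : Γ k)
  have : Nontrivial (ConjClasses (Γ k)) := ⟨ConjClasses.mk g, ConjClasses.mk 1, fun h => by
    rw [ConjClasses.mk_eq_mk_iff_isConj, isConj_one_left] at h
    exact hg h⟩
  exact Finite.one_lt_card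

theorem bigP_pos (k : ℕ) : 0 < bigP Γ k := Finset.prod_pos fun i _ => numClasses_pos Γ i

theorem bigP_succ (k : ℕ) : bigP Γ (k + 1) = bigP Γ k * numClasses Γ k :=
  Finset.prod_range_succ _ _

theorem bigP_dvd {k l : ℕ} (h : k ≤ l) : bigP Γ k ∣ bigP Γ l :=
  Finset.prod_dvd_prod_of_subset _ _ _ (Finset.range_mono h)

theorem lt_bigP [∀ k, Nontrivial (Γ k)] (n : ℕ) : n < bigP Γ n := by
  refine (Nat.lt_two_pow_self (n := n)).trans_le ?_
  calc 2 ^ n = ∏ _i ∈ Finset.range n, 2 := by simp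
    _ ≤ _ := Finset.prod_le_prod' fun i _ => two_le_numClasses Γ i

theorem sum_dig_mul_bigP (n N : ℕ) :
    ∑ k ∈ Finset.range N, dig Γ n k * bigP Γ k = n % bigP Γ N := by
  induction N with
  | zero => simp [bigP, Nat.mod_one]
  | succ N ih => rw [Finset.sum_range_succ, ih, bigP_succ, Nat.mod_mul, dig, mul_comm (bigP Γ N)]

theorem dig_eq_zero_of_lt {n k : ℕ} (h : n < bigP Γ k) : dig Γ n k = 0 := by
  rw [dig, Nat.div_eq_of_lt h, Nat.zero_mod]

/-- Erasing the digits below s subtracts n mod P_s. Since P_n > n, only finitely many digits are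
nonzero. -/
theorem tail_eq [∀ k, Nontrivial (Γ k)] (s n : ℕ) : tail Γ s n = bigP Γ s * (n / bigP Γ s) := by
  have hzero : ∀ k, n ≤ k → dig Γ n k = 0 := fun k hk => by
    refine dig_eq_zero_of_lt Γ ((lt_bigP Γ n).trans_le ?_)
    exact Nat.le_of_dvd (bigP_pos Γ k) (bigP_dvd Γ hk)
  have h1 : tail Γ s n = ∑ k ∈ Finset.Ico s (s + n), dig Γ n k * bigP Γ k := by
    rw [tail, ← finsum_mem_finset_eq_sum]
    refine finsum_congr fun k => ?_
    by_cases hk : s ≤ k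
    · by_cases hk' : k < s + n
      · simp [hk, hk']
      · simp [hzero k (by lia)]
    · simp [hk]
  have h2 := Finset.sum_range_add_sum_Ico (fun k => dig Γ n k * bigP Γ k) (Nat.le_add_right s n)
  rw [← h1, sum_dig_mul_bigP, sum_dig_mul_bigP, Nat.mod_eq_of_lt (a := n) (b := bigP Γ (s + n))]
    at h2
  · have := Nat.mod_add_div n (bigP Γ s)
    lia
  · exact (lt_bigP Γ n).trans_le (Nat.le_of_dvd (bigP_pos Γ _) (bigP_dvd Γ (by lia)))

theorem dig_tail [∀ k, Nontrivial (Γ k)] (s n k : ℕ) :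
    dig Γ (tail Γ s n) k = if s ≤ k then dig Γ n k else 0 := by
  rw [tail_eq, dig]
  split_ifs with h
  · obtain ⟨R, hR⟩ := bigP_dvd Γ h
    rw [dig, hR, Nat.mul_div_mul_left _ _ (bigP_pos Γ s), Nat.div_div_eq_div_mul]
  · obtain ⟨R, hR⟩ := bigP_dvd Γ (show k + 1 ≤ s by lia)
    rw [hR, bigP_succ, mul_assoc, mul_assoc, Nat.mul_div_cancel_left _ (bigP_pos Γ k),
      Nat.mul_mod_right]

theorem dig_eq_zero_of_mem_block {A n k : ℕ} (hn : n ∈ block Γ A) (hk : A < k) :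
    dig Γ n k = 0 := by
  by_contra h
  exact absurd (hn.2 h) (not_le.2 hk)

/-- Digits above A vanish by maximality and those below s are erased; both contribute the trivial
character. -/
theorem chi_tail [∀ k, Nontrivial (Γ k)] {r : ∀ k, ℕ → Γ k → ℂ} (hr : ∀ k, r k 0 = fun _ => 1)
    {A s n : ℕ} (hn : n ∈ block Γ A) (x : ∀ k, Γ k) :
    chi r (tail Γ s n) x =
      ∏ k ∈ Finset.range (A + 1), if k < s then 1 else r k (dig Γ n k) (x k) := by
  rw [chi, finprod_eq_prod_of_mulSupport_subset (s := Finset.range (A + 1))]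
  · refine Finset.prod_congr rfl fun k _ => ?_
    rw [dig_tail]
    by_cases h : k < s
    · rw [if_pos h, if_neg (not_le.2 h), hr]
    · rw [if_neg h, if_pos (not_lt.1 h)]
  · intro k hk
    rw [Function.mem_mulSupport] at hk
    by_contra hA
    rw [Finset.mem_coe, Finset.mem_range, not_lt] at hA
    refine hk ?_
    rw [dig_tail, dig_eq_zero_of_mem_block Γ hn (by lia), ite_self, hr]

end Digits

/-! ### Normalized class indicators on a finite group -/

section Uniform

open ProbabilityTheory

variable {K : Type*} [Group K] [Finite K] [MeasurableSpace K] [MeasurableSingletonClass K]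

theorem integral_uniformOn_univ [Fintype K] (h : K → ℂ) :
    ∫ z, h z ∂(uniformOn (Set.univ : Set K)) = (Nat.card K : ℂ)⁻¹ * ∑ z, h z := by
  rw [integral_fintype .of_finite, Finset.mul_sum]
  refine Finset.sum_congr rfl fun z _ => ?_
  have : (uniformOn (Set.univ : Set K)).real {z} = (Nat.card K : ℝ)⁻¹ := by
    rw [measureReal_def, uniformOn_univ]
    simp
  rw [this, Complex.real_smul]
  simp

theorem uniformOn_univ_real_pos {S : Set K} (hS : S.Nonempty) :
    0 < (uniformOn (Set.univ : Set K)).real S := by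
  refine ENNReal.toReal_pos (fun h => ?_) (measure_ne_top _ _)
  rw [uniformOn_eq_zero_iff Set.finite_univ, Set.univ_inter] at h
  exact hS.ne_empty h

/-- The number of the conjugacy class of `x`. -/
noncomputable def classIdx (x : K) : Fin (Nat.card (ConjClasses K)) :=
  Finite.equivFin _ (ConjClasses.mk x)

theorem classIdx_eq_iff {x y : K} : classIdx x = classIdx y ↔ IsConj x y := by
  rw [classIdx, classIdx, EmbeddingLike.apply_eq_iff_eq, ConjClasses.mk_eq_mk_iff_isConj]

theorem exists_classIdx_eq (j : Fin (Nat.card (ConjClasses K))) : ∃ x : K, classIdx x = j := by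
  obtain ⟨c, rfl⟩ := (Finite.equivFin (ConjClasses K)).surjective j
  obtain ⟨x, rfl⟩ := ConjClasses.mk_surjective c
  exact ⟨x, rfl⟩

/-- The probability of the conjugacy class of `x`. -/
noncomputable def classMass (x : K) : ℝ := (uniformOn (Set.univ : Set K)).real {z | IsConj x z}

theorem classMass_pos (x : K) : 0 < classMass x := uniformOn_univ_real_pos ⟨x, IsConj.refl x⟩

theorem classMass_congr {x y : K} (h : IsConj x y) : classMass x = classMass y := by
  rw [classMass, classMass]
  congr 1
  ext z
  exact ⟨fun hz => h.symm.trans hz, fun hz => h.trans hz⟩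

/-- The normalized indicator function of the `j`-th conjugacy class. -/
noncomputable def classFn (j : Fin (Nat.card (ConjClasses K))) (x : K) : ℂ :=
  open scoped Classical in
  if classIdx x = j then ((√(classMass x) : ℝ) : ℂ)⁻¹ else 0

open scoped Classical in
-- With j the class of y, the kernel reproduces averaging over that class: this supplies the factors
-- k < s of 1/μ(J_s(y)).
theorem classFn_mul_conj (x y : K) :
    classFn (classIdx y) y * conj (classFn (classIdx y) x) =
      if IsConj y x then ((classMass y : ℝ) : ℂ)⁻¹ else 0 := by
  rw [classFn, classFn, if_pos rfl]
  by_cases h : IsConj y x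
  · rw [if_pos h, if_pos (classIdx_eq_iff.2 h.symm), classMass_congr h, map_inv₀,
      Complex.conj_ofReal, ← mul_inv, ← Complex.ofReal_mul, Real.mul_self_sqrt (classMass_pos x).le]
  · rw [if_neg h, if_neg fun e => h (classIdx_eq_iff.1 e).symm, map_zero, mul_zero]

theorem classFn_orthonormal (i j : Fin (Nat.card (ConjClasses K))) :
    ∫ x, classFn i x * conj (classFn j x) ∂(uniformOn (Set.univ : Set K)) =
      (if i = j then 1 else 0 : ℂ) := by
  classical
  by_cases h : i = j
  · subst h
    obtain ⟨y, rfl⟩ := exists_classIdx_eq i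
    have e : ∀ x, classFn (classIdx y) x * conj (classFn (classIdx y) x) =
        Set.indicator {z | IsConj y z} (fun _ => ((classMass y : ℝ) : ℂ)⁻¹) x := fun x => by
      by_cases hx : IsConj y x
      · rw [Set.indicator_of_mem (by exact hx), classIdx_eq_iff.2 hx, classFn_mul_conj,
          if_pos (IsConj.refl x), classMass_congr hx]
      · rw [Set.indicator_of_notMem (by exact hx), classFn,
          if_neg fun e => hx (classIdx_eq_iff.1 e).symm, zero_mul]
    simp_rw [e]
    rw [integral_indicator_const _ (Set.toFinite _).measurableSet, if_true, Complex.real_smul]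
    exact mul_inv_cancel₀ (Complex.ofReal_ne_zero.2 (classMass_pos y).ne')
  · rw [if_neg h]
    convert integral_zero K ℂ using 2
    ext x
    rw [classFn, classFn]
    by_cases hi : classIdx x = i
    · rw [if_neg fun hj => h (hi.symm.trans hj), map_zero, mul_zero]
    · rw [if_neg hi, zero_mul]

end Uniform

/-! ### The mixed orthonormal system and the kernels of the averages -/

section System

variable {Γ : ℕ → Type*} [∀ k, Group (Γ k)] [∀ k, Finite (Γ k)]
  [∀ k, MeasurableSpace (Γ k)] [∀ k, MeasurableSingletonClass (Γ k)]

instance : IsProbabilityMeasure (haarG Γ) := by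
  unfold haarG
  infer_instance

/-- Orthonormal functions on `Γ k`: normalized indicators of conjugacy classes for `k < s`,
irreducible characters for `k ≥ s`. -/
noncomputable def mixedFn (r : ∀ k, ℕ → Γ k → ℂ) (s k : ℕ) (j : Fin (numClasses Γ k)) : Γ k → ℂ :=
  if k < s then classFn j else r k j

/-- The index `j` for which `mixedFn r s k j` does not vanish at `y`, if `k < s`, and the `k`-th
digit of `n` otherwise. -/
noncomputable def mixedIdx (s n k : ℕ) (y : Γ k) : Fin (numClasses Γ k) :=
  if k < s then classIdx y else ⟨dig Γ n k, Nat.mod_lt _ (numClasses_pos Γ k)⟩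

theorem mixedFn_orthonormal {r : ∀ k, ℕ → Γ k → ℂ} (hr : IsCharacterSystem Γ r) (s k : ℕ)
    (i j : Fin (numClasses Γ k)) :
    ∫ x, mixedFn r s k i x * conj (mixedFn r s k j x)
      ∂(ProbabilityTheory.uniformOn (Set.univ : Set (Γ k))) = (if i = j then 1 else 0 : ℂ) := by
  by_cases h : k < s
  · simp only [mixedFn, if_pos h]
    exact classFn_orthonormal i j
  · have := Fintype.ofFinite (Γ k)
    simp only [mixedFn, if_neg h]
    rw [integral_uniformOn_univ, irrChars_orthonormal ((hr k).1.mapsTo i.2) ((hr k).1.mapsTo j.2)]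
    have e : r k i = r k j ↔ i = j :=
      ⟨fun e => Fin.ext ((hr k).1.injOn i.2 j.2 e), fun e => by rw [e]⟩
    simp only [e]

/-- Products of the functions `mixedFn` over the coordinates in `I`. -/
noncomputable def mixedProd (r : ∀ k, ℕ → Γ k → ℂ) (s : ℕ) (I : Finset ℕ)
    (m : ∀ k : I, Fin (numClasses Γ k)) (x : ∀ k, Γ k) : ℂ :=
  ∏ k : I, mixedFn r s k (m k) (x k)

theorem mixedProd_orthonormal {r : ∀ k, ℕ → Γ k → ℂ} (hr : IsCharacterSystem Γ r) (s : ℕ)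
    (I : Finset ℕ) (m l : ∀ k : I, Fin (numClasses Γ k)) :
    ∫ x, mixedProd r s I m x * conj (mixedProd r s I l x) ∂(haarG Γ) =
      (if m = l then 1 else 0 : ℂ) := by
  have e : ∀ x, mixedProd r s I m x * conj (mixedProd r s I l x) =
      ∏ k : I, (fun z => mixedFn r s k (m k) z * conj (mixedFn r s k (l k) z)) (x k) := fun x => by
    rw [mixedProd, mixedProd, map_prod, ← Finset.prod_mul_distrib]
  simp_rw [e]
  rw [haarG, integral_finset_prod_infinitePi _ I
    (fun k z => mixedFn r s k (m k) z * conj (mixedFn r s k (l k) z))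
    fun k => (measurable_of_finite _).stronglyMeasurable]
  simp_rw [mixedFn_orthonormal hr]
  by_cases h : m = l
  · simp [h]
  · obtain ⟨k, hk⟩ := Function.ne_iff.1 h
    rw [if_neg h]
    exact Finset.prod_eq_zero (Finset.mem_univ k) (if_neg hk)

theorem memLp_comp_restrict {E : Type*} [NormedAddCommGroup E] (I : Finset ℕ)
    (F : (∀ k : I, Γ k) → E) (p : ℝ≥0∞) :
    MemLp (fun x : ∀ k, Γ k => F (I.restrict x)) p (haarG Γ) := by
  have hF : StronglyMeasurable F := StronglyMeasurable.of_discrete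
  obtain ⟨C, hC⟩ := (Set.finite_range fun q => ‖F q‖).bddAbove
  exact MemLp.of_bound (hF.comp_measurable (Finset.measurable_restrict I)).aestronglyMeasurable C
    (ae_of_all _ fun x => hC ⟨_, rfl⟩)

theorem measurableSet_J (s : ℕ) (y : ∀ k, Γ k) : MeasurableSet (J s y) := by
  have : J s y = ⋂ i ∈ Finset.range s, (fun x : ∀ k, Γ k => x i) ⁻¹' {z | IsConj (y i) z} := by
    ext x
    simp [J]
  rw [this]
  exact Finset.measurableSet_biInter _ fun i _ =>
    measurable_pi_apply i (Set.toFinite _).measurableSet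

theorem haarG_real_J (s : ℕ) (y : ∀ k, Γ k) :
    (haarG Γ).real (J s y) = ∏ k ∈ Finset.range s, classMass (y k) := by
  have : J s y = Set.pi (Finset.range s) fun i => {z | IsConj (y i) z} := by
    ext x
    simp [J, Set.mem_pi]
  rw [this, measureReal_def, haarG,
    Measure.infinitePi_pi _ fun i _ => (Set.toFinite _).measurableSet, ENNReal.toReal_prod]
  rfl

open scoped Classical in
-- The key identity: the kernel of T_n is a rank-one kernel of the orthonormal system whose index
-- depends on y. Coordinates k < s give the normalized indicator of J_s(y), the others the
-- characters.
theorem mixedProd_mul_conj [∀ k, Nontrivial (Γ k)] {r : ∀ k, ℕ → Γ k → ℂ}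
    (hr : IsCharacterSystem Γ r) {A s n : ℕ} (hs : s ≤ A) (hn : n ∈ block Γ A) (x y : ∀ k, Γ k) :
    mixedProd r s (Finset.range (A + 1)) (fun k => mixedIdx s n k (y k)) y *
      conj (mixedProd r s (Finset.range (A + 1)) (fun k => mixedIdx s n k (y k)) x) =
      if x ∈ J s y then (((haarG Γ).real (J s y) : ℝ) : ℂ)⁻¹ *
        (chi r (tail Γ s n) y * conj (chi r (tail Γ s n) x)) else 0 := by
  have h1 : mixedProd r s (Finset.range (A + 1)) (fun k => mixedIdx s n k (y k)) y *
      conj (mixedProd r s (Finset.range (A + 1)) (fun k => mixedIdx s n k (y k)) x) =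
      (∏ k ∈ Finset.range (A + 1), if k < s then
        (if IsConj (y k) (x k) then ((classMass (y k) : ℝ) : ℂ)⁻¹ else 0) else 1) *
      (chi r (tail Γ s n) y * conj (chi r (tail Γ s n) x)) := by
    rw [mixedProd, mixedProd, chi_tail Γ (fun k => (hr k).2) hn, chi_tail Γ (fun k => (hr k).2) hn,
      map_prod, map_prod, ← Finset.prod_mul_distrib, ← Finset.prod_mul_distrib,
      ← Finset.prod_mul_distrib, ← Finset.prod_coe_sort (Finset.range (A + 1))]
    refine Finset.prod_congr rfl fun k _ => ?_
    by_cases h : (k : ℕ) < s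
    · have e : mixedIdx s n k (y k) = classIdx (y k) := if_pos h
      simp only [mixedFn, e, if_pos h, map_one, mul_one]
      exact classFn_mul_conj (x k) (y k)
    · have e : (mixedIdx s n k (y k) : ℕ) = dig Γ n k :=
        congrArg Fin.val (if_neg h)
      simp only [mixedFn, e, if_neg h, one_mul]
  -- Here s ≤ A is used: every coordinate below s occurs among those up to A.
  have h2 : (∏ k ∈ Finset.range (A + 1), if k < s then
        (if IsConj (y k) (x k) then ((classMass (y k) : ℝ) : ℂ)⁻¹ else 0) else 1) =
      ∏ k ∈ Finset.range s,
        (if IsConj (y k) (x k) then ((classMass (y k) : ℝ) : ℂ)⁻¹ else 0) := by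
    rw [← Finset.prod_filter]
    refine Finset.prod_congr (Finset.ext fun k => ?_) fun _ _ => rfl
    simp only [Finset.mem_filter, Finset.mem_range]
    lia
  rw [h1, h2]
  by_cases hx : x ∈ J s y
  · rw [if_pos hx, haarG_real_J, Complex.ofReal_prod, ← Finset.prod_inv_distrib]
    congr 1
    exact Finset.prod_congr rfl fun k hk => if_pos (hx k (Finset.mem_range.1 hk))
  · rw [if_neg hx]
    have : ∃ i < s, ¬ IsConj (y i) (x i) := by
      by_contra! h
      exact hx h
    obtain ⟨i, hi, hxi⟩ := this
    rw [Finset.prod_eq_zero (Finset.mem_range.2 hi) (if_neg hxi), zero_mul]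

/-- The averages are, at each point, multiples of Fourier coefficients. -/
theorem avg_eq_smul_integral [∀ k, Nontrivial (Γ k)] {E : Type*} [NormedAddCommGroup E]
    [NormedSpace ℂ E] {r : ∀ k, ℕ → Γ k → ℂ} (hr : IsCharacterSystem Γ r) {A s n : ℕ} (hs : s ≤ A)
    (hn : n ∈ block Γ A) (f : (∀ k, Γ k) → E) (y : ∀ k, Γ k) :
    avg r s n f y =
      mixedProd r s (Finset.range (A + 1)) (fun k => mixedIdx s n k (y k)) y •
        ∫ x, conj (mixedProd r s (Finset.range (A + 1)) (fun k => mixedIdx s n k (y k)) x) • f x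
          ∂(haarG Γ) := by
  rw [avg, ← integral_indicator (measurableSet_J s y), ← integral_smul, ← integral_smul]
  congr 1
  ext x
  rw [smul_smul, mixedProd_mul_conj hr hs hn]
  by_cases hx : x ∈ J s y
  · rw [Set.indicator_of_mem hx, if_pos hx, smul_smul]
  · rw [Set.indicator_of_notMem hx, if_neg hx, smul_zero, zero_smul]

end System

theorem lemma4p4
    {H : Type*} [NormedAddCommGroup H] [InnerProductSpace ℂ H] [CompleteSpace H]
    (M : VonNeumannAlgebra H) (τ : NSFTrace M)
    (Γ : ℕ → Type*) [∀ k, Group (Γ k)] [∀ k, Finite (Γ k)] [∀ k, Nontrivial (Γ k)]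
    [∀ k, MeasurableSpace (Γ k)] [∀ k, MeasurableSingletonClass (Γ k)]
    (r : ∀ k, ℕ → Γ k → ℂ) (hr : IsCharacterSystem Γ r)
    (A s : ℕ) (hs : s ≤ A) (f : L2N τ (haarG Γ)) :
    ∃ h : ∀ n : block Γ A, MemLp (avg r s n f) 2 (haarG Γ),
      maxNorm τ (haarG Γ) (fun n : block Γ A => (h n).toLp (avg r s n f)) ≤ ‖f‖ₑ := by
  classical
  have : ∀ k, Fintype (Γ k) := fun k => Fintype.ofFinite _
  set I := Finset.range (A + 1)
  let φ (m : ∀ k : I, Fin (numClasses Γ k)) (q : ∀ k : I, Γ k) : ℂ :=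
    ∏ k : I, mixedFn r s k (m k) (q k)
  have hφ : ∀ m x, mixedProd r s I m x = φ m (I.restrict x) := fun m x => rfl
  let v (m : ∀ k : I, Fin (numClasses Γ k)) : τ.L2 :=
    ∫ x, conj (mixedProd r s I m x) • f x ∂(haarG Γ)
  -- Selects which of the finitely many vectors φ m q • v m is the value of T_n f at a point over q.
  let δ (n : block Γ A) (q : ∀ k : I, Γ k) (k : I) : Fin (numClasses Γ k) :=
    mixedIdx s n k (q k)
  have hT : ∀ (n : block Γ A) y, avg r s n f y =
      φ (δ n (I.restrict y)) (I.restrict y) • v (δ n (I.restrict y)) := fun n y =>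
    avg_eq_smul_integral hr hs n.2 f y
  have hΨ : ∀ m p, MemLp (mixedProd r s I m) p (haarG Γ) := fun m p =>
    memLp_comp_restrict I (φ m) p
  have hmem : ∀ n : block Γ A, MemLp (avg r s n f) 2 (haarG Γ) := fun n => by
    rw [funext (hT n)]
    exact memLp_comp_restrict I (fun q => φ (δ n q) q • v (δ n q)) 2
  refine ⟨hmem, ?_⟩
  refine maxNorm_le_of_finite τ (haarG Γ) (Finset.measurable_restrict I) δ
    (fun m q => φ m q • v m) _ (fun n => ?_) ?_
  · filter_upwards [(hmem n).coeFn_toLp] with y hy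
    rw [hy, hT]
  have hbessel : ∑ m, ‖v m‖ ^ 2 ≤ ‖f‖ ^ 2 := by
    -- The Hilbert structure of L_2(M) is needed only for Bessel and is kept local.
    let _ := τ.innerL2
    exact sum_norm_integral_sq_le (fun m => hΨ m ∞) (mixedProd_orthonormal hr s I) f
  have hone : ∀ m, ∫⁻ x, ‖mixedProd r s I m x‖ₑ ^ 2 ∂(haarG Γ) = 1 := fun m => by
    have h1 := mixedProd_orthonormal hr s I m m
    simp_rw [Complex.mul_conj, if_true, Complex.normSq_eq_norm_sq] at h1
    rw [integral_complex_ofReal] at h1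
    have h2 : ∫ x, ‖mixedProd r s I m x‖ ^ 2 ∂(haarG Γ) = 1 := by exact_mod_cast h1
    have h3 : Integrable (fun x => ‖mixedProd r s I m x‖ ^ 2) (haarG Γ) :=
      (memLp_two_iff_integrable_sq_norm (hΨ m 2).1).1 (hΨ m 2)
    have h4 := ofReal_integral_eq_lintegral_ofReal h3 (ae_of_all _ fun x => by positivity)
    rw [h2, ENNReal.ofReal_one] at h4
    rw [h4]
    refine lintegral_congr fun x => ?_
    rw [← ofReal_norm, ENNReal.ofReal_pow (norm_nonneg _)]
  calc ∫⁻ x, ∑ m, ‖φ m (I.restrict x) • v m‖ₑ ^ 2 ∂(haarG Γ)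
      = ∑ m, ∫⁻ x, ‖mixedProd r s I m x‖ₑ ^ 2 * ‖v m‖ₑ ^ 2 ∂(haarG Γ) := by
        rw [lintegral_finsetSum']
        · refine Finset.sum_congr rfl fun m _ => lintegral_congr fun x => ?_
          rw [enorm_smul, mul_pow, hφ]
        · exact fun m _ => (memLp_comp_restrict I (fun q => φ m q • v m) 2).1.enorm.pow_const 2
    _ = ∑ m, ‖v m‖ₑ ^ 2 := by
        refine Finset.sum_congr rfl fun m _ => ?_
        rw [lintegral_mul_const'' _ ((hΨ m 2).1.enorm.pow_const 2), hone, one_mul]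
    _ = ENNReal.ofReal (∑ m, ‖v m‖ ^ 2) := by
        rw [ENNReal.ofReal_sum_of_nonneg fun m _ => by positivity]
        refine Finset.sum_congr rfl fun m _ => ?_
        rw [← ofReal_norm, ENNReal.ofReal_pow (norm_nonneg _)]
    _ ≤ ENNReal.ofReal (‖f‖ ^ 2) := ENNReal.ofReal_le_ofReal hbessel
    _ = ‖f‖ₑ ^ 2 := by rw [ENNReal.ofReal_pow (norm_nonneg _), ofReal_norm]
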